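/- **Setting.** Let $\lambda<0$, let $t_\bullet>0$, let $B$ ($=\partial\mathcal S_\star$) be a smooth surface, and let $\mathscr I_{t_\bullet}=[0,t_\bullet)\times B$ with points $(t,q)$. Indices $i,j,k$ refer to $\mathscr I_{t_\bullet}$, indices $a,b,c,\dots$ to spacetime. Brackets denote (anti)symmetrisation with the factor $\tfrac12$, and curvature is normalised by $\nabla_c\nabla_du^a-\nabla_d\nabla_cu^a=R^a{}_{bcd}u^b$. **Basic boundary data.** On $\mathscr I_{t_\bullet}$ let there be given the following smooth fields. * A Lorentzian metric $\ell_{ij}$ of signature $(-,+,+)$, with Levi-Civita derivative $D_i$, such that the leaves $\{t\}\times B$ are spacelike and their future unit normal $\nu_i$ is geodesic, $\nu^jD_j\nu_i=0$. Write $s_i{}^j=\ell_i{}^j+\nu_i\nu^j$, $k_{ij}=D_i\nu_j$, $k=s^{ij}k_{ij}$, $\delta=\nu^iD_i$, and let $\delta_i$ be the $s$-projection of $D_i$ (all free indices projected). * A function $\varkappa$, a symmetric $s$-tracefree tensor $w_{\{ij\}}$ with $\nu^jw_{\{ij\}}=0$, a covector $p_i$ with $\nu^ip_i=0$, and a function $p$.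 * A function $w$ and a covector $w_i$ with $\nu^iw_i=0$ (with arbitrary values at $t=0$) which solve on $\mathscr I_{t_\bullet}$ $$\delta^iw_i-\delta w=k^{ij}w_{\{ij\}}+\tfrac32kw-\Sigma p,\qquad 2\,\delta w_i-\delta_iw=-2kw_i-2w_jk_i{}^j+2\delta^jw_{\{ij\}}+2\Sigma p_i ,$$ with $\Sigma$ as below. **Constructed fields.** With $l_{ij}=r_{ij}-\tfrac14r\,\ell_{ij}$ the Schouten tensor of $\ell$ ($r_{ij}$, $r$ its Ricci tensor and scalar) and $y_{ijk}=D_il_{jk}-D_jl_{ik}$, put $$\Sigma=\sqrt{|\lambda|/3},\quad s=\Sigma\varkappa,\quad K_{ij}=\varkappa\,\ell_{ij},\quad L_i=-D_i\varkappa,\quad L_{ij}=l_{ij}-\tfrac12\varkappa^2\ell_{ij},\quad d_{kij}=-\Sigma^{-1}y_{ijk},$$ $$d_{ij}=w_{\{ij\}}+\tfrac12w\,s_{ij}-\nu_iw_j-\nu_jw_i+w\,\nu_i\nu_j,\qquad j_i=p_i-p\,\nu_i .$$ **Spacetime fields.** On the part $t\ge0$, $x^1\ge0$ of an open neighbourhood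 of $[0,t_\bullet)\times\{0\}\times B$ in $\mathbb R\times\mathbb R\times B$, with points $(t,x^1,q)$ and $\mathscr I_{t_\bullet}$ identified with $\{x^1=0,\ 0\le t<t_\bullet\}$, let $g_{ab}$ be a smooth Lorentzian metric of signature $(-,+,+,+)$, $\Xi$ and $s$ smooth functions, $L_{ab}$ a smooth symmetric tensor, $T_{ab}$ a smooth symmetric tracefree tensor, and $d_{abcd}$ a smooth tensor with the algebraic symmetries of a Weyl tensor. Let $n_a=\nabla_ax^1/|\nabla x^1|$, $\ell_a{}^b=\delta_a{}^b-n_an^b$, $K_{ab}=\ell_a{}^c\ell_b{}^d\nabla_cn_d$. Write $\simeq$ for equality on $\mathscr I_{t_\bullet}$, and suppose that these fields have the boundary values constructed above: $\Xi\simeq0$, the function $s$ restricts to $\Sigma\varkappa$, and $n^a\nabla_a\Xi\simeq\Sigma$; the pull-backs to $\mathscr I_{t_\bullet}$ of $$g_{ab},\quad K_{ab},\quad n^cL_{ca},\quad L_{ab},\quad n^bn^dd_{abcd},\quad n^bd_{abcd},\quad n^bT_{ab}$$ are, respectively, $\ell_{ij}$, $K_{ij}$, $L_i$, $L_{ij}$,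 $d_{ij}$, $d_{ijk}$, $j_i$. **Zero-quantities.** With the rescaled Cotton tensor $T_{abc}=\Xi\nabla_{[a}T_{b]c}-g_{c[a}T_{b]d}\nabla^d\Xi-3T_{c[a}\nabla_{b]}\Xi$, let $$\begin{aligned} \Upsilon_{ab}&=\nabla_a\nabla_b\Xi+\Xi L_{ab}-sg_{ab}-\tfrac12\Xi^3T_{ab},\\ \Theta_a&=\nabla_as+L_{ac}\nabla^c\Xi-\tfrac12\Xi^2T_{ab}\nabla^b\Xi,\\ \Delta_{abc}&=\nabla_aL_{bc}-\nabla_bL_{ac}-\nabla_d\Xi\,d^d{}_{cab}-\Xi T_{abc},\\ \Lambda_{abc}&=T_{bca}-\nabla_ed^e{}_{abc},\\ Z&=\lambda-6\Xi s+3\nabla^c\Xi\nabla_c\Xi,\\ P^a{}_{bcd}&=R^a{}_{bcd}-\Xi d^a{}_{bcd}-2\delta_{[c}{}^aL_{d]b}-2L_{[c}{}^ag_{d]b}. \end{aligned}$$ **Proposition.** On the whole cylinder $\mathscr I_{t_\bullet}=[0,t_\bullet)\times B$ one has $$\ell_b{}^a\Theta_a\simeq0,\quad Z\simeq0,\quad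 \ell_c{}^a\ell_d{}^b\Upsilon_{ab}\simeq0,\quad n^a\ell_c{}^b\Upsilon_{ab}\simeq0,$$ $$\ell_e{}^c\ell_f{}^d\ell_g{}^b\Delta_{cdb}\simeq0,\quad n^b\ell_e{}^c\ell_f{}^d\Delta_{cdb}\simeq0,\quad n^b\ell_e{}^c\ell_f{}^d\Lambda_{bcd}\simeq0,\quad n^bn^d\ell_e{}^c\Lambda_{bcd}\simeq0,$$ $$\ell_a{}^e\ell_b{}^f\ell_c{}^g\ell_d{}^hP_{efgh}\simeq0,\quad n^d\ell_a{}^e\ell_b{}^f\ell_c{}^gP_{edfg}\simeq0 .$$ -/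

import Mathlib

open scoped Manifold ContDiff

namespace ConformalBoundary

noncomputable section

/-! ## Tensor calculus for component functions in a coordinate domain

Component functions are defined on coordinate space `Fin n → ℝ`; `S` is the coordinate domain, which
may have boundary points, so that partial derivatives are taken within `S`. -/

/-- The partial derivative `∂_a f`, within the domain `S`. -/
def pd {n : ℕ} (S : Set (Fin n → ℝ)) (f : (Fin n → ℝ) → ℝ) (y : Fin n → ℝ) (a : Fin n) : ℝ :=
  fderivWithin ℝ f S y (Pi.single a 1)

/-- The contravariant metric `g^{ab}`. -/
def metricInv {n : ℕ} (g : (Fin n → ℝ) → Fin n → Fin n → ℝ) (y : Fin n → ℝ) (a b : Fin n) : ℝ :=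
  (Matrix.of (g y))⁻¹ a b

/-- The Christoffel symbol `Γ^a_{bc}` of the Levi-Civita connection. -/
def christoffel {n : ℕ} (S : Set (Fin n → ℝ)) (g : (Fin n → ℝ) → Fin n → Fin n → ℝ)
    (y : Fin n → ℝ) (a b c : Fin n) : ℝ :=
  1 / 2 * ∑ e, metricInv g y a e *
    (pd S (fun x => g x e c) y b + pd S (fun x => g x e b) y c - pd S (fun x => g x b c) y e)

/-- The curvature `R^a_{bcd}`, with `∇_c ∇_d u^a - ∇_d ∇_c u^a = R^a_{bcd} u^b`. -/
def riemann {n : ℕ} (S : Set (Fin n → ℝ)) (g : (Fin n → ℝ) → Fin n → Fin n → ℝ)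
    (y : Fin n → ℝ) (a b c d : Fin n) : ℝ :=
  pd S (fun x => christoffel S g x a d b) y c - pd S (fun x => christoffel S g x a c b) y d
    + ∑ e, (christoffel S g y a c e * christoffel S g y e d b
          - christoffel S g y a d e * christoffel S g y e c b)

/-- The Ricci tensor `R_{bd} = R^a_{bad}`. -/
def ricci {n : ℕ} (S : Set (Fin n → ℝ)) (g : (Fin n → ℝ) → Fin n → Fin n → ℝ)
    (y : Fin n → ℝ) (b d : Fin n) : ℝ :=
  ∑ a, riemann S g y a b a d

/-- The Ricci scalar. -/
def scalarCurv {n : ℕ} (S : Set (Fin n → ℝ)) (g : (Fin n → ℝ) → Fin n → Fin n → ℝ)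
    (y : Fin n → ℝ) : ℝ :=
  ∑ b, ∑ d, metricInv g y b d * ricci S g y b d

/-- `∇_a α_b`. -/
def cov1 {n : ℕ} (S : Set (Fin n → ℝ)) (g : (Fin n → ℝ) → Fin n → Fin n → ℝ)
    (α : (Fin n → ℝ) → Fin n → ℝ) (y : Fin n → ℝ) (a b : Fin n) : ℝ :=
  pd S (fun x => α x b) y a - ∑ e, christoffel S g y e a b * α y e

/-- `∇_a A_{bc}`. -/
def cov2 {n : ℕ} (S : Set (Fin n → ℝ)) (g : (Fin n → ℝ) → Fin n → Fin n → ℝ)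
    (A : (Fin n → ℝ) → Fin n → Fin n → ℝ) (y : Fin n → ℝ) (a b c : Fin n) : ℝ :=
  pd S (fun x => A x b c) y a
    - ∑ e, (christoffel S g y e a b * A y e c + christoffel S g y e a c * A y b e)

/-- `∇_a A_{bcdf}`. -/
def cov4 {n : ℕ} (S : Set (Fin n → ℝ)) (g : (Fin n → ℝ) → Fin n → Fin n → ℝ)
    (A : (Fin n → ℝ) → Fin n → Fin n → Fin n → Fin n → ℝ) (y : Fin n → ℝ)
    (a b c d f : Fin n) : ℝ :=
  pd S (fun x => A x b c d f) y a
    - ∑ e, (christoffel S g y e a b * A y e c d f + christoffel S g y e a c * A y b e d f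
          + christoffel S g y e a d * A y b c e f + christoffel S g y e a f * A y b c d e)

/-- A Gram matrix of signature `(-, +, …, +)`. -/
def IsLorentzian {n : ℕ} (G : Fin (n + 1) → Fin (n + 1) → ℝ) : Prop :=
  ∃ P : Matrix (Fin (n + 1)) (Fin (n + 1)) ℝ, IsUnit P.det ∧
    P.transpose * Matrix.of G * P = Matrix.diagonal (Fin.cons (-1) (fun _ => 1))

/-- The Kronecker delta. -/
def delta {n : ℕ} (a b : Fin n) : ℝ := if a = b then 1 else 0

/-! ## Fields on the conformal boundary `[0, t•) × B`, in coordinates `(t, y¹, y²)` -/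

/-- Components, in a coordinate domain of the boundary, of the fields
`ℓ_{ij}, ϰ, w_{{ij}}, w_i, w, p_i, p`, together with the cosmological constant. -/
structure BoundaryComponents where
  dom : Set (Fin 3 → ℝ)
  lam : ℝ
  ell : (Fin 3 → ℝ) → Fin 3 → Fin 3 → ℝ
  kappa : (Fin 3 → ℝ) → ℝ
  wTF : (Fin 3 → ℝ) → Fin 3 → Fin 3 → ℝ
  wVec : (Fin 3 → ℝ) → Fin 3 → ℝ
  w : (Fin 3 → ℝ) → ℝ
  pVec : (Fin 3 → ℝ) → Fin 3 → ℝ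
  p : (Fin 3 → ℝ) → ℝ

namespace BoundaryComponents

variable (X : BoundaryComponents)

/-- `ℓ^{ij}`. -/
def ellUp (z : Fin 3 → ℝ) (i j : Fin 3) : ℝ := metricInv X.ell z i j

/-- The future unit normal `ν_i = - dt / |dt|` of the leaves `t = const`, index down. -/
def nu (z : Fin 3 → ℝ) (i : Fin 3) : ℝ := -(delta i 0 / √(-X.ellUp z 0 0))

/-- `ν^i`. -/
def nuUp (z : Fin 3 → ℝ) (i : Fin 3) : ℝ := ∑ j, X.ellUp z i j * X.nu z j

/-- `s_{ij} = ℓ_{ij} + ν_i ν_j`. -/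
def sLow (z : Fin 3 → ℝ) (i j : Fin 3) : ℝ := X.ell z i j + X.nu z i * X.nu z j

/-- `s_i^j = ℓ_i^j + ν_i ν^j`. -/
def sMix (z : Fin 3 → ℝ) (i j : Fin 3) : ℝ := delta i j + X.nu z i * X.nuUp z j

/-- `s^{ij} = ℓ^{ij} + ν^i ν^j`. -/
def sUp (z : Fin 3 → ℝ) (i j : Fin 3) : ℝ := X.ellUp z i j + X.nuUp z i * X.nuUp z j

/-- The extrinsic curvature `k_{ij} = D_i ν_j` of the foliation. -/
def kExt (z : Fin 3 → ℝ) (i j : Fin 3) : ℝ := cov1 X.dom X.ell X.nu z i j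

/-- Its trace `k = s^{ij} k_{ij}`. -/
def kTr (z : Fin 3 → ℝ) : ℝ := ∑ i, ∑ j, X.sUp z i j * X.kExt z i j

/-- `D_i f` for a scalar. -/
def grad (f : (Fin 3 → ℝ) → ℝ) (z : Fin 3 → ℝ) (i : Fin 3) : ℝ := pd X.dom f z i

/-- `δ f = ν^i D_i f` for a scalar. -/
def normalD0 (f : (Fin 3 → ℝ) → ℝ) (z : Fin 3 → ℝ) : ℝ := ∑ i, X.nuUp z i * X.grad f z i

/-- `δ α_i = ν^j D_j α_i`. -/
def normalD1 (α : (Fin 3 → ℝ) → Fin 3 → ℝ) (z : Fin 3 → ℝ) (i : Fin 3) : ℝ :=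
  ∑ j, X.nuUp z j * cov1 X.dom X.ell α z j i

/-- `δ_i f = s_i^j D_j f`, the derivative intrinsic to the leaves. -/
def leafD0 (f : (Fin 3 → ℝ) → ℝ) (z : Fin 3 → ℝ) (i : Fin 3) : ℝ :=
  ∑ j, X.sMix z i j * X.grad f z j

/-- `δ^i α_i = s^{ij} D_i α_j`. -/
def leafDiv1 (α : (Fin 3 → ℝ) → Fin 3 → ℝ) (z : Fin 3 → ℝ) : ℝ :=
  ∑ i, ∑ j, X.sUp z i j * cov1 X.dom X.ell α z i j

/-- `δ^j A_{ij} = s_i^a s^{bj} D_b A_{aj}`. -/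
def leafDiv2 (A : (Fin 3 → ℝ) → Fin 3 → Fin 3 → ℝ) (z : Fin 3 → ℝ) (i : Fin 3) : ℝ :=
  ∑ a, ∑ b, ∑ j, X.sMix z i a * X.sUp z b j * cov2 X.dom X.ell A z b a j

/-! The fields constructed from the boundary data. -/

/-- `Σ = √(|λ| / 3)`. -/
def Sig : ℝ := √(|X.lam| / 3)

/-- `s = Σ ϰ`. -/
def friedrich (z : Fin 3 → ℝ) : ℝ := X.Sig * X.kappa z

/-- `K_{ij} = ϰ ℓ_{ij}`. -/
def K (z : Fin 3 → ℝ) (i j : Fin 3) : ℝ := X.kappa z * X.ell z i j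

/-- `L_i = - D_i ϰ`. -/
def L1 (z : Fin 3 → ℝ) (i : Fin 3) : ℝ := -X.grad X.kappa z i

/-- The Schouten tensor `l_{ij} = r_{ij} - r ℓ_{ij} / 4` of `ℓ`. -/
def schouten (z : Fin 3 → ℝ) (i j : Fin 3) : ℝ :=
  ricci X.dom X.ell z i j - 1 / 4 * scalarCurv X.dom X.ell z * X.ell z i j

/-- `L_{ij} = l_{ij} - ϰ² ℓ_{ij} / 2`. -/
def L2 (z : Fin 3 → ℝ) (i j : Fin 3) : ℝ :=
  X.schouten z i j - 1 / 2 * X.kappa z ^ 2 * X.ell z i j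

/-- The Cotton tensor `y_{ijk} = D_i l_{jk} - D_j l_{ik}` of `ℓ`. -/
def cotton (z : Fin 3 → ℝ) (i j k : Fin 3) : ℝ :=
  cov2 X.dom X.ell X.schouten z i j k - cov2 X.dom X.ell X.schouten z j i k

/-- `d_{kij} = - Σ⁻¹ y_{ijk}`. -/
def d3 (z : Fin 3 → ℝ) (k i j : Fin 3) : ℝ := -(X.Sig⁻¹ * X.cotton z i j k)

/-- `w_{ij} = w_{{ij}} + w s_{ij} / 2`. -/
def wFull (z : Fin 3 → ℝ) (i j : Fin 3) : ℝ := X.wTF z i j + 1 / 2 * X.w z * X.sLow z i j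

/-- `d_{ij} = w_{ij} - ν_i w_j - ν_j w_i + w ν_i ν_j`. -/
def d2 (z : Fin 3 → ℝ) (i j : Fin 3) : ℝ :=
  X.wFull z i j - X.nu z i * X.wVec z j - X.nu z j * X.wVec z i + X.w z * X.nu z i * X.nu z j

/-- `j_i = p_i - p ν_i`. -/
def j1 (z : Fin 3 → ℝ) (i : Fin 3) : ℝ := X.pVec z i - X.p z * X.nu z i

/-- The requirements on the basic boundary data in a coordinate domain. -/
structure IsAdmissible : Prop where
  smooth_ell : ∀ i j, ContDiffOn ℝ ∞ (fun z => X.ell z i j) X.dom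
  smooth_kappa : ContDiffOn ℝ ∞ X.kappa X.dom
  smooth_wTF : ∀ i j, ContDiffOn ℝ ∞ (fun z => X.wTF z i j) X.dom
  smooth_wVec : ∀ i, ContDiffOn ℝ ∞ (fun z => X.wVec z i) X.dom
  smooth_w : ContDiffOn ℝ ∞ X.w X.dom
  smooth_pVec : ∀ i, ContDiffOn ℝ ∞ (fun z => X.pVec z i) X.dom
  smooth_p : ContDiffOn ℝ ∞ X.p X.dom
  lorentzian : ∀ z ∈ X.dom, IsLorentzian (X.ell z)
  /-- the leaves `t = const` are spacelike, that is, `dt` is timelike -/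
  leaves_spacelike : ∀ z ∈ X.dom, X.ellUp z 0 0 < 0
  /-- the acceleration `ν^j D_j ν_i` vanishes -/
  geodesic : ∀ z ∈ X.dom, ∀ i, X.normalD1 X.nu z i = 0
  wTF_symm : ∀ z ∈ X.dom, ∀ i j, X.wTF z i j = X.wTF z j i
  wTF_spatial : ∀ z ∈ X.dom, ∀ i, ∑ j, X.nuUp z j * X.wTF z i j = 0
  wTF_tracefree : ∀ z ∈ X.dom, ∑ i, ∑ j, X.sUp z i j * X.wTF z i j = 0
  wVec_spatial : ∀ z ∈ X.dom, ∑ i, X.nuUp z i * X.wVec z i = 0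
  pVec_spatial : ∀ z ∈ X.dom, ∑ i, X.nuUp z i * X.pVec z i = 0
  /-- `δ^i w_i - δ w = k^{ij} w_{{ij}} + (3/2) k w - Σ p` -/
  evolution_w : ∀ z ∈ X.dom,
    X.leafDiv1 X.wVec z - X.normalD0 X.w z =
      (∑ i, ∑ j, ∑ a, ∑ b, X.ellUp z i a * X.ellUp z j b * X.kExt z a b * X.wTF z i j)
        + 3 / 2 * X.kTr z * X.w z - X.Sig * X.p z
  /-- `2 δ w_i - δ_i w = - 2 k w_i - 2 w_j k_i^j + 2 δ^j w_{{ij}} + 2 Σ p_i` -/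
  evolution_wVec : ∀ z ∈ X.dom, ∀ i,
    2 * X.normalD1 X.wVec z i - X.leafD0 X.w z i =
      -2 * X.kTr z * X.wVec z i
        - 2 * (∑ j, ∑ a, X.wVec z j * X.ellUp z j a * X.kExt z i a)
        + 2 * X.leafDiv2 X.wTF z i + 2 * X.Sig * X.pVec z i

end BoundaryComponents

/-! ## Fields on the unphysical spacetime, in coordinates `x⁰ = t`, `x¹`, `x²`, `x³`

The spacetime lies in `x¹ ≥ 0` and the conformal boundary is `x¹ = 0`. -/

/-- Components, in a coordinate domain of the spacetime, of the fields
`g_{ab}, Ξ, s, L_{ab}, d_{abcd}, T_{ab}`, together with the cosmological constant. -/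
structure BulkComponents where
  dom : Set (Fin 4 → ℝ)
  lam : ℝ
  g : (Fin 4 → ℝ) → Fin 4 → Fin 4 → ℝ
  Xi : (Fin 4 → ℝ) → ℝ
  s : (Fin 4 → ℝ) → ℝ
  L : (Fin 4 → ℝ) → Fin 4 → Fin 4 → ℝ
  d : (Fin 4 → ℝ) → Fin 4 → Fin 4 → Fin 4 → Fin 4 → ℝ
  T : (Fin 4 → ℝ) → Fin 4 → Fin 4 → ℝ

namespace BulkComponents

variable (F : BulkComponents)

/-- `g^{ab}`. -/
def gUp (y : Fin 4 → ℝ) (a b : Fin 4) : ℝ := metricInv F.g y a b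

/-- `∇_a Ξ`. -/
def dXi (y : Fin 4 → ℝ) (a : Fin 4) : ℝ := pd F.dom F.Xi y a

/-- `∇^a Ξ`. -/
def gradXi (y : Fin 4 → ℝ) (a : Fin 4) : ℝ := ∑ b, F.gUp y a b * F.dXi y b

/-- The rescaled Cotton tensor
`T_{abc} = Ξ ∇_{[a} T_{b]c} - g_{c[a} T_{b]e} ∇^e Ξ - 3 T_{c[a} ∇_{b]} Ξ`. -/
def rescaledCotton (y : Fin 4 → ℝ) (a b c : Fin 4) : ℝ :=
  F.Xi y * (1 / 2 * (cov2 F.dom F.g F.T y a b c - cov2 F.dom F.g F.T y b a c))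
    - ∑ e, 1 / 2 * (F.g y c a * F.T y b e - F.g y c b * F.T y a e) * F.gradXi y e
    - 3 * (1 / 2 * (F.T y c a * F.dXi y b - F.T y c b * F.dXi y a))

/-! The geometric zero-quantities. -/

/-- `Υ_{ab} = ∇_a ∇_b Ξ + Ξ L_{ab} - s g_{ab} - Ξ³ T_{ab} / 2`. -/
def Upsilon (y : Fin 4 → ℝ) (a b : Fin 4) : ℝ :=
  cov1 F.dom F.g F.dXi y a b + F.Xi y * F.L y a b - F.s y * F.g y a b
    - 1 / 2 * F.Xi y ^ 3 * F.T y a b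

/-- `Θ_a = ∇_a s + L_{ac} ∇^c Ξ - Ξ² T_{ab} ∇^b Ξ / 2`. -/
def Theta (y : Fin 4 → ℝ) (a : Fin 4) : ℝ :=
  pd F.dom F.s y a + (∑ c, F.L y a c * F.gradXi y c)
    - 1 / 2 * F.Xi y ^ 2 * ∑ b, F.T y a b * F.gradXi y b

/-- `Δ_{abc} = ∇_a L_{bc} - ∇_b L_{ac} - ∇_e Ξ d^e_{cab} - Ξ T_{abc}`. -/
def Delta (y : Fin 4 → ℝ) (a b c : Fin 4) : ℝ :=
  cov2 F.dom F.g F.L y a b c - cov2 F.dom F.g F.L y b a c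
    - (∑ e, F.gradXi y e * F.d y e c a b) - F.Xi y * F.rescaledCotton y a b c

/-- `Λ_{abc} = T_{bca} - ∇_e d^e_{abc}`. -/
def Lambda (y : Fin 4 → ℝ) (a b c : Fin 4) : ℝ :=
  F.rescaledCotton y b c a - ∑ e, ∑ f, F.gUp y e f * cov4 F.dom F.g F.d y e f a b c

/-- `Z = λ - 6 Ξ s + 3 ∇^c Ξ ∇_c Ξ`. -/
def Zq (y : Fin 4 → ℝ) : ℝ :=
  F.lam - 6 * F.Xi y * F.s y + 3 * ∑ c, F.gradXi y c * F.dXi y c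

/-- `P_{abcd} = R_{abcd} - Ξ d_{abcd} - 2 g_{a[c} L_{d]b} - 2 L_{a[c} g_{d]b}`. -/
def Pq (y : Fin 4 → ℝ) (a b c d : Fin 4) : ℝ :=
  (∑ e, F.g y a e * riemann F.dom F.g y e b c d) - F.Xi y * F.d y a b c d
    - (F.g y a c * F.L y d b - F.g y a d * F.L y c b)
    - (F.L y a c * F.g y d b - F.L y a d * F.g y c b)

/-! The geometry of the hypersurfaces `x¹ = const`. -/

/-- The unit normal `n_a = ∇_a x¹ / |∇ x¹|`. -/
def nLow (y : Fin 4 → ℝ) (a : Fin 4) : ℝ := delta a 1 / √(F.gUp y 1 1)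

/-- `n^a`. -/
def nUp (y : Fin 4 → ℝ) (a : Fin 4) : ℝ := ∑ b, F.gUp y a b * F.nLow y b

/-- The projector `ℓ_a^b = δ_a^b - n_a n^b`. -/
def proj (y : Fin 4 → ℝ) (a b : Fin 4) : ℝ := delta a b - F.nLow y a * F.nUp y b

/-- The extrinsic curvature `K_{ab} = ℓ_a^c ℓ_b^e ∇_c n_e`. -/
def extrinsic (y : Fin 4 → ℝ) (a b : Fin 4) : ℝ :=
  ∑ c, ∑ e, F.proj y a c * F.proj y b e * cov1 F.dom F.g F.nLow y c e

/-- The requirements on the spacetime fields in a coordinate domain: smoothness, signature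
and algebraic symmetries (`d` has those of a Weyl tensor, `T` is tracefree). -/
structure IsAdmissible : Prop where
  smooth_g : ∀ a b, ContDiffOn ℝ ∞ (fun y => F.g y a b) F.dom
  smooth_Xi : ContDiffOn ℝ ∞ F.Xi F.dom
  smooth_s : ContDiffOn ℝ ∞ F.s F.dom
  smooth_L : ∀ a b, ContDiffOn ℝ ∞ (fun y => F.L y a b) F.dom
  smooth_d : ∀ a b c e, ContDiffOn ℝ ∞ (fun y => F.d y a b c e) F.dom
  smooth_T : ∀ a b, ContDiffOn ℝ ∞ (fun y => F.T y a b) F.dom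
  lorentzian : ∀ y ∈ F.dom, IsLorentzian (F.g y)
  L_symm : ∀ y ∈ F.dom, ∀ a b, F.L y a b = F.L y b a
  d_antisymm_left : ∀ y ∈ F.dom, ∀ a b c e, F.d y a b c e = -F.d y b a c e
  d_antisymm_right : ∀ y ∈ F.dom, ∀ a b c e, F.d y a b c e = -F.d y a b e c
  d_pair : ∀ y ∈ F.dom, ∀ a b c e, F.d y a b c e = F.d y c e a b
  d_cyclic : ∀ y ∈ F.dom, ∀ a b c e, F.d y a b c e + F.d y a c e b + F.d y a e b c = 0
  d_tracefree : ∀ y ∈ F.dom, ∀ b e, ∑ a, ∑ c, F.gUp y a c * F.d y a b c e = 0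
  T_symm : ∀ y ∈ F.dom, ∀ a b, F.T y a b = F.T y b a
  T_tracefree : ∀ y ∈ F.dom, ∑ a, ∑ b, F.gUp y a b * F.T y a b = 0

end BulkComponents

/-- The inclusion of the boundary, `(t, y¹, y²) ↦ (t, 0, y¹, y²)`. -/
def bdryPoint (z : Fin 3 → ℝ) : Fin 4 → ℝ := ![z 0, 0, z 1, z 2]

/-- The index in the spacetime of a coordinate of the boundary: `0 ↦ 0`, `1 ↦ 2`, `2 ↦ 3`. -/
def tang (i : Fin 3) : Fin 4 := ![0, 2, 3] i

/-- On the coordinate domain of `X`, the spacetime fields `F` have the boundary values that are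
constructed from `X`. -/
structure HasBoundaryValues (F : BulkComponents) (X : BoundaryComponents) : Prop where
  Xi_eq : ∀ z ∈ X.dom, F.Xi (bdryPoint z) = 0
  Sig_eq : ∀ z ∈ X.dom, ∑ a, F.nUp (bdryPoint z) a * F.dXi (bdryPoint z) a = X.Sig
  s_eq : ∀ z ∈ X.dom, F.s (bdryPoint z) = X.friedrich z
  ell_eq : ∀ z ∈ X.dom, ∀ i j, F.g (bdryPoint z) (tang i) (tang j) = X.ell z i j
  K_eq : ∀ z ∈ X.dom, ∀ i j, F.extrinsic (bdryPoint z) (tang i) (tang j) = X.K z i j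
  L1_eq : ∀ z ∈ X.dom, ∀ i,
    ∑ c, F.nUp (bdryPoint z) c * F.L (bdryPoint z) c (tang i) = X.L1 z i
  L2_eq : ∀ z ∈ X.dom, ∀ i j, F.L (bdryPoint z) (tang i) (tang j) = X.L2 z i j
  d2_eq : ∀ z ∈ X.dom, ∀ i j,
    ∑ b, ∑ e, F.nUp (bdryPoint z) b * F.nUp (bdryPoint z) e *
      F.d (bdryPoint z) (tang i) b (tang j) e = X.d2 z i j
  d3_eq : ∀ z ∈ X.dom, ∀ i j k,
    ∑ b, F.nUp (bdryPoint z) b * F.d (bdryPoint z) (tang i) b (tang j) (tang k) = X.d3 z i j k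
  j1_eq : ∀ z ∈ X.dom, ∀ i,
    ∑ b, F.nUp (bdryPoint z) b * F.T (bdryPoint z) (tang i) b = X.j1 z i

/-! ## Tensor fields on manifolds

`B` is a smooth surface. Boundary tensor fields live on `ℝ × B`, spacetime tensor fields on
`ℝ × ℝ × B`, with points `(t, x¹, q)`; only their values on the regions below matter. -/

section Global

variable (B : Type*) [TopologicalSpace B] [ChartedSpace (EuclideanSpace ℝ (Fin 2)) B]

/-- Covariant tensors of rank `k` on the boundary. -/
abbrev BdryTensor (k : ℕ) : Type _ :=
  (p : ℝ × B) → MultilinearMap ℝ (fun _ : Fin k => ℝ × TangentSpace (𝓡 2) p.2) ℝ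

/-- Covariant tensors of rank `k` on the spacetime. -/
abbrev BulkTensor (k : ℕ) : Type _ :=
  (p : ℝ × ℝ × B) → MultilinearMap ℝ (fun _ : Fin k => ℝ × ℝ × TangentSpace (𝓡 2) p.2.2) ℝ

/-- The basic boundary fields on `[0, tEnd) × B`. -/
structure BoundaryFields where
  tEnd : ℝ
  ell : BdryTensor B 2
  kappa : ℝ × B → ℝ
  wTF : BdryTensor B 2
  wVec : BdryTensor B 1
  w : ℝ × B → ℝ
  pVec : BdryTensor B 1
  p : ℝ × B → ℝ

/-- The spacetime fields `g_{ab}, Ξ, s, L_{ab}, d_{abcd}, T_{ab}`. They are considered on the part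
`t ≥ 0, x¹ ≥ 0` of the open set `region`. -/
structure BulkFields where
  region : Set (ℝ × ℝ × B)
  g : BulkTensor B 2
  Xi : ℝ × ℝ × B → ℝ
  s : ℝ × ℝ × B → ℝ
  L : BulkTensor B 2
  d : BulkTensor B 4
  T : BulkTensor B 2

variable {B}
variable (e : OpenPartialHomeomorph B (EuclideanSpace ℝ (Fin 2)))

/-- The coordinate vector `∂_A` of the chart `e` of `B` at the point with coordinates `u`. -/
def surfaceVec (u : EuclideanSpace ℝ (Fin 2)) (A : Fin 2) : TangentSpace (𝓡 2) (e.symm u) :=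
  mfderiv (𝓡 2) (𝓡 2) e.symm u (EuclideanSpace.single A (1 : ℝ))

/-- The point of `ℝ × B` with coordinates `z`. -/
def bdryPt (z : Fin 3 → ℝ) : ℝ × B := (z 0, e.symm !₂[z 1, z 2])

/-- The coordinate vectors `∂_t, ∂_2, ∂_3` at that point. -/
def bdryVec (z : Fin 3 → ℝ) : Fin 3 → ℝ × TangentSpace (𝓡 2) (bdryPt e z).2 :=
  ![(1, 0), (0, surfaceVec e !₂[z 1, z 2] 0), (0, surfaceVec e !₂[z 1, z 2] 1)]

/-- The components of a boundary tensor in the chart `e`. -/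
def bdryComp {k : ℕ} (A : BdryTensor B k) (z : Fin 3 → ℝ) (i : Fin k → Fin 3) : ℝ :=
  A (bdryPt e z) (fun m => bdryVec e z (i m))

/-- The point of `ℝ × ℝ × B` with coordinates `y`. -/
def bulkPt (y : Fin 4 → ℝ) : ℝ × ℝ × B := (y 0, y 1, e.symm !₂[y 2, y 3])

/-- The coordinate vectors `∂_0, ∂_1, ∂_2, ∂_3` at that point. -/
def bulkVec (y : Fin 4 → ℝ) : Fin 4 → ℝ × ℝ × TangentSpace (𝓡 2) (bulkPt e y).2.2 :=
  ![(1, 0, 0), (0, 1, 0), (0, 0, surfaceVec e !₂[y 2, y 3] 0),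
    (0, 0, surfaceVec e !₂[y 2, y 3] 1)]

/-- The components of a spacetime tensor in the chart `e`. -/
def bulkComp {k : ℕ} (A : BulkTensor B k) (y : Fin 4 → ℝ) (a : Fin k → Fin 4) : ℝ :=
  A (bulkPt e y) (fun m => bulkVec e y (a m))

/-- The boundary fields in the chart `e`, with cosmological constant `lam`. -/
def BoundaryFields.inChart (X : BoundaryFields B) (lam : ℝ) : BoundaryComponents where
  dom := {z | 0 ≤ z 0 ∧ z 0 < X.tEnd ∧ !₂[z 1, z 2] ∈ e.target}
  lam := lam
  ell z i j := bdryComp e X.ell z ![i, j]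
  kappa z := X.kappa (bdryPt e z)
  wTF z i j := bdryComp e X.wTF z ![i, j]
  wVec z i := bdryComp e X.wVec z ![i]
  w z := X.w (bdryPt e z)
  pVec z i := bdryComp e X.pVec z ![i]
  p z := X.p (bdryPt e z)

/-- The spacetime fields in the chart `e`, with cosmological constant `lam`. -/
def BulkFields.inChart (F : BulkFields B) (lam : ℝ) : BulkComponents where
  dom := {y | 0 ≤ y 0 ∧ 0 ≤ y 1 ∧ !₂[y 2, y 3] ∈ e.target ∧ bulkPt e y ∈ F.region}
  lam := lam
  g y a b := bulkComp e F.g y ![a, b]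
  Xi y := F.Xi (bulkPt e y)
  s y := F.s (bulkPt e y)
  L y a b := bulkComp e F.L y ![a, b]
  d y a b c f := bulkComp e F.d y ![a, b, c, f]
  T y a b := bulkComp e F.T y ![a, b]

/-- `region` is an open neighbourhood of the cylinder `[0, tEnd) × {0} × B`. -/
def BulkFields.IsCollarOf (F : BulkFields B) (X : BoundaryFields B) : Prop :=
  IsOpen F.region ∧ ∀ t q, 0 ≤ t → t < X.tEnd → (t, 0, q) ∈ F.region

end Global

end

end ConformalBoundary

/-!
The zero-quantities are tensors on the spacetime, and each claim is an identity at the boundary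
`x¹ = 0` between values and *tangential* derivatives of the given fields. Contractions with
the projector `ℓ_a^b` only see the tangential components (`BoundaryProblem.proj_one`), so that it
suffices to verify the claims for the coordinate indices of the boundary.

*Algebra.* All coordinate expressions are moved to the ring of smooth functions on the coordinate
domain (`smoothFunctions`), with the partial derivatives as commuting derivations (`partialD`).
Tensor calculus is done over an abstract commutative ring with derivations: metric connections,
Levi-Civita connections, their curvature and the Bianchi identities. Restriction to the boundary is
a ring homomorphism that intertwines tangential derivatives (`restrict_partialD`). Hence the
spacetime connection restricts to a metric connection of rank four along three directions, for
which the boundary is umbilic with extrinsic curvature `ϰ ℓ_{ij}` (`IsUmbilicBoundary`). The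
formulas of Gauss and Weingarten express tangential covariant derivatives by intrinsic ones.

*The claims.*
* Since `Ξ` vanishes on the boundary, `∇_a Ξ = Σ n_a` there. The claims for `Θ`, `Z`, `Υ` are then
  direct, with `s = Σ ϰ` and `L_i = -D_i ϰ`.
* `Δ`: the antisymmetrised tangential derivative of `L_{jk}` is the Cotton tensor of the boundary,
  which cancels `∇_e Ξ d^e_{kij} = Σ d_{ekij} n^e`. The component with one normal is the
  antisymmetrised Hessian of `ϰ`.
* `Λ`: antisymmetry of `d_{abcd}` in its first two indices removes the transversal derivative from
  `n^b ∇^e d_{ebcd}` (`BoundaryProblem.sum_nUp_div_d`). With two tangential indices the claim becomes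
  that the Cotton tensor of a metric is divergence-free over its last index
  (`IsLeviCivita.div_cot`). With a second normal it becomes `D^j d_{ij} = -Σ j_i`, which is the
  content of the evolution equations for `w` and `w_i` along the geodesic foliation
  (`IsGeodesicFoliation.divergence`).
* `P`: these are the Gauss and Codazzi equations of an umbilic hypersurface
  (`IsUmbilicBoundary.gauss`, `IsUmbilicBoundary.codazzi`). The boundary has dimension three, where
  the curvature tensor is determined by the Schouten tensor (`riemann_eq_schouten_of_dim_three`).
-/

namespace ConformalBoundary

noncomputable section

/-! ### The differential ring of smooth functions on a coordinate domain -/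

/-- A coordinate domain, possibly with boundary and corners, on which partial derivatives are
well defined and commute. -/
structure IsRegularDomain {n : ℕ} (S : Set (Fin n → ℝ)) : Prop where
  uniqueDiff : UniqueDiffOn ℝ S
  mem_closure : ∀ y ∈ S, y ∈ closure (interior S)

theorem IsRegularDomain.convex_inter_open {n : ℕ} {Q U : Set (Fin n → ℝ)} (hQ : Convex ℝ Q)
    (hQi : (interior Q).Nonempty) (hU : IsOpen U) : IsRegularDomain (Q ∩ U) where
  uniqueDiff := (uniqueDiffOn_convex hQ hQi).inter hU
  mem_closure := by
    rintro y ⟨hy, hyU⟩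
    have h1 : y ∈ closure (interior Q) := by
      rw [hQ.closure_interior_eq_closure_of_nonempty_interior hQi]
      exact subset_closure hy
    rw [interior_inter, hU.interior_eq]
    exact hU.closure_inter ⟨h1, hyU⟩

/-- The ring of functions on `S` that are smooth up to the boundary points of `S`. -/
def smoothFunctions {n : ℕ} (S : Set (Fin n → ℝ)) : Subalgebra ℝ (S → ℝ) where
  carrier := {f | ∃ φ : (Fin n → ℝ) → ℝ, ContDiffOn ℝ ∞ φ S ∧ ∀ y : S, φ y = f y}
  mul_mem' := by
    rintro f g ⟨φ, hφ, h1⟩ ⟨ψ, hψ, h2⟩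
    exact ⟨fun y => φ y * ψ y, hφ.mul hψ, fun y => by simp [h1, h2]⟩
  add_mem' := by
    rintro f g ⟨φ, hφ, h1⟩ ⟨ψ, hψ, h2⟩
    exact ⟨fun y => φ y + ψ y, hφ.add hψ, fun y => by simp [h1, h2]⟩
  algebraMap_mem' r := ⟨fun _ => r, contDiffOn_const, fun y => by simp⟩

variable {n : ℕ} {S : Set (Fin n → ℝ)}

/-- Evaluation of a smooth function at a point of the domain. -/
def evalAt (y : S) : smoothFunctions S →ₐ[ℝ] ℝ :=
  (Pi.evalAlgHom ℝ (fun _ : S => ℝ) y).comp (smoothFunctions S).val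

theorem smoothFunctions_ext {f g : smoothFunctions S} (h : ∀ y, evalAt y f = evalAt y g) :
    f = g := Subtype.ext (funext h)

/-- The element `f` of the ring is the restriction to `S` of the function `φ`. -/
def Represents (φ : (Fin n → ℝ) → ℝ) (f : smoothFunctions S) : Prop :=
  ∀ y : S, φ y = evalAt y f

/-- The restriction to `S` of a function that is smooth on `S`. -/
def ofSmooth (φ : (Fin n → ℝ) → ℝ) (hφ : ContDiffOn ℝ ∞ φ S) : smoothFunctions S :=
  ⟨fun y => φ y, φ, hφ, fun _ => rfl⟩

theorem represents_ofSmooth (φ : (Fin n → ℝ) → ℝ) (hφ : ContDiffOn ℝ ∞ φ S) :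
    Represents φ (ofSmooth φ hφ) := fun _ => rfl

@[simp]
theorem evalAt_ofSmooth (φ : (Fin n → ℝ) → ℝ) (hφ : ContDiffOn ℝ ∞ φ S) (y : S) :
    evalAt y (ofSmooth φ hφ) = φ y := rfl

/-- Some function on coordinate space that restricts to `f`. -/
def extension (f : smoothFunctions S) : (Fin n → ℝ) → ℝ := f.2.choose

theorem extension_smooth (f : smoothFunctions S) : ContDiffOn ℝ ∞ (extension f) S :=
  f.2.choose_spec.1

theorem represents_extension (f : smoothFunctions S) : Represents (extension f) f :=
  f.2.choose_spec.2

theorem pd_congr {φ ψ : (Fin n → ℝ) → ℝ} (h : ∀ y ∈ S, φ y = ψ y) {y : Fin n → ℝ} (hy : y ∈ S)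
    (a : Fin n) : pd S φ y a = pd S ψ y a := by
  rw [pd, pd, fderivWithin_congr h (h y hy)]

theorem pd_smooth (hS : IsRegularDomain S) {φ : (Fin n → ℝ) → ℝ} (hφ : ContDiffOn ℝ ∞ φ S)
    (a : Fin n) : ContDiffOn ℝ ∞ (fun y => pd S φ y a) S :=
  (hφ.fderivWithin hS.uniqueDiff (by simp)).clm_apply contDiffOn_const

theorem differentiableWithinAt_extension (f : smoothFunctions S) (y : S) :
    DifferentiableWithinAt ℝ (extension f) S y :=
  (extension_smooth f).differentiableOn (by simp) y y.2

/-- The partial derivative `∂_a`, as a derivation of the ring of smooth functions. -/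
def partialD (hS : IsRegularDomain S) (a : Fin n) :
    Derivation ℝ (smoothFunctions S) (smoothFunctions S) :=
  Derivation.mk'
    { toFun := fun f => ofSmooth (fun y => pd S (extension f) y a)
        (pd_smooth hS (extension_smooth f) a)
      map_add' := fun f g => by
        refine smoothFunctions_ext fun y => ?_
        simp only [map_add, evalAt_ofSmooth]
        rw [pd_congr (ψ := fun x => extension f x + extension g x) _ y.2]
        · unfold pd
          rw [fderivWithin_fun_add (hS.uniqueDiff y y.2) (differentiableWithinAt_extension f y)
            (differentiableWithinAt_extension g y)]
          rfl
        · intro x hx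
          rw [represents_extension _ ⟨x, hx⟩, represents_extension _ ⟨x, hx⟩,
            represents_extension _ ⟨x, hx⟩, map_add]
      map_smul' := fun r f => by
        refine smoothFunctions_ext fun y => ?_
        simp only [map_smul, evalAt_ofSmooth, RingHom.id_apply]
        rw [pd_congr (ψ := fun x => r • extension f x) _ y.2]
        · unfold pd
          rw [fderivWithin_fun_const_smul (hS.uniqueDiff y y.2)
            (differentiableWithinAt_extension f y) r]
          rfl
        · intro x hx
          rw [represents_extension _ ⟨x, hx⟩, represents_extension _ ⟨x, hx⟩, map_smul] }
    (fun f g => by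
      refine smoothFunctions_ext fun y => ?_
      simp only [LinearMap.coe_mk, AddHom.coe_mk, map_add, smul_eq_mul, map_mul, evalAt_ofSmooth]
      rw [pd_congr (ψ := fun x => extension f x * extension g x) _ y.2]
      · unfold pd
        rw [fderivWithin_fun_mul (hS.uniqueDiff y y.2) (differentiableWithinAt_extension f y)
          (differentiableWithinAt_extension g y)]
        simp [represents_extension _ y]
      · intro x hx
        rw [represents_extension _ ⟨x, hx⟩, represents_extension _ ⟨x, hx⟩,
          represents_extension _ ⟨x, hx⟩, map_mul])

/-- Partial derivatives of functions are computed by the derivations of the ring of smooth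
functions. -/
theorem Represents.pd_eq (hS : IsRegularDomain S) {φ : (Fin n → ℝ) → ℝ} {f : smoothFunctions S}
    (h : Represents φ f) (y : S) (a : Fin n) : pd S φ y a = evalAt y (partialD hS a f) :=
  pd_congr (fun x hx => (h ⟨x, hx⟩).trans (represents_extension f ⟨x, hx⟩).symm) y.2 a

theorem partialD_comm (hS : IsRegularDomain S) (a b : Fin n) (f : smoothFunctions S) :
    partialD hS a (partialD hS b f) = partialD hS b (partialD hS a f) := by
  refine smoothFunctions_ext fun y => ?_
  have key : ∀ a b : Fin n, evalAt y (partialD hS a (partialD hS b f))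
      = fderivWithin ℝ (fderivWithin ℝ (extension f) S) S y (Pi.single a 1) (Pi.single b 1) := by
    intro a b
    rw [← Represents.pd_eq hS (φ := fun x => pd S (extension f) x b)
      (fun x => (represents_extension f).pd_eq hS x b)]
    unfold pd
    rw [fderivWithin_clm_apply (hS.uniqueDiff y y.2)
      ((((extension_smooth f).fderivWithin (m := ∞) hS.uniqueDiff
        (by simp)).differentiableOn (by simp)) y y.2) (differentiableWithinAt_const _)]
    simp
  rw [key, key]
  exact ContDiffWithinAt.isSymmSndFDerivWithinAt (n := ∞) (extension_smooth f y y.2)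
    (by rw [minSmoothness_of_isRCLikeNormedField]; exact WithTop.coe_le_coe.2 le_top)
    hS.uniqueDiff (hS.mem_closure y y.2) y.2 _ _

/-! ### Restriction to the boundary -/

/-- The inclusion of the boundary as a continuous linear map. -/
def bdryCLM : (Fin 3 → ℝ) →L[ℝ] (Fin 4 → ℝ) :=
  ContinuousLinearMap.pi
    ![ContinuousLinearMap.proj 0, 0, ContinuousLinearMap.proj 1, ContinuousLinearMap.proj 2]

theorem bdryCLM_apply (z : Fin 3 → ℝ) : bdryCLM z = bdryPoint z := by
  ext a; fin_cases a <;> rfl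

theorem bdryCLM_single (i : Fin 3) : bdryCLM (Pi.single i 1) = Pi.single (tang i) 1 := by
  rw [bdryCLM_apply]
  ext a; fin_cases i <;> fin_cases a <;> simp [bdryPoint, tang]

variable {V : Set (Fin 3 → ℝ)} {U : Set (Fin 4 → ℝ)}

theorem comp_bdryPoint_smooth (hVU : ∀ z ∈ V, bdryPoint z ∈ U) {φ : (Fin 4 → ℝ) → ℝ}
    (hφ : ContDiffOn ℝ ∞ φ U) : ContDiffOn ℝ ∞ (fun z => φ (bdryPoint z)) V := by
  simp only [← bdryCLM_apply] at hVU ⊢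
  exact hφ.comp bdryCLM.contDiff.contDiffOn hVU

/-- The restriction of smooth functions from the spacetime to its boundary. -/
def restrict (hVU : ∀ z ∈ V, bdryPoint z ∈ U) : smoothFunctions U →ₐ[ℝ] smoothFunctions V where
  toFun f := ofSmooth (fun z => extension f (bdryPoint z))
    (comp_bdryPoint_smooth hVU (extension_smooth f))
  map_one' := smoothFunctions_ext fun z => by
    simp [represents_extension _ ⟨bdryPoint z, hVU z z.2⟩]
  map_zero' := smoothFunctions_ext fun z => by
    simp [represents_extension _ ⟨bdryPoint z, hVU z z.2⟩]
  map_mul' f g := smoothFunctions_ext fun z => by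
    simp [represents_extension _ ⟨bdryPoint z, hVU z z.2⟩]
  map_add' f g := smoothFunctions_ext fun z => by
    simp [represents_extension _ ⟨bdryPoint z, hVU z z.2⟩]
  commutes' r := smoothFunctions_ext fun z => by
    simp [represents_extension _ ⟨bdryPoint z, hVU z z.2⟩]

theorem evalAt_restrict (hVU : ∀ z ∈ V, bdryPoint z ∈ U) (f : smoothFunctions U) (z : V) :
    evalAt z (restrict hVU f) = evalAt ⟨bdryPoint z, hVU z z.2⟩ f :=
  represents_extension f ⟨bdryPoint z, hVU z z.2⟩

/-- Restriction to the boundary intertwines the tangential partial derivatives. -/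
theorem restrict_partialD (hU : IsRegularDomain U) (hV : IsRegularDomain V)
    (hVU : ∀ z ∈ V, bdryPoint z ∈ U) (i : Fin 3) (f : smoothFunctions U) :
    restrict hVU (partialD hU (tang i) f) = partialD hV i (restrict hVU f) := by
  refine smoothFunctions_ext fun z => ?_
  rw [evalAt_restrict, ← (represents_extension f).pd_eq hU,
    ← Represents.pd_eq hV (φ := fun z => extension f (bdryPoint z)) (fun _ => rfl)]
  unfold pd
  have hd : DifferentiableWithinAt ℝ (extension f) U (bdryCLM z) := by
    rw [bdryCLM_apply]
    exact differentiableWithinAt_extension f ⟨bdryPoint z, hVU z z.2⟩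
  simp only [← bdryCLM_apply] at hVU ⊢
  have h := fderivWithin_comp (g := extension f) (f := bdryCLM) (s := V) (t := U) (z : Fin 3 → ℝ)
    hd bdryCLM.differentiableWithinAt hVU (hV.uniqueDiff z z.2)
  change _ = fderivWithin ℝ (extension f ∘ bdryCLM) V z _
  rw [h, bdryCLM.fderivWithin (hV.uniqueDiff z z.2)]
  simp [bdryCLM_single]

end
end ConformalBoundary

namespace ConformalBoundary

noncomputable section

/-! ### Metric connections over a differential ring -/

section Connection

variable {R : Type*} [CommRing R] [Algebra ℝ R] {m N n : ℕ}

/-- The entrywise derivative of a matrix. -/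
def dM (δ : Derivation ℝ R R) (A : Matrix (Fin N) (Fin N) R) : Matrix (Fin N) (Fin N) R :=
  A.map δ

theorem dM_apply (δ : Derivation ℝ R R) (A : Matrix (Fin N) (Fin N) R) (a b : Fin N) :
    dM δ A a b = δ (A a b) := rfl

theorem dM_add (δ : Derivation ℝ R R) (A B : Matrix (Fin N) (Fin N) R) :
    dM δ (A + B) = dM δ A + dM δ B := by
  ext a b; simp [dM_apply]

theorem dM_sub (δ : Derivation ℝ R R) (A B : Matrix (Fin N) (Fin N) R) :
    dM δ (A - B) = dM δ A - dM δ B := by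
  ext a b; simp [dM_apply]

theorem dM_transpose (δ : Derivation ℝ R R) (A : Matrix (Fin N) (Fin N) R) :
    dM δ A.transpose = (dM δ A).transpose := rfl

theorem dM_one (δ : Derivation ℝ R R) : dM δ (1 : Matrix (Fin N) (Fin N) R) = 0 := by
  ext a b
  by_cases h : a = b <;> simp [dM_apply, h]

theorem dM_mul (δ : Derivation ℝ R R) (A B : Matrix (Fin N) (Fin N) R) :
    dM δ (A * B) = dM δ A * B + A * dM δ B := by
  ext a b
  simp only [dM_apply, Matrix.mul_apply, Matrix.add_apply, map_sum, Derivation.leibniz,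
    smul_eq_mul, ← Finset.sum_add_distrib]
  exact Finset.sum_congr rfl fun e _ => by ring

/-- The curvature matrix `R^a_{bcd}`, with rows `a` and columns `b`, of the connection with the
coefficients `Γ_c` along `m` directions on a trivial bundle of rank `N`, where the matrix `Γ_c` has
the entries `Γ^a_{cb}`. The numbers `m` and `N` may differ, which covers the restriction of a
spacetime connection to a hypersurface. -/
def curv (D : Fin m → Derivation ℝ R R) (Γ : Fin m → Matrix (Fin N) (Fin N) R) (c d : Fin m) :
    Matrix (Fin N) (Fin N) R :=
  dM (D c) (Γ d) - dM (D d) (Γ c) + (Γ c * Γ d - Γ d * Γ c)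

/-- The connection `Γ` along commuting derivations `D` preserves the symmetric metric `G`, which has
the inverse `H`. -/
structure IsMetricConnection (D : Fin m → Derivation ℝ R R) (G H : Matrix (Fin N) (Fin N) R)
    (Γ : Fin m → Matrix (Fin N) (Fin N) R) : Prop where
  comm : ∀ c d f, D c (D d f) = D d (D c f)
  symm : G.transpose = G
  mul_inv : G * H = 1
  compat : ∀ c, dM (D c) G = G * Γ c + (Γ c).transpose * G

variable {D : Fin m → Derivation ℝ R R} {G H : Matrix (Fin N) (Fin N) R}
  {Γ : Fin m → Matrix (Fin N) (Fin N) R}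

namespace IsMetricConnection

theorem dM_comm (h : IsMetricConnection D G H Γ) (c d : Fin m) (A : Matrix (Fin N) (Fin N) R) :
    dM (D c) (dM (D d) A) = dM (D d) (dM (D c) A) := by
  ext a b
  exact h.comm c d _

theorem inv_mul (h : IsMetricConnection D G H Γ) : H * G = 1 := mul_eq_one_comm.1 h.mul_inv

theorem inv_symm (h : IsMetricConnection D G H Γ) : H.transpose = H := by
  have h1 : H.transpose * G = 1 := by
    have := congrArg Matrix.transpose h.mul_inv
    rwa [Matrix.transpose_mul, h.symm, Matrix.transpose_one] at this
  calc H.transpose = H.transpose * (G * H) := by rw [h.mul_inv, Matrix.mul_one]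
    _ = H := by rw [← Matrix.mul_assoc, h1, Matrix.one_mul]

theorem G_swap (h : IsMetricConnection D G H Γ) (a b : Fin N) : G a b = G b a :=
  congrFun (congrFun h.symm b) a

theorem H_swap (h : IsMetricConnection D G H Γ) (a b : Fin N) : H a b = H b a :=
  congrFun (congrFun h.inv_symm b) a

/-- The inverse metric is covariantly constant. -/
theorem dM_inv (h : IsMetricConnection D G H Γ) (c : Fin m) :
    dM (D c) H = -(Γ c * H) - H * (Γ c).transpose := by
  have h1 : dM (D c) H * G + H * dM (D c) G = 0 := by rw [← dM_mul, h.inv_mul, dM_one]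
  have h2 : dM (D c) H * G * H + H * dM (D c) G * H = 0 := by rw [← add_mul, h1, zero_mul]
  rw [Matrix.mul_assoc, h.mul_inv, Matrix.mul_one, h.compat] at h2
  have h3 : H * (G * Γ c + (Γ c).transpose * G) * H
      = (H * G) * Γ c * H + H * (Γ c).transpose * (G * H) := by noncomm_ring
  rw [h3, h.inv_mul, h.mul_inv, Matrix.one_mul, Matrix.mul_one] at h2
  rw [eq_sub_iff_add_eq, ← sub_eq_zero, ← h2]
  abel

theorem D_inv (h : IsMetricConnection D G H Γ) (c : Fin m) (a b : Fin N) :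
    D c (H a b) = -(∑ p, Γ c a p * H p b) - ∑ p, H a p * Γ c b p := by
  have := congrFun (congrFun (h.dM_inv c) a) b
  simpa [dM_apply, Matrix.mul_apply] using this

theorem D_metric (h : IsMetricConnection D G H Γ) (c : Fin m) (a b : Fin N) :
    D c (G a b) = ∑ e, (G a e * Γ c e b + G b e * Γ c e a) := by
  have := congrFun (congrFun (h.compat c) a) b
  simp only [dM_apply, Matrix.add_apply, Matrix.mul_apply, Matrix.transpose_apply] at this
  rw [this, Finset.sum_add_distrib]
  congr 1
  exact Finset.sum_congr rfl fun e _ => by rw [h.G_swap e b, mul_comm]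

/-- The curvature, with its first index lowered, is antisymmetric in the first pair. -/
theorem curv_skew (h : IsMetricConnection D G H Γ) (c d : Fin m) :
    G * curv D Γ c d + (curv D Γ c d).transpose * G = 0 := by
  have h1 := h.dM_comm c d G
  rw [h.compat c, h.compat d] at h1
  simp only [dM_add, dM_mul, dM_transpose, h.compat] at h1
  rw [← sub_eq_zero] at h1
  rw [← h1]
  simp only [curv, Matrix.transpose_add, Matrix.transpose_sub, Matrix.transpose_mul]
  noncomm_ring

/-- The second Bianchi identity for a connection on a bundle. -/
theorem bianchi (h : IsMetricConnection D G H Γ) (e c d : Fin m) :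
    (dM (D e) (curv D Γ c d) + Γ e * curv D Γ c d - curv D Γ c d * Γ e)
      + (dM (D c) (curv D Γ d e) + Γ c * curv D Γ d e - curv D Γ d e * Γ c)
      + (dM (D d) (curv D Γ e c) + Γ d * curv D Γ e c - curv D Γ e c * Γ d) = 0 := by
  simp only [curv, dM_add, dM_sub, dM_mul]
  rw [h.dM_comm e c, h.dM_comm e d, h.dM_comm c d]
  noncomm_ring

end IsMetricConnection

theorem curv_swap (D : Fin m → Derivation ℝ R R) (Γ : Fin m → Matrix (Fin N) (Fin N) R)
    (c d : Fin m) : curv D Γ c d = -curv D Γ d c := by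
  simp only [curv]; abel

/-! ### Covariant derivatives and the Levi-Civita connection -/

variable {D : Fin n → Derivation ℝ R R} {G H : Matrix (Fin n) (Fin n) R}
  {Γ : Fin n → Matrix (Fin n) (Fin n) R}

/-- `∇_a α_b`. -/
def covD1 (D : Fin n → Derivation ℝ R R) (Γ : Fin n → Matrix (Fin n) (Fin n) R)
    (α : Fin n → R) (a b : Fin n) : R :=
  D a (α b) - ∑ e, Γ a e b * α e

/-- `∇_a A_{bc}`. -/
def covD2 (D : Fin n → Derivation ℝ R R) (Γ : Fin n → Matrix (Fin n) (Fin n) R)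
    (A : Fin n → Fin n → R) (a b c : Fin n) : R :=
  D a (A b c) - ∑ e, (Γ a e b * A e c + Γ a e c * A b e)

/-- `∇_a A_{bcd}`. -/
def covD3 (D : Fin n → Derivation ℝ R R) (Γ : Fin n → Matrix (Fin n) (Fin n) R)
    (A : Fin n → Fin n → Fin n → R) (a b c d : Fin n) : R :=
  D a (A b c d) - ∑ e, (Γ a e b * A e c d + Γ a e c * A b e d + Γ a e d * A b c e)

/-- `∇_a A_{bcdf}`. -/
def covD4 (D : Fin n → Derivation ℝ R R) (Γ : Fin n → Matrix (Fin n) (Fin n) R)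
    (A : Fin n → Fin n → Fin n → Fin n → R) (a b c d f : Fin n) : R :=
  D a (A b c d f) - ∑ e, (Γ a e b * A e c d f + Γ a e c * A b e d f + Γ a e d * A b c e f
    + Γ a e f * A b c d e)

/-- A torsion-free metric connection on the tangent bundle. -/
structure IsLeviCivita (D : Fin n → Derivation ℝ R R) (G H : Matrix (Fin n) (Fin n) R)
    (Γ : Fin n → Matrix (Fin n) (Fin n) R) : Prop extends IsMetricConnection D G H Γ where
  torsion_free : ∀ a b c, Γ c a b = Γ b a c

theorem algebraMap_half : algebraMap ℝ R (1 / 2) * 2 = 1 := by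
  rw [← map_ofNat (algebraMap ℝ R) 2, ← map_mul]
  norm_num

theorem two_cancel {x y : R} (h : 2 * x = 2 * y) : x = y := by
  linear_combination algebraMap ℝ R (1 / 2) * h + (y - x) * algebraMap_half (R := R)

/-- The matrix `Γ_c` of Christoffel symbols. -/
def chr (D : Fin n → Derivation ℝ R R) (G H : Matrix (Fin n) (Fin n) R) (c : Fin n) :
    Matrix (Fin n) (Fin n) R := Matrix.of fun a b =>
  algebraMap ℝ R (1 / 2) * ∑ e, H a e * (D c (G e b) + D b (G e c) - D e (G c b))

theorem isLeviCivita_chr (comm : ∀ c d f, D c (D d f) = D d (D c f)) (symm : G.transpose = G)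
    (mul_inv : G * H = 1) : IsLeviCivita D G H (chr D G H) := by
  have hs : ∀ a b, G a b = G b a := fun a b => congrFun (congrFun symm b) a
  have lower : ∀ a b c, (G * chr D G H c) a b
      = algebraMap ℝ R (1 / 2) * (D c (G a b) + D b (G a c) - D a (G c b)) := by
    intro a b c
    have h1 : chr D G H c = algebraMap ℝ R (1 / 2) •
        (H * Matrix.of fun e b => D c (G e b) + D b (G e c) - D e (G c b)) := by
      ext a b
      simp only [chr, Matrix.of_apply, Matrix.smul_apply, Matrix.mul_apply, smul_eq_mul]
    rw [h1, Matrix.mul_smul, ← Matrix.mul_assoc, mul_inv, Matrix.one_mul]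
    simp
  refine ⟨⟨comm, symm, mul_inv, fun c => ?_⟩, fun a b c => ?_⟩
  · ext a b
    have h2 : ((chr D G H c).transpose * G) a b = (G * chr D G H c) b a := by
      rw [← Matrix.transpose_apply (G * chr D G H c), Matrix.transpose_mul, symm]
    rw [Matrix.add_apply, h2, lower, lower, dM_apply, hs c b, hs c a, hs b a]
    linear_combination (-D c (G a b)) * algebraMap_half (R := R)
  · simp only [chr, Matrix.of_apply]
    congr 1
    exact Finset.sum_congr rfl fun e _ => by rw [hs c b]; ring

end Connection

end
end ConformalBoundary

namespace ConformalBoundary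

noncomputable section

/-! ### The Bianchi identities -/

section Intrinsic

variable {R : Type*} [CommRing R] [Algebra ℝ R] {n : ℕ}
variable {D : Fin n → Derivation ℝ R R} {G H : Matrix (Fin n) (Fin n) R}
  {Γ : Fin n → Matrix (Fin n) (Fin n) R}

theorem sum_comm4 {R : Type*} [AddCommMonoid R] {ι : Type*} [Fintype ι] (f : ι → ι → ι → ι → R) :
    ∑ a, ∑ b, ∑ c, ∑ d, f a b c d = ∑ c, ∑ d, ∑ a, ∑ b, f a b c d := by
  calc _ = ∑ a, ∑ c, ∑ b, ∑ d, f a b c d := Finset.sum_congr rfl fun a _ => Finset.sum_comm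
    _ = ∑ c, ∑ a, ∑ b, ∑ d, f a b c d := Finset.sum_comm
    _ = ∑ c, ∑ a, ∑ d, ∑ b, f a b c d :=
      Finset.sum_congr rfl fun c _ => Finset.sum_congr rfl fun a _ => Finset.sum_comm
    _ = _ := Finset.sum_congr rfl fun c _ => Finset.sum_comm

theorem sum_reverse4 {R : Type*} [AddCommMonoid R] {ι : Type*} [Fintype ι]
    (f : ι → ι → ι → ι → R) :
    ∑ a, ∑ b, ∑ c, ∑ d, f a b c d = ∑ a, ∑ b, ∑ c, ∑ d, f d c b a := by
  rw [sum_comm4, Finset.sum_comm]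
  exact Finset.sum_congr rfl fun d _ => Finset.sum_congr rfl fun c _ => Finset.sum_comm

/-- The curvature with all indices down, `R_{abcd}`. -/
def riemLow (D : Fin n → Derivation ℝ R R) (G : Matrix (Fin n) (Fin n) R)
    (Γ : Fin n → Matrix (Fin n) (Fin n) R) (a b c d : Fin n) : R :=
  (G * curv D Γ c d) a b

/-- The Ricci tensor `R^a_{bad}`. -/
def ric (D : Fin n → Derivation ℝ R R) (Γ : Fin n → Matrix (Fin n) (Fin n) R) (b d : Fin n) : R :=
  ∑ a, curv D Γ a d a b

theorem covD2_eq_matrix (A : Matrix (Fin n) (Fin n) R) (i j k : Fin n) :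
    covD2 D Γ A i j k = (dM (D i) A - (Γ i).transpose * A - A * Γ i) j k := by
  simp only [covD2, Matrix.sub_apply, Matrix.mul_apply, Matrix.transpose_apply, dM_apply,
    Finset.sum_add_distrib, sub_sub]
  congr 2
  exact Finset.sum_congr rfl fun e _ => mul_comm _ _

namespace IsLeviCivita

theorem curv_cyclic (h : IsLeviCivita D G H Γ) (a b c d : Fin n) :
    curv D Γ c d a b + curv D Γ d b a c + curv D Γ b c a d = 0 := by
  have ht := h.torsion_free
  simp only [curv, Matrix.add_apply, Matrix.sub_apply, dM_apply, Matrix.mul_apply]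
  simp only [ht _ c b, ht _ d c, ht _ d b]
  ring

theorem riemLow_skew_left (h : IsLeviCivita D G H Γ) (a b c d : Fin n) :
    riemLow D G Γ a b c d = -riemLow D G Γ b a c d := by
  have h1 := congrFun (congrFun (h.curv_skew c d) a) b
  have h2 : ((curv D Γ c d).transpose * G) a b = (G * curv D Γ c d) b a := by
    rw [← Matrix.transpose_apply (G * curv D Γ c d), Matrix.transpose_mul, h.symm]
  rw [Matrix.add_apply, h2] at h1
  exact eq_neg_of_add_eq_zero_left h1

theorem _root_.ConformalBoundary.riemLow_skew_right (a b c d : Fin n) :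
    riemLow D G Γ a b c d = -riemLow D G Γ a b d c := by
  rw [riemLow, curv_swap, Matrix.mul_neg]; rfl

theorem riemLow_cyclic (h : IsLeviCivita D G H Γ) (a b c d : Fin n) :
    riemLow D G Γ a b c d + riemLow D G Γ a c d b + riemLow D G Γ a d b c = 0 := by
  simp only [riemLow, Matrix.mul_apply, ← Finset.sum_add_distrib]
  refine Finset.sum_eq_zero fun e _ => ?_
  linear_combination G a e * h.curv_cyclic e b c d

theorem riemLow_pair (h : IsLeviCivita D G H Γ) (a b c d : Fin n) :
    riemLow D G Γ a b c d = riemLow D G Γ c d a b := by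
  have hl := h.riemLow_skew_left
  have hr := riemLow_skew_right (D := D) (G := G) (Γ := Γ)
  have h1 := h.riemLow_cyclic a b c d
  have h2 := h.riemLow_cyclic b c d a
  have h3 := h.riemLow_cyclic c d a b
  have h4 := h.riemLow_cyclic d a b c
  rw [hr b c d a, hl b d a c, hl b a c d] at h2
  rw [hl c a b d, hr a c b d, hl c b d a, hr b c d a] at h3
  rw [hl d a b c, hr d b c a, hl d c a b] at h4
  apply two_cancel
  linear_combination h1 - h2 - h3 + h4

/-- The Ricci tensor is the trace of the curvature over the first and third index. -/
theorem sum_riemLow (h : IsLeviCivita D G H Γ) (b d : Fin n) :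
    ∑ a, ∑ c, H a c * riemLow D G Γ a b c d = ric D Γ b d := by
  rw [Finset.sum_comm, ric]
  refine Finset.sum_congr rfl fun c _ => ?_
  have h1 : (H * (G * curv D Γ c d)) c b = curv D Γ c d c b := by
    rw [← Matrix.mul_assoc, h.inv_mul, Matrix.one_mul]
  rw [← h1, Matrix.mul_apply]
  exact Finset.sum_congr rfl fun a _ => by rw [h.H_swap a c]; rfl

theorem ric_symm (h : IsLeviCivita D G H Γ) (b d : Fin n) : ric D Γ b d = ric D Γ d b := by
  rw [← h.sum_riemLow, ← h.sum_riemLow, Finset.sum_comm]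
  refine Finset.sum_congr rfl fun c _ => Finset.sum_congr rfl fun a _ => ?_
  rw [h.H_swap, h.riemLow_pair]

/-- The second Bianchi identity for the curvature with all indices down. -/
theorem covD4_riemLow (h : IsLeviCivita D G H Γ) (e a b c d : Fin n) :
    covD4 D Γ (riemLow D G Γ) e a b c d + covD4 D Γ (riemLow D G Γ) c a b d e
      + covD4 D Γ (riemLow D G Γ) d a b e c = 0 := by
  have key : ∀ e c d, covD4 D Γ (riemLow D G Γ) e a b c d
      = (G * (dM (D e) (curv D Γ c d) + Γ e * curv D Γ c d - curv D Γ c d * Γ e)) a b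
        - ∑ p, (Γ e p c * riemLow D G Γ a b p d + Γ e p d * riemLow D G Γ a b c p) := by
    intro e c d
    have h1 : G * (dM (D e) (curv D Γ c d) + Γ e * curv D Γ c d - curv D Γ c d * Γ e)
        = dM (D e) (G * curv D Γ c d) - (Γ e).transpose * (G * curv D Γ c d)
          - (G * curv D Γ c d) * Γ e := by
      rw [dM_mul, h.compat]
      noncomm_ring
    rw [h1, ← covD2_eq_matrix]
    simp only [covD4, covD2, riemLow, Finset.sum_add_distrib]
    ring
  have h2 := congrFun (congrFun
    (congrArg (fun M : Matrix (Fin n) (Fin n) R => G * M) (h.bianchi e c d)) a) b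
  beta_reduce at h2
  rw [Matrix.mul_add, Matrix.mul_add, Matrix.add_apply, Matrix.add_apply, Matrix.mul_zero,
    Matrix.zero_apply] at h2
  rw [key, key, key]
  have h3 : ∑ p, (Γ e p c * riemLow D G Γ a b p d + Γ e p d * riemLow D G Γ a b c p)
      + ∑ p, (Γ c p d * riemLow D G Γ a b p e + Γ c p e * riemLow D G Γ a b d p)
      + ∑ p, (Γ d p e * riemLow D G Γ a b p c + Γ d p c * riemLow D G Γ a b e p) = 0 := by
    simp only [← Finset.sum_add_distrib]
    refine Finset.sum_eq_zero fun p _ => ?_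
    rw [h.torsion_free p c e, h.torsion_free p d e, h.torsion_free p d c,
      riemLow_skew_right a b c p, riemLow_skew_right a b d p, riemLow_skew_right a b e p]
    ring
  linear_combination h2 - h3

end IsLeviCivita

/-- The Leibniz rule for the contraction of two indices with the inverse metric. -/
theorem IsMetricConnection.D_trace {m N : ℕ} {D : Fin m → Derivation ℝ R R}
    {G H : Matrix (Fin N) (Fin N) R} {Γ : Fin m → Matrix (Fin N) (Fin N) R}
    (h : IsMetricConnection D G H Γ) (e : Fin m) (X : Fin N → Fin N → R) :
    ∑ a, ∑ c, H a c * (D e (X a c) - ∑ p, (Γ e p a * X p c + Γ e p c * X a p))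
      = D e (∑ a, ∑ c, H a c * X a c) := by
  have h1 : ∑ a, ∑ c, H a c * ∑ p, Γ e p a * X p c
      = ∑ a, ∑ c, (∑ p, Γ e a p * H p c) * X a c := by
    simp only [Finset.mul_sum, Finset.sum_mul]
    rw [Finset.sum_comm]
    conv_rhs => rw [Finset.sum_comm]
    refine Finset.sum_congr rfl fun c _ => ?_
    rw [Finset.sum_comm]
    exact Finset.sum_congr rfl fun a _ => Finset.sum_congr rfl fun p _ => by ring
  have h2 : ∑ a, ∑ c, H a c * ∑ p, Γ e p c * X a p
      = ∑ a, ∑ c, (∑ p, H a p * Γ e c p) * X a c := by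
    simp only [Finset.mul_sum, Finset.sum_mul]
    refine Finset.sum_congr rfl fun a _ => ?_
    rw [Finset.sum_comm]
    exact Finset.sum_congr rfl fun a _ => Finset.sum_congr rfl fun p _ => by ring
  have h3 : ∀ a c, D e (H a c * X a c) = H a c * D e (X a c)
      - (∑ p, Γ e a p * H p c) * X a c - (∑ p, H a p * Γ e c p) * X a c := by
    intro a c
    rw [Derivation.leibniz, h.D_inv]
    simp only [smul_eq_mul]
    ring
  simp only [map_sum, h3, mul_sub, Finset.sum_sub_distrib, Finset.sum_add_distrib, mul_add, h1, h2]
  ring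

namespace IsLeviCivita

theorem covD2_trace (h : IsLeviCivita D G H Γ) (A : Fin n → Fin n → R) (e : Fin n) :
    ∑ a, ∑ b, H a b * covD2 D Γ A e a b = D e (∑ a, ∑ b, H a b * A a b) :=
  h.D_trace e A

theorem covD3_trace (h : IsLeviCivita D G H Γ) (A : Fin n → Fin n → Fin n → R) (e j : Fin n) :
    ∑ k, ∑ m, H k m * covD3 D Γ A e k j m
      = covD1 D Γ (fun j => ∑ k, ∑ m, H k m * A k j m) e j := by
  have h1 : ∑ p, Γ e p j * ∑ k, ∑ m, H k m * A k p m
      = ∑ k, ∑ m, H k m * ∑ p, Γ e p j * A k p m := by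
    simp only [Finset.mul_sum]
    rw [Finset.sum_comm]
    refine Finset.sum_congr rfl fun k _ => ?_
    rw [Finset.sum_comm]
    exact Finset.sum_congr rfl fun a _ => Finset.sum_congr rfl fun p _ => by ring
  rw [covD1, h1, ← h.D_trace e fun k m => A k j m, ← Finset.sum_sub_distrib]
  refine Finset.sum_congr rfl fun k _ => ?_
  rw [← Finset.sum_sub_distrib]
  refine Finset.sum_congr rfl fun m _ => ?_
  simp only [covD3, Finset.sum_add_distrib]
  ring

theorem covD4_trace (h : IsLeviCivita D G H Γ) (A : Fin n → Fin n → Fin n → Fin n → R)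
    (e b d : Fin n) :
    ∑ a, ∑ c, H a c * covD4 D Γ A e a b c d
      = covD2 D Γ (fun b d => ∑ a, ∑ c, H a c * A a b c d) e b d := by
  have h1 : ∑ p, (Γ e p b * ∑ a, ∑ c, H a c * A a p c d + Γ e p d * ∑ a, ∑ c, H a c * A a b c p)
      = ∑ a, ∑ c, H a c * ∑ p, (Γ e p b * A a p c d + Γ e p d * A a b c p) := by
    simp only [Finset.mul_sum, ← Finset.sum_add_distrib]
    rw [Finset.sum_comm]
    refine Finset.sum_congr rfl fun k _ => ?_
    rw [Finset.sum_comm]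
    exact Finset.sum_congr rfl fun a _ => Finset.sum_congr rfl fun p _ => by ring
  rw [covD2, h1, ← h.D_trace e fun a c => A a b c d, ← Finset.sum_sub_distrib]
  refine Finset.sum_congr rfl fun k _ => ?_
  rw [← Finset.sum_sub_distrib]
  refine Finset.sum_congr rfl fun m _ => ?_
  simp only [covD4, Finset.sum_add_distrib]
  ring

/-- The contracted second Bianchi identity. -/
theorem div_ric (h : IsLeviCivita D G H Γ) (e : Fin n) :
    2 * ∑ a, ∑ c, H a c * covD2 D Γ (ric D Γ) c a e
      = D e (∑ a, ∑ b, H a b * ric D Γ a b) := by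
  have hric : (fun b d => ∑ a, ∑ c, H a c * riemLow D G Γ a b c d) = ric D Γ :=
    funext fun b => funext fun d => h.sum_riemLow b d
  have hl : ∀ c a b d e, covD4 D Γ (riemLow D G Γ) c a b d e
      = -covD4 D Γ (riemLow D G Γ) c b a d e := by
    intro c a b d e
    simp only [covD4, h.riemLow_skew_left a b, fun p => h.riemLow_skew_left a p,
      fun p => h.riemLow_skew_left p b, map_neg, mul_neg, Finset.sum_add_distrib,
      Finset.sum_neg_distrib]
    ring
  have hr : ∀ d a b e c, covD4 D Γ (riemLow D G Γ) d a b e c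
      = -covD4 D Γ (riemLow D G Γ) d a b c e := by
    intro d a b e c
    simp only [covD4, riemLow_skew_right _ _ e c, fun x y p => riemLow_skew_right (D := D) (G := G)
      (Γ := Γ) x y e p, fun x y p => riemLow_skew_right (D := D) (G := G) (Γ := Γ) x y p c,
      map_neg, mul_neg, Finset.sum_add_distrib, Finset.sum_neg_distrib]
    ring
  have htr := fun e b d => h.covD4_trace (riemLow D G Γ) e b d
  rw [hric] at htr
  -- contract the Bianchi identity with `H^{ac} H^{bd}`
  have h0 : ∑ b, ∑ d, H b d * ∑ a, ∑ c, H a c * (covD4 D Γ (riemLow D G Γ) e a b c d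
      + covD4 D Γ (riemLow D G Γ) c a b d e + covD4 D Γ (riemLow D G Γ) d a b e c) = 0 := by
    simp [h.covD4_riemLow]
  have h1 : ∑ b, ∑ d, H b d * ∑ a, ∑ c, H a c * covD4 D Γ (riemLow D G Γ) e a b c d
      = D e (∑ a, ∑ b, H a b * ric D Γ a b) := by
    simp only [htr, h.covD2_trace]
  have h2 : ∑ b, ∑ d, H b d * ∑ a, ∑ c, H a c * covD4 D Γ (riemLow D G Γ) c a b d e
      = -∑ a, ∑ c, H a c * covD2 D Γ (ric D Γ) c a e := by
    have : ∀ b d, H b d * ∑ a, ∑ c, H a c * covD4 D Γ (riemLow D G Γ) c a b d e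
        = -∑ a, ∑ c, H a c * (H b d * covD4 D Γ (riemLow D G Γ) c b a d e) := by
      intro b d
      simp only [Finset.mul_sum, hl _ _ b, mul_neg, Finset.sum_neg_distrib, mul_left_comm (H b d)]
    simp only [this, Finset.sum_neg_distrib, ← htr]
    rw [neg_inj]
    simp only [Finset.mul_sum]
    rw [sum_comm4]
  have h3 : ∑ b, ∑ d, H b d * ∑ a, ∑ c, H a c * covD4 D Γ (riemLow D G Γ) d a b e c
      = -∑ a, ∑ c, H a c * covD2 D Γ (ric D Γ) c a e := by
    simp only [hr _ _ _ e, mul_neg, Finset.sum_neg_distrib, htr]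
  simp only [mul_add, Finset.sum_add_distrib] at h0
  linear_combination h1 + h2 + h3 - h0

end IsLeviCivita

end Intrinsic

end
end ConformalBoundary

namespace ConformalBoundary

noncomputable section

/-! ### The divergence of the Cotton tensor -/

section Cotton

variable {R : Type*} [CommRing R] [Algebra ℝ R] {n : ℕ}
variable {D : Fin n → Derivation ℝ R R} {G H : Matrix (Fin n) (Fin n) R}
  {Γ : Fin n → Matrix (Fin n) (Fin n) R}

/-- The Ricci scalar. -/
def scal (D : Fin n → Derivation ℝ R R) (H : Matrix (Fin n) (Fin n) R)
    (Γ : Fin n → Matrix (Fin n) (Fin n) R) : R :=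
  ∑ b, ∑ d, H b d * ric D Γ b d

/-- The tensor `R_{bd} - R g_{bd} / 4`, which is the Schouten tensor in dimension three. -/
def sch (D : Fin n → Derivation ℝ R R) (G H : Matrix (Fin n) (Fin n) R)
    (Γ : Fin n → Matrix (Fin n) (Fin n) R) (b d : Fin n) : R :=
  ric D Γ b d - algebraMap ℝ R (1 / 4) * scal D H Γ * G b d

/-- The Cotton tensor `y_{ijk} = D_i l_{jk} - D_j l_{ik}`. -/
def cot (D : Fin n → Derivation ℝ R R) (G H : Matrix (Fin n) (Fin n) R)
    (Γ : Fin n → Matrix (Fin n) (Fin n) R) (i j k : Fin n) : R :=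
  covD2 D Γ (sch D G H Γ) i j k - covD2 D Γ (sch D G H Γ) j i k

namespace IsLeviCivita

theorem D_comm_covD1 (h : IsLeviCivita D G H Γ) (f : R) (i j : Fin n) :
    covD1 D Γ (fun j => D j f) i j = covD1 D Γ (fun j => D j f) j i := by
  simp only [covD1, h.torsion_free _ j i, h.comm i j]

/-- The Ricci identity for covariant tensors of rank two. -/
theorem ricci_identity (h : IsLeviCivita D G H Γ) (A : Fin n → Fin n → R) (k i j m : Fin n) :
    covD3 D Γ (covD2 D Γ A) k i j m - covD3 D Γ (covD2 D Γ A) i k j m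
      = -∑ p, (curv D Γ k i p j * A p m + curv D Γ k i p m * A j p) := by
  have key : ∀ k i, covD3 D Γ (covD2 D Γ A) k i j m
      = (dM (D k) (dM (D i) (Matrix.of A) - (Γ i).transpose * (Matrix.of A) - (Matrix.of A) * Γ i)
        - (Γ k).transpose *
          (dM (D i) (Matrix.of A) - (Γ i).transpose * (Matrix.of A) - (Matrix.of A) * Γ i)
        - (dM (D i) (Matrix.of A) - (Γ i).transpose * (Matrix.of A)
            - (Matrix.of A) * Γ i) * Γ k) j m
        - ∑ p, Γ k p i * covD2 D Γ A p j m := by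
    intro k i
    rw [← covD2_eq_matrix]
    have hM : covD2 D Γ (dM (D i) (Matrix.of A) - (Γ i).transpose * (Matrix.of A)
        - (Matrix.of A) * Γ i) k j m = covD2 D Γ (covD2 D Γ A i) k j m :=
      congrArg (fun M => covD2 D Γ M k j m)
        (funext fun j => funext fun m => (covD2_eq_matrix (Matrix.of A) i j m).symm)
    rw [hM, covD3, covD2.eq_def D Γ (covD2 D Γ A i)]
    simp only [Finset.sum_add_distrib]
    ring
  have hF : ∑ p, (curv D Γ k i p j * A p m + curv D Γ k i p m * A j p)
      = ((curv D Γ k i).transpose * Matrix.of A + Matrix.of A * curv D Γ k i) j m := by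
    simp only [Matrix.add_apply, Matrix.mul_apply, Matrix.transpose_apply, Matrix.of_apply,
      Finset.sum_add_distrib]
    congr 1
    exact Finset.sum_congr rfl fun p _ => mul_comm _ _
  have ht : ∑ p, Γ k p i * covD2 D Γ A p j m = ∑ p, Γ i p k * covD2 D Γ A p j m :=
    Finset.sum_congr rfl fun p _ => by rw [h.torsion_free p i k]
  rw [key, key, ht, hF, sub_sub_sub_cancel_right, ← Matrix.sub_apply, ← Matrix.neg_apply]
  refine congrFun (congrFun ?_ j) m
  simp only [curv, dM_sub, dM_mul, dM_transpose, h.dM_comm k i, Matrix.transpose_add,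
    Matrix.transpose_sub, Matrix.transpose_mul]
  noncomm_ring

theorem covD2_metric (h : IsLeviCivita D G H Γ) (e a b : Fin n) :
    covD2 D Γ (fun a b => G a b) e a b = 0 := by
  rw [covD2, h.D_metric, sub_eq_zero]
  refine Finset.sum_congr rfl fun p _ => ?_
  rw [h.G_swap p b]
  ring

theorem covD2_sch (h : IsLeviCivita D G H Γ) (e a b : Fin n) :
    covD2 D Γ (sch D G H Γ) e a b = covD2 D Γ (ric D Γ) e a b
      - algebraMap ℝ R (1 / 4) * D e (scal D H Γ) * G a b := by
  have h1 := h.covD2_metric e a b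
  simp only [covD2, sch, map_sub, Derivation.leibniz, smul_eq_mul, Derivation.map_algebraMap,
    mul_sub, Finset.sum_add_distrib, Finset.sum_sub_distrib, mul_zero, add_zero] at h1 ⊢
  simp only [mul_left_comm (Γ _ _ _), ← Finset.mul_sum]
  linear_combination (-(algebraMap ℝ R (1 / 4) * scal D H Γ)) * h1

theorem sch_symm (h : IsLeviCivita D G H Γ) (a b : Fin n) :
    sch D G H Γ a b = sch D G H Γ b a := by
  rw [sch, sch, h.ric_symm, h.G_swap]

theorem sum_inv_mul_metric (h : IsLeviCivita D G H Γ) (α : Fin n → R) (e : Fin n) :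
    ∑ a, ∑ c, H a c * (α c * G a e) = α e := by
  have h1 : ∀ c, ∑ a, H a c * (α c * G a e) = α c * (H * G) c e := by
    intro c
    rw [Matrix.mul_apply, Finset.mul_sum]
    exact Finset.sum_congr rfl fun a _ => by rw [h.H_swap]; ring
  rw [Finset.sum_comm]
  simp [h1, h.inv_mul, Matrix.one_apply]

/-- The divergence of the Schouten tensor is the gradient of a quarter of the Ricci scalar. -/
theorem div_sch (h : IsLeviCivita D G H Γ) (e : Fin n) :
    ∑ a, ∑ c, H a c * covD2 D Γ (sch D G H Γ) c a e
      = D e (algebraMap ℝ R (1 / 4) * scal D H Γ) := by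
  have h1 := h.div_ric e
  have h2 := h.sum_inv_mul_metric (fun c => algebraMap ℝ R (1 / 4) * D c (scal D H Γ)) e
  have h3 : algebraMap ℝ R (1 / 4) * 2 = algebraMap ℝ R (1 / 2) := by
    rw [← map_ofNat (algebraMap ℝ R) 2, ← map_mul]; norm_num
  simp only [h.covD2_sch, mul_sub, Finset.sum_sub_distrib, h2]
  rw [show ∑ a, ∑ b, H a b * ric D Γ a b = scal D H Γ from rfl] at h1
  simp only [Derivation.leibniz, smul_eq_mul, Derivation.map_algebraMap, mul_zero, add_zero]
  apply two_cancel
  linear_combination h1 - 2 * D e (scal D H Γ) * h3 - D e (scal D H Γ) * algebraMap_half (R := R)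

theorem curv_eq (h : IsLeviCivita D G H Γ) (p j k i : Fin n) :
    curv D Γ k i p j = ∑ q, H p q * riemLow D G Γ q j k i := by
  have h1 : (H * (G * curv D Γ k i)) p j = curv D Γ k i p j := by
    rw [← Matrix.mul_assoc, h.inv_mul, Matrix.one_mul]
  rw [← h1, Matrix.mul_apply]
  rfl

/-- The curvature terms in the divergence of the Cotton tensor are symmetric in the two free
indices and therefore drop out of it. -/
theorem ricci_term_symm (h : IsLeviCivita D G H Γ) (i j : Fin n) :
    ∑ k, ∑ m, H k m * ∑ p, (curv D Γ k i p j * sch D G H Γ p m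
        + curv D Γ k i p m * sch D G H Γ j p)
      = ∑ k, ∑ m, H k m * ∑ p, (curv D Γ k j p i * sch D G H Γ p m
        + curv D Γ k j p m * sch D G H Γ i p) := by
  have h1 : ∑ k, ∑ m, H k m * ∑ p, curv D Γ k i p j * sch D G H Γ p m
      = ∑ k, ∑ m, H k m * ∑ p, curv D Γ k j p i * sch D G H Γ p m := by
    simp only [h.curv_eq, Finset.sum_mul, Finset.mul_sum]
    -- the two sides agree after the renaming `(k, m, p, q) ↦ (q, p, m, k)`, by pair symmetry
    rw [sum_reverse4]
    refine Finset.sum_congr rfl fun k _ => Finset.sum_congr rfl fun m _ =>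
      Finset.sum_congr rfl fun p _ => Finset.sum_congr rfl fun q _ => ?_
    rw [h.riemLow_pair k j q i, h.sch_symm m p, h.H_swap q p, h.H_swap m k]
    ring
  have h2 : ∀ i j, ∑ k, ∑ m, H k m * ∑ p, curv D Γ k i p m * sch D G H Γ j p
      = -∑ p, ∑ q, H p q * ric D Γ q i * sch D G H Γ j p := by
    intro i j
    simp only [h.curv_eq, Finset.sum_mul, Finset.mul_sum]
    rw [sum_comm4]
    simp only [← Finset.sum_neg_distrib]
    refine Finset.sum_congr rfl fun p _ => Finset.sum_congr rfl fun q _ => ?_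
    rw [← h.sum_riemLow, Finset.mul_sum, Finset.sum_mul, ← Finset.sum_neg_distrib]
    rw [Finset.sum_comm]
    refine Finset.sum_congr rfl fun k _ => ?_
    rw [Finset.mul_sum, Finset.sum_mul, ← Finset.sum_neg_distrib]
    refine Finset.sum_congr rfl fun m _ => ?_
    rw [h.riemLow_skew_left q, h.H_swap m k]
    ring
  have h3 : ∀ i j, ∑ p, ∑ q, H p q * ric D Γ q i * sch D G H Γ j p
      = ∑ p, ∑ q, H p q * ric D Γ q i * ric D Γ j p
        - algebraMap ℝ R (1 / 4) * scal D H Γ * ric D Γ j i := by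
    intro i j
    have := h.sum_inv_mul_metric (fun q => ric D Γ q i) j
    rw [h.ric_symm j i, h.ric_symm i j, ← this, Finset.mul_sum, ← Finset.sum_sub_distrib]
    refine Finset.sum_congr rfl fun p _ => ?_
    rw [Finset.mul_sum, ← Finset.sum_sub_distrib]
    refine Finset.sum_congr rfl fun q _ => ?_
    rw [sch, h.G_swap j p]
    ring
  have h4 : ∑ p, ∑ q, H p q * ric D Γ q i * ric D Γ j p
      = ∑ p, ∑ q, H p q * ric D Γ q j * ric D Γ i p := by
    rw [Finset.sum_comm]
    refine Finset.sum_congr rfl fun p _ => Finset.sum_congr rfl fun q _ => ?_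
    rw [h.H_swap, h.ric_symm p i, h.ric_symm j q]
    ring
  simp only [Finset.sum_add_distrib, mul_add]
  rw [h1, h2, h2, h3, h3, h4, h.ric_symm i j]

/-- The divergence of the Cotton tensor over its last index vanishes. -/
theorem div_cot (h : IsLeviCivita D G H Γ) (i j : Fin n) :
    ∑ k, ∑ m, H k m * covD3 D Γ (cot D G H Γ) k i j m = 0 := by
  have h0 : ∀ k m, covD3 D Γ (cot D G H Γ) k i j m
      = covD3 D Γ (covD2 D Γ (sch D G H Γ)) k i j m
        - covD3 D Γ (covD2 D Γ (sch D G H Γ)) k j i m := by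
    intro k m
    simp only [covD3, cot, map_sub, mul_sub, Finset.sum_sub_distrib, Finset.sum_add_distrib]
    ring
  have hv : (fun j => ∑ k, ∑ m, H k m * covD2 D Γ (sch D G H Γ) k j m)
      = fun j => D j (algebraMap ℝ R (1 / 4) * scal D H Γ) := by
    funext j
    rw [← h.div_sch, Finset.sum_comm]
    refine Finset.sum_congr rfl fun k _ => Finset.sum_congr rfl fun m _ => ?_
    rw [h.H_swap]
    congr 1
    simp only [covD2, h.sch_symm j k, fun p => h.sch_symm p k, fun p => h.sch_symm j p,
      Finset.sum_add_distrib]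
    ring
  have h1 : ∀ i j, ∑ k, ∑ m, H k m * covD3 D Γ (covD2 D Γ (sch D G H Γ)) k i j m
      = covD1 D Γ (fun j => D j (algebraMap ℝ R (1 / 4) * scal D H Γ)) i j
        - ∑ k, ∑ m, H k m * ∑ p, (curv D Γ k i p j * sch D G H Γ p m
        + curv D Γ k i p m * sch D G H Γ j p) := by
    intro i j
    rw [← hv, ← h.covD3_trace, ← Finset.sum_sub_distrib]
    refine Finset.sum_congr rfl fun k _ => ?_
    rw [← Finset.sum_sub_distrib]
    refine Finset.sum_congr rfl fun m _ => ?_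
    linear_combination H k m * h.ricci_identity (sch D G H Γ) k i j m
  simp only [h0, mul_sub, Finset.sum_sub_distrib]
  rw [h1, h1, h.ricci_term_symm i j, h.D_comm_covD1]
  ring

end IsLeviCivita

end Cotton

/-! ### Curvature tensors in dimension three -/

/-- In dimension three, a tensor with the symmetries of a curvature tensor and vanishing trace
vanishes. Writing `W_{abcd} = ε_{abp} ε_{cdq} S^{pq}` and `T_{bd}` for the trace, one has
`det H · S^{pq} = ½ (H^{bd} T_{bd}) H^{pq} - H^{pb} T_{bd} H^{dq}`. -/
theorem eq_zero_of_traceless {H : Matrix (Fin 3) (Fin 3) ℝ} (hH : ∀ a b, H a b = H b a)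
    (hdet : H.det ≠ 0) {W : Fin 3 → Fin 3 → Fin 3 → Fin 3 → ℝ}
    (hl : ∀ a b c d, W a b c d = -W b a c d) (hr : ∀ a b c d, W a b c d = -W a b d c)
    (hp : ∀ a b c d, W a b c d = W c d a b) (ht : ∀ b d, ∑ a, ∑ c, H a c * W a b c d = 0)
    (a b c d : Fin 3) : W a b c d = 0 := by
  have l0 : ∀ a c d, W a a c d = 0 := fun a c d => by linarith [hl a a c d]
  have r0 : ∀ a b c, W a b c c = 0 := fun a b c => by linarith [hr a b c c]
  have l1 := hl 1 0
  have l2 := hl 2 0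
  have l3 := hl 2 1
  have r1 := fun a b => hr a b 1 0
  have r2 := fun a b => hr a b 2 0
  have r3 := fun a b => hr a b 2 1
  have p1 := hp 0 2 0 1
  have p2 := hp 1 2 0 1
  have p3 := hp 1 2 0 2
  have s1 := hH 1 0
  have s2 := hH 2 0
  have s3 := hH 2 1
  simp only [Fin.sum_univ_three] at ht
  have t00 := ht 0 0
  have t01 := ht 0 1
  have t02 := ht 0 2
  have t11 := ht 1 1
  have t12 := ht 1 2
  have t22 := ht 2 2
  simp only [l0, r0, l1, l2, l3, r1, r2, r3, p1, p2, p3, s1, s2, s3] at t00 t01 t02 t11 t12 t22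
  have hd : H.det = H 0 0 * H 1 1 * H 2 2 - H 0 0 * H 1 2 * H 1 2 - H 0 1 * H 0 1 * H 2 2
      + 2 * H 0 1 * H 1 2 * H 0 2 - H 0 2 * H 1 1 * H 0 2 := by
    rw [Matrix.det_fin_three, s1, s2, s3]; ring
  have w1 : W 0 1 0 1 = 0 := by
    refine (mul_eq_zero.1 (?_ : H.det * _ = 0)).resolve_left hdet
    rw [hd]
    linear_combination (1 / 2 * H 2 2 * H 0 0 - H 0 2 * H 0 2) * t00
      + (H 2 2 * H 0 1 - H 0 2 * H 1 2 - H 1 2 * H 0 2) * t01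
      + (H 2 2 * H 0 2 - H 0 2 * H 2 2 - H 2 2 * H 0 2) * t02
      + (1 / 2 * H 2 2 * H 1 1 - H 1 2 * H 1 2) * t11
      + (H 2 2 * H 1 2 - H 1 2 * H 2 2 - H 2 2 * H 1 2) * t12
      + (1 / 2 * H 2 2 * H 2 2 - H 2 2 * H 2 2) * t22
  have w2 : W 0 1 0 2 = 0 := by
    refine (mul_eq_zero.1 (?_ : H.det * _ = 0)).resolve_left hdet
    rw [hd]
    linear_combination -((1 / 2 * H 1 2 * H 0 0 - H 0 1 * H 0 2) * t00
      + (H 1 2 * H 0 1 - H 0 1 * H 1 2 - H 1 1 * H 0 2) * t01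
      + (H 1 2 * H 0 2 - H 0 1 * H 2 2 - H 1 2 * H 0 2) * t02
      + (1 / 2 * H 1 2 * H 1 1 - H 1 1 * H 1 2) * t11
      + (H 1 2 * H 1 2 - H 1 1 * H 2 2 - H 1 2 * H 1 2) * t12
      + (1 / 2 * H 1 2 * H 2 2 - H 1 2 * H 2 2) * t22)
  have w3 : W 0 1 1 2 = 0 := by
    refine (mul_eq_zero.1 (?_ : H.det * _ = 0)).resolve_left hdet
    rw [hd]
    linear_combination (1 / 2 * H 0 2 * H 0 0 - H 0 0 * H 0 2) * t00
      + (H 0 2 * H 0 1 - H 0 0 * H 1 2 - H 0 1 * H 0 2) * t01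
      + (H 0 2 * H 0 2 - H 0 0 * H 2 2 - H 0 2 * H 0 2) * t02
      + (1 / 2 * H 0 2 * H 1 1 - H 0 1 * H 1 2) * t11
      + (H 0 2 * H 1 2 - H 0 1 * H 2 2 - H 0 2 * H 1 2) * t12
      + (1 / 2 * H 0 2 * H 2 2 - H 0 2 * H 2 2) * t22
  have w4 : W 0 2 0 2 = 0 := by
    refine (mul_eq_zero.1 (?_ : H.det * _ = 0)).resolve_left hdet
    rw [hd]
    linear_combination (1 / 2 * H 1 1 * H 0 0 - H 0 1 * H 0 1) * t00
      + (H 1 1 * H 0 1 - H 0 1 * H 1 1 - H 1 1 * H 0 1) * t01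
      + (H 1 1 * H 0 2 - H 0 1 * H 1 2 - H 1 2 * H 0 1) * t02
      + (1 / 2 * H 1 1 * H 1 1 - H 1 1 * H 1 1) * t11
      + (H 1 1 * H 1 2 - H 1 1 * H 1 2 - H 1 2 * H 1 1) * t12
      + (1 / 2 * H 1 1 * H 2 2 - H 1 2 * H 1 2) * t22
  have w5 : W 0 2 1 2 = 0 := by
    refine (mul_eq_zero.1 (?_ : H.det * _ = 0)).resolve_left hdet
    rw [hd]
    linear_combination -((1 / 2 * H 0 1 * H 0 0 - H 0 0 * H 0 1) * t00
      + (H 0 1 * H 0 1 - H 0 0 * H 1 1 - H 0 1 * H 0 1) * t01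
      + (H 0 1 * H 0 2 - H 0 0 * H 1 2 - H 0 2 * H 0 1) * t02
      + (1 / 2 * H 0 1 * H 1 1 - H 0 1 * H 1 1) * t11
      + (H 0 1 * H 1 2 - H 0 1 * H 1 2 - H 0 2 * H 1 1) * t12
      + (1 / 2 * H 0 1 * H 2 2 - H 0 2 * H 1 2) * t22)
  have w6 : W 1 2 1 2 = 0 := by
    refine (mul_eq_zero.1 (?_ : H.det * _ = 0)).resolve_left hdet
    rw [hd]
    linear_combination (1 / 2 * H 0 0 * H 0 0 - H 0 0 * H 0 0) * t00
      + (H 0 0 * H 0 1 - H 0 0 * H 0 1 - H 0 1 * H 0 0) * t01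
      + (H 0 0 * H 0 2 - H 0 0 * H 0 2 - H 0 2 * H 0 0) * t02
      + (1 / 2 * H 0 0 * H 1 1 - H 0 1 * H 0 1) * t11
      + (H 0 0 * H 1 2 - H 0 1 * H 0 2 - H 0 2 * H 0 1) * t12
      + (1 / 2 * H 0 0 * H 2 2 - H 0 2 * H 0 2) * t22
  fin_cases a <;> fin_cases b <;> fin_cases c <;> fin_cases d <;>
    simp [l0, r0, l1, l2, l3, r1, r2, r3, p1, p2, p3, w1, w2, w3, w4, w5, w6]

/-- In dimension three the curvature is determined by the Ricci tensor. This is the algebraic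
statement, for a tensor `A` with the symmetries of a curvature tensor, its trace `ρ`, and a metric
`G` with the inverse `H`. -/
theorem riemann_eq_schouten_of_dim_three {G H : Matrix (Fin 3) (Fin 3) ℝ}
    (hG : ∀ a b, G a b = G b a) (hGH : G * H = 1) {A : Fin 3 → Fin 3 → Fin 3 → Fin 3 → ℝ}
    (hl : ∀ a b c d, A a b c d = -A b a c d) (hr : ∀ a b c d, A a b c d = -A a b d c)
    (hp : ∀ a b c d, A a b c d = A c d a b) (ρ : Fin 3 → Fin 3 → ℝ)
    (hρ : ∀ b d, ρ b d = ∑ a, ∑ c, H a c * A a b c d)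
    (r : ℝ) (hr' : r = ∑ b, ∑ d, H b d * ρ b d) (a b c d : Fin 3) :
    A a b c d = G a c * (ρ b d - 1 / 4 * r * G b d) - G a d * (ρ b c - 1 / 4 * r * G b c)
      + (ρ a c - 1 / 4 * r * G a c) * G b d - (ρ a d - 1 / 4 * r * G a d) * G b c := by
  have hHG : H * G = 1 := mul_eq_one_comm.1 hGH
  have hG' : G.transpose = G := by ext a b; exact hG b a
  have hH' : H.transpose = H := by
    have h1 : H.transpose * G = 1 := by
      have := congrArg Matrix.transpose hGH
      rwa [Matrix.transpose_mul, hG', Matrix.transpose_one] at this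
    calc H.transpose = H.transpose * (G * H) := by rw [hGH, Matrix.mul_one]
      _ = H := by rw [← Matrix.mul_assoc, h1, Matrix.one_mul]
  have hH : ∀ a b, H a b = H b a := fun a b => congrFun (congrFun hH' b) a
  have hdet : H.det ≠ 0 := by
    intro h0
    have := congrArg Matrix.det hHG
    rw [Matrix.det_mul, h0, zero_mul, Matrix.det_one] at this
    exact zero_ne_one this
  have k0 : ∑ a, ∑ c, H a c * G a c = 3 := by
    have h1 : ∀ a, ∑ c, H a c * G a c = (H * G) a a := fun a => by
      rw [Matrix.mul_apply]; exact Finset.sum_congr rfl fun c _ => by rw [hG]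
    simp [h1, hHG]
  have k1 : ∀ (d : Fin 3) (X : Fin 3 → ℝ), ∑ a, ∑ c, H a c * (G a d * X c) = X d := by
    intro d X
    have h1 : ∀ c, ∑ a, H a c * (G a d * X c) = (H * G) c d * X c := fun c => by
      rw [Matrix.mul_apply, Finset.sum_mul]
      exact Finset.sum_congr rfl fun a _ => by rw [hH]; ring
    rw [Finset.sum_comm]
    simp [h1, hHG, Matrix.one_apply]
  have k2 : ∀ (d : Fin 3) (X : Fin 3 → ℝ), ∑ a, ∑ c, H a c * (X a * G d c) = X d := by
    intro d X
    rw [← k1 d X, Finset.sum_comm]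
    exact Finset.sum_congr rfl fun a _ => Finset.sum_congr rfl fun c _ => by
      rw [hH, hG d a]; ring
  have hρs : ∀ a b, ρ a b = ρ b a := by
    intro b d
    rw [hρ, hρ, Finset.sum_comm]
    exact Finset.sum_congr rfl fun a _ => Finset.sum_congr rfl fun c _ => by rw [hH, hp]
  set l : Fin 3 → Fin 3 → ℝ := fun a b => ρ a b - 1 / 4 * r * G a b with hldef
  have hls : ∀ a b, l a b = l b a := fun a b => by simp only [hldef]; rw [hρs, hG]
  have htr : ∑ a, ∑ c, H a c * l a c = 1 / 4 * r := by
    simp only [hldef, mul_sub, Finset.sum_sub_distrib, ← hr']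
    have : ∑ a, ∑ c, H a c * (1 / 4 * r * G a c) = 1 / 4 * r * ∑ a, ∑ c, H a c * G a c := by
      simp only [Finset.mul_sum]
      exact Finset.sum_congr rfl fun a _ => Finset.sum_congr rfl fun c _ => by ring
    rw [this, k0]; ring
  have key := eq_zero_of_traceless hH hdet
    (W := fun a b c d => A a b c d - (G a c * l b d - G a d * l b c
        + l a c * G b d - l a d * G b c))
    (fun a b c d => by rw [hl]; ring) (fun a b c d => by rw [hr]; ring)
    (fun a b c d => by
      rw [hp, hG a c, hG b d, hG a d, hG b c, hls a c, hls b d, hls a d, hls b c]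
      ring)
    (fun b d => by
      have e1 : ∑ a, ∑ c, H a c * (G a c * l b d) = 3 * l b d := by
        simp only [← mul_assoc, ← Finset.sum_mul, k0]
      have e2 : ∑ a, ∑ c, H a c * (l a c * G b d) = 1 / 4 * r * G b d := by
        simp only [← mul_assoc, ← Finset.sum_mul, htr]
      have e3 := k1 d fun c => l b c
      have e4 := k2 b fun a => l a d
      simp only [mul_sub, mul_add, Finset.sum_sub_distrib, Finset.sum_add_distrib, ← hρ, e1, e2,
        e3, e4]
      simp only [hldef]
      ring) a b c d
  simp only [hldef] at key
  linarith

end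
end ConformalBoundary

namespace ConformalBoundary

noncomputable section

/-! ### Umbilic hypersurfaces: the Gauss and Codazzi equations -/

theorem sum_eq_normal_add_tang {M : Type*} [AddCommMonoid M] (f : Fin 4 → M) :
    ∑ a, f a = f 1 + ∑ i, f (tang i) := by
  rw [Fin.sum_univ_four, Fin.sum_univ_three]
  simp only [tang, Matrix.cons_val_zero, Matrix.cons_val_one, Matrix.cons_val]
  abel

theorem tang_injective : Function.Injective tang := by decide

theorem tang_ne_one (i : Fin 3) : tang i ≠ 1 := by revert i; decide

theorem eq_one_or_tang (a : Fin 4) : a = 1 ∨ ∃ i, a = tang i := by revert a; decide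

section Hypersurface

variable {R : Type*} [CommRing R] [Algebra ℝ R]

/-- The restriction to the hypersurface `x¹ = 0` of a spacetime metric `g` with inverse `h` and
Christoffel symbols `Γ`, where the second fundamental form is `κ ℓ_{ij}`. Here `n` and `N` are the
unit normal with index down and up, and `γ` belongs to the induced metric `ℓ` with inverse `ℓu`.
Only derivatives along the hypersurface occur, so that `Γ` is a metric connection of rank four over
a base of dimension three. -/
structure IsUmbilicBoundary (D : Fin 3 → Derivation ℝ R R) (g h : Matrix (Fin 4) (Fin 4) R)
    (Γ : Fin 4 → Matrix (Fin 4) (Fin 4) R) (ℓ ℓu : Matrix (Fin 3) (Fin 3) R)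
    (γ : Fin 3 → Matrix (Fin 3) (Fin 3) R) (n N : Fin 4 → R) (κ : R) : Prop where
  metric : IsMetricConnection D g h (fun i => Γ (tang i))
  torsion_free : ∀ a b c, Γ c a b = Γ b a c
  levi : IsLeviCivita D ℓ ℓu γ
  ell_eq : ∀ i j, ℓ i j = g (tang i) (tang j)
  n_tang : ∀ i, n (tang i) = 0
  N_eq : ∀ a, N a = h a 1 * n 1
  n_mul_N : n 1 * N 1 = 1
  umbilic : ∀ i j, Γ (tang i) 1 (tang j) * n 1 = -(κ * ℓ i j)

/-- The covariant derivative `∇_i A_{bc}` of a spacetime tensor along the boundary. -/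
def tcov2 (D : Fin 3 → Derivation ℝ R R) (Γ : Fin 4 → Matrix (Fin 4) (Fin 4) R)
    (A : Fin 4 → Fin 4 → R) (i : Fin 3) (b c : Fin 4) : R :=
  D i (A b c) - ∑ e, (Γ (tang i) e b * A e c + Γ (tang i) e c * A b e)

/-- The covariant derivative `∇_i A_{bcdf}` of a spacetime tensor along the boundary. -/
def tcov4 (D : Fin 3 → Derivation ℝ R R) (Γ : Fin 4 → Matrix (Fin 4) (Fin 4) R)
    (A : Fin 4 → Fin 4 → Fin 4 → Fin 4 → R) (i : Fin 3) (b c d f : Fin 4) : R :=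
  D i (A b c d f) - ∑ e, (Γ (tang i) e b * A e c d f + Γ (tang i) e c * A b e d f
    + Γ (tang i) e d * A b c e f + Γ (tang i) e f * A b c d e)

namespace IsUmbilicBoundary

variable {D : Fin 3 → Derivation ℝ R R} {g h : Matrix (Fin 4) (Fin 4) R}
    {Γ : Fin 4 → Matrix (Fin 4) (Fin 4) R} {ℓ ℓu : Matrix (Fin 3) (Fin 3) R}
    {γ : Fin 3 → Matrix (Fin 3) (Fin 3) R} {n N : Fin 4 → R} {κ : R}

theorem h_one (u : IsUmbilicBoundary D g h Γ ℓ ℓu γ n N κ) (a : Fin 4) : h a 1 = N a * N 1 := by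
  rw [u.N_eq a, mul_assoc, u.n_mul_N, mul_one]

theorem lower_N (u : IsUmbilicBoundary D g h Γ ℓ ℓu γ n N κ) (b : Fin 4) :
    ∑ a, g b a * N a = n b := by
  have h1 : ∑ a, g b a * N a = (g * h) b 1 * n 1 := by
    rw [Matrix.mul_apply, Finset.sum_mul]
    exact Finset.sum_congr rfl fun a _ => by rw [u.N_eq]; ring
  rw [h1, u.metric.mul_inv]
  rcases eq_one_or_tang b with rfl | ⟨i, rfl⟩
  · simp
  · rw [u.n_tang, Matrix.one_apply_ne (tang_ne_one i), zero_mul]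

theorem lower_N_tang (u : IsUmbilicBoundary D g h Γ ℓ ℓu γ n N κ) (j : Fin 3) :
    ∑ i, ℓ j i * N (tang i) = -(g (tang j) 1 * N 1) := by
  have h1 := u.lower_N (tang j)
  rw [sum_eq_normal_add_tang, u.n_tang] at h1
  simp only [u.ell_eq]
  exact (neg_eq_of_add_eq_zero_right h1).symm

theorem sum_n_N (u : IsUmbilicBoundary D g h Γ ℓ ℓu γ n N κ) : ∑ a, n a * N a = 1 := by
  rw [sum_eq_normal_add_tang, u.n_mul_N]
  simp [u.n_tang]

theorem ellUp_eq (u : IsUmbilicBoundary D g h Γ ℓ ℓu γ n N κ) (i j : Fin 3) :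
    ℓu i j = h (tang i) (tang j) - N (tang i) * N (tang j) := by
  have h1 : ℓ * (Matrix.of fun i j => h (tang i) (tang j) - N (tang i) * N (tang j)) = 1 := by
    ext i j
    have h2 : (g * h) (tang i) (tang j) = (1 : Matrix (Fin 3) (Fin 3) R) i j := by
      rw [u.metric.mul_inv]
      by_cases hij : i = j
      · rw [hij, Matrix.one_apply_eq, Matrix.one_apply_eq]
      · rw [Matrix.one_apply_ne hij, Matrix.one_apply_ne (tang_injective.ne hij)]
    rw [Matrix.mul_apply, sum_eq_normal_add_tang] at h2
    have h3 := u.lower_N_tang i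
    have h4 := u.metric.H_swap 1 (tang j)
    rw [u.h_one] at h4
    simp only [Matrix.mul_apply, Matrix.of_apply, mul_sub, Finset.sum_sub_distrib, ← mul_assoc,
      ← Finset.sum_mul, h3]
    simp only [u.ell_eq]
    linear_combination h2 - g (tang i) 1 * h4
  have h5 : ℓu = Matrix.of fun i j => h (tang i) (tang j) - N (tang i) * N (tang j) := by
    rw [← Matrix.mul_one ℓu, ← h1, ← Matrix.mul_assoc, u.levi.inv_mul, Matrix.one_mul]
  exact congrFun (congrFun h5 i) j

/-- The inverse metric splits into the normal direction and the inverse of the induced metric. -/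
theorem sum_h (u : IsUmbilicBoundary D g h Γ ℓ ℓu γ n N κ) (A : Fin 4 → Fin 4 → R) :
    ∑ e, ∑ f, h e f * A e f
      = ∑ e, ∑ f, N e * N f * A e f + ∑ k, ∑ l, ℓu k l * A (tang k) (tang l) := by
  have h1 : ∀ b, h 1 b = N 1 * N b := fun b => by rw [u.metric.H_swap, u.h_one, mul_comm]
  simp only [sum_eq_normal_add_tang, u.ellUp_eq, u.h_one, h1, sub_mul, Finset.sum_add_distrib,
    Finset.sum_sub_distrib]
  ring

theorem christoffel_one (u : IsUmbilicBoundary D g h Γ ℓ ℓu γ n N κ) (i j : Fin 3) :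
    Γ (tang i) 1 (tang j) = -(κ * ℓ i j * N 1) := by
  linear_combination N 1 * u.umbilic i j - Γ (tang i) 1 (tang j) * u.n_mul_N

/-- Twice a Christoffel symbol of the induced metric, with all indices down. -/
theorem _root_.ConformalBoundary.IsLeviCivita.koszul {n : ℕ} {D : Fin n → Derivation ℝ R R}
    {G H : Matrix (Fin n) (Fin n) R} {Γ : Fin n → Matrix (Fin n) (Fin n) R}
    (h : IsLeviCivita D G H Γ) (a b c : Fin n) :
    2 * ∑ e, G a e * Γ b e c = D b (G a c) + D c (G a b) - D a (G b c) := by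
  simp only [h.D_metric, Finset.sum_add_distrib, h.torsion_free _ b c, h.torsion_free _ b a,
    h.torsion_free _ c a]
  ring

theorem christoffel_tang (u : IsUmbilicBoundary D g h Γ ℓ ℓu γ n N κ) (i j k : Fin 3) :
    Γ (tang i) (tang k) (tang j) = γ i k j - κ * ℓ i j * N (tang k) := by
  -- both sides agree after lowering the index `k` with `ℓ`
  have low : ∀ l, ∑ k, ℓ l k * (Γ (tang i) (tang k) (tang j) - γ i k j + κ * ℓ i j * N (tang k))
      = 0 := by
    intro l
    have h1 : ∑ e, g (tang l) e * Γ (tang i) e (tang j) = ∑ k, ℓ l k * γ i k j := by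
      apply two_cancel
      rw [u.levi.koszul]
      simp only [u.ell_eq, u.metric.D_metric, Finset.sum_add_distrib,
        u.torsion_free _ (tang i) (tang j), u.torsion_free _ (tang i) (tang l),
        u.torsion_free _ (tang j) (tang l)]
      ring
    rw [sum_eq_normal_add_tang, u.christoffel_one] at h1
    have h2 := u.lower_N_tang l
    simp only [u.ell_eq] at h1 h2
    have h3 : ∑ k, ℓ l k * (Γ (tang i) (tang k) (tang j) - γ i k j + κ * ℓ i j * N (tang k))
        = ∑ k, ℓ l k * Γ (tang i) (tang k) (tang j) - ∑ k, ℓ l k * γ i k j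
          + κ * ℓ i j * ∑ k, ℓ l k * N (tang k) := by
      rw [Finset.mul_sum, ← Finset.sum_sub_distrib, ← Finset.sum_add_distrib]
      exact Finset.sum_congr rfl fun k _ => by ring
    rw [h3]
    simp only [u.ell_eq]
    linear_combination h1 + κ * g (tang i) (tang j) * h2
  have h4 : ℓ.mulVec (fun k => Γ (tang i) (tang k) (tang j) - γ i k j + κ * ℓ i j * N (tang k))
      = 0 := funext low
  have h5 := congrArg ℓu.mulVec h4
  rw [Matrix.mulVec_mulVec, u.levi.inv_mul, Matrix.one_mulVec, Matrix.mulVec_zero] at h5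
  have h6 := congrFun h5 k
  simp only [Pi.zero_apply] at h6
  linear_combination h6

/-- The Gauss formula: tangential Christoffel symbols in terms of those of the induced metric. -/
theorem sum_christoffel (u : IsUmbilicBoundary D g h Γ ℓ ℓu γ n N κ) (i j : Fin 3)
    (A : Fin 4 → R) : ∑ e, Γ (tang i) e (tang j) * A e
      = ∑ k, γ i k j * A (tang k) - κ * ℓ i j * ∑ e, N e * A e := by
  rw [sum_eq_normal_add_tang, u.christoffel_one]
  simp only [u.christoffel_tang, sub_mul, Finset.sum_sub_distrib]
  rw [sum_eq_normal_add_tang (fun e => N e * A e), mul_add, Finset.mul_sum]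
  simp only [mul_assoc]
  ring

/-- The Weingarten formula `∇_k n^b = κ δ_k^b`. -/
theorem weingarten (u : IsUmbilicBoundary D g h Γ ℓ ℓu γ n N κ) (k : Fin 3) (b : Fin 4) :
    D k (N b) + ∑ e, Γ (tang k) b e * N e = κ * (1 : Matrix (Fin 4) (Fin 4) R) b (tang k) := by
  have hN1 : n 1 * N 1 = 1 := u.n_mul_N
  -- the covector version, `∇_k n_b = κ g_{kb}`
  have hlow : ∀ b, D k (n b) - ∑ a, Γ (tang k) a b * n a = κ * g (tang k) b := by
    have hs : ∀ b, ∑ a, Γ (tang k) a b * n a = Γ (tang k) 1 b * n 1 := fun b => by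
      rw [sum_eq_normal_add_tang]; simp [u.n_tang]
    have ht : ∀ j, D k (n (tang j)) - ∑ a, Γ (tang k) a (tang j) * n a
        = κ * g (tang k) (tang j) := by
      intro j
      rw [hs, u.umbilic, u.n_tang, map_zero, u.ell_eq]
      ring
    intro b
    rcases eq_one_or_tang b with rfl | ⟨j, rfl⟩
    · -- differentiate `h^{11} n_1 n_1 = 1`
      have h1 : D k (h 1 1) = -(2 * ∑ p, Γ (tang k) 1 p * h p 1) := by
        rw [u.metric.D_inv, two_mul, neg_add, ← sub_eq_add_neg]
        congr 1
        exact Finset.sum_congr rfl fun p _ => by rw [u.metric.H_swap]; ring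
      have h2 : ∑ p, Γ (tang k) 1 p * h p 1 = N 1 * ∑ p, Γ (tang k) 1 p * N p := by
        rw [Finset.mul_sum]
        exact Finset.sum_congr rfl fun p _ => by rw [u.h_one]; ring
      have h3 : D k (n 1 * (h 1 1 * n 1)) = 0 := by rw [← u.N_eq, hN1, Derivation.map_one_eq_zero]
      simp only [Derivation.leibniz, smul_eq_mul, h1, h2] at h3
      rw [u.h_one 1] at h3
      have h4 : N 1 * D k (n 1) = n 1 * ∑ p, Γ (tang k) 1 p * N p := by
        apply two_cancel
        linear_combination h3 + (2 * n 1 * ∑ p, Γ (tang k) 1 p * N p - 2 * N 1 * D k (n 1)) * hN1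
      rw [sum_eq_normal_add_tang] at h4
      have h5 : ∑ i, Γ (tang k) 1 (tang i) * N (tang i) = κ * g (tang k) 1 * N 1 * N 1 := by
        have := u.lower_N_tang k
        simp only [u.christoffel_one]
        have h6 : ∑ i, -(κ * ℓ k i * N 1) * N (tang i) = -(κ * N 1) * ∑ i, ℓ k i * N (tang i) := by
          rw [Finset.mul_sum]
          exact Finset.sum_congr rfl fun p _ => by ring
        rw [h6, this]
        ring
      rw [h5] at h4
      rw [hs]
      linear_combination n 1 * h4
        - (D k (n 1) - Γ (tang k) 1 1 * n 1 - κ * g (tang k) 1 * (n 1 * N 1 + 1)) * hN1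
    · exact ht j
  have hN : ∀ b, N b = ∑ c, h b c * n c := fun b => by
    rw [sum_eq_normal_add_tang]; simp [u.n_tang, u.N_eq]
  have h1 : D k (N b) + ∑ e, Γ (tang k) b e * N e
      = ∑ c, h b c * (D k (n c) - ∑ a, Γ (tang k) a c * n a) := by
    simp only [mul_sub, Finset.sum_sub_distrib, Finset.mul_sum]
    rw [hN b]
    simp only [map_sum, Derivation.leibniz, smul_eq_mul, Finset.sum_add_distrib, u.metric.D_inv,
      mul_sub, mul_neg, Finset.mul_sum, Finset.sum_sub_distrib, Finset.sum_neg_distrib, hN]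
    have e1 : ∑ e, ∑ c, Γ (tang k) b e * (h e c * n c)
        = ∑ c, ∑ e, n c * (Γ (tang k) b e * h e c) := by
      rw [Finset.sum_comm]
      exact Finset.sum_congr rfl fun p _ => Finset.sum_congr rfl fun q _ => by ring
    have e2 : ∑ c, ∑ p, n c * (h b p * Γ (tang k) c p)
        = ∑ c, ∑ a, h b c * (Γ (tang k) a c * n a) := by
      rw [Finset.sum_comm]
      exact Finset.sum_congr rfl fun p _ => Finset.sum_congr rfl fun q _ => by ring
    rw [e1, e2]
    ring
  rw [h1]
  simp only [hlow]
  have h2 : ∑ c, h b c * (κ * g (tang k) c) = κ * (h * g) b (tang k) := by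
    rw [Matrix.mul_apply, Finset.mul_sum]
    exact Finset.sum_congr rfl fun c _ => by rw [u.metric.G_swap]; ring
  rw [h2, u.metric.inv_mul]

theorem sum_christoffel_N (u : IsUmbilicBoundary D g h Γ ℓ ℓu γ n N κ) (k : Fin 3) (b : Fin 4) :
    ∑ e, N e * Γ (tang k) b e = κ * (1 : Matrix (Fin 4) (Fin 4) R) b (tang k) - D k (N b) := by
  rw [← u.weingarten, add_sub_cancel_left]
  exact Finset.sum_congr rfl fun e _ => mul_comm _ _

/-- The normal component of a covariant derivative along the boundary. -/
theorem N_contract (u : IsUmbilicBoundary D g h Γ ℓ ℓu γ n N κ) (k : Fin 3) (X : Fin 4 → R) :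
    ∑ b, N b * (D k (X b) - ∑ e, Γ (tang k) e b * X e) = D k (∑ b, N b * X b) - κ * X (tang k) := by
  have h1 : ∑ b, N b * ∑ e, Γ (tang k) e b * X e = ∑ e, (∑ b, N b * Γ (tang k) e b) * X e := by
    simp only [Finset.mul_sum, Finset.sum_mul]
    rw [Finset.sum_comm]
    exact Finset.sum_congr rfl fun p _ => Finset.sum_congr rfl fun q _ => by ring
  have h2 : ∑ e, κ * (1 : Matrix (Fin 4) (Fin 4) R) e (tang k) * X e = κ * X (tang k) := by
    simp [Matrix.one_apply]
  simp only [mul_sub, Finset.sum_sub_distrib, h1, u.sum_christoffel_N, sub_mul, h2, map_sum,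
    Derivation.leibniz, smul_eq_mul, Finset.sum_add_distrib, mul_comm (X _) (D _ _)]
  ring

theorem sum_N_christoffel (u : IsUmbilicBoundary D g h Γ ℓ ℓu γ n N κ) (i j : Fin 3)
    (Y : Fin 4 → Fin 4 → R) : ∑ b, N b * ∑ e, Γ (tang i) e (tang j) * Y e b
      = ∑ k, γ i k j * (∑ b, N b * Y (tang k) b) - κ * ℓ i j * ∑ e, N e * ∑ b, N b * Y e b := by
  rw [← u.sum_christoffel i j (fun e => ∑ b, N b * Y e b)]
  simp only [Finset.mul_sum]
  rw [Finset.sum_comm]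
  exact Finset.sum_congr rfl fun p _ => Finset.sum_congr rfl fun q _ => by ring

theorem tcov2_tang (u : IsUmbilicBoundary D g h Γ ℓ ℓu γ n N κ) (A : Fin 4 → Fin 4 → R)
    (i j k : Fin 3) : tcov2 D Γ A i (tang j) (tang k)
      = covD2 D γ (fun j k => A (tang j) (tang k)) i j k
        + κ * (ℓ i j * ∑ e, N e * A e (tang k) + ℓ i k * ∑ e, N e * A (tang j) e) := by
  simp only [tcov2, covD2, Finset.sum_add_distrib, u.sum_christoffel]
  ring

theorem tcov2_normal (u : IsUmbilicBoundary D g h Γ ℓ ℓu γ n N κ) (A : Fin 4 → Fin 4 → R)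
    (i j : Fin 3) : ∑ b, N b * tcov2 D Γ A i (tang j) b
      = covD1 D γ (fun j => ∑ b, N b * A (tang j) b) i j
        + κ * ℓ i j * (∑ e, N e * ∑ b, N b * A e b) - κ * A (tang j) (tang i) := by
  have h1 : ∀ b, tcov2 D Γ A i (tang j) b = (D i (A (tang j) b)
      - ∑ e, Γ (tang i) e b * A (tang j) e) - ∑ e, Γ (tang i) e (tang j) * A e b := by
    intro b
    simp only [tcov2, Finset.sum_add_distrib]
    ring
  simp only [h1, mul_sub _ (_ - _) _, Finset.sum_sub_distrib, u.sum_N_christoffel]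
  rw [u.N_contract i (fun b => A (tang j) b), covD1]
  ring

theorem tcov4_normal (u : IsUmbilicBoundary D g h Γ ℓ ℓu γ n N κ)
    (A : Fin 4 → Fin 4 → Fin 4 → Fin 4 → R) (k l i j : Fin 3) :
    ∑ b, N b * tcov4 D Γ A k (tang l) b (tang i) (tang j)
      = covD3 D γ (fun l i j => ∑ b, N b * A (tang l) b (tang i) (tang j)) k l i j
        + κ * (ℓ k l * ∑ e, N e * ∑ b, N b * A e b (tang i) (tang j)
          + ℓ k i * ∑ e, N e * ∑ b, N b * A (tang l) b e (tang j)
          + ℓ k j * ∑ e, N e * ∑ b, N b * A (tang l) b (tang i) e)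
        - κ * A (tang l) (tang k) (tang i) (tang j) := by
  have h1 : ∀ b, tcov4 D Γ A k (tang l) b (tang i) (tang j) = (D k (A (tang l) b (tang i) (tang j))
      - ∑ e, Γ (tang k) e b * A (tang l) e (tang i) (tang j))
      - ∑ e, Γ (tang k) e (tang l) * A e b (tang i) (tang j)
      - ∑ e, Γ (tang k) e (tang i) * A (tang l) b e (tang j)
      - ∑ e, Γ (tang k) e (tang j) * A (tang l) b (tang i) e := by
    intro b
    simp only [tcov4, Finset.sum_add_distrib]
    ring
  simp only [h1, mul_sub _ (_ - _) _, Finset.sum_sub_distrib]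
  rw [u.N_contract k (fun b => A (tang l) b (tang i) (tang j)),
    u.sum_N_christoffel k l (fun e b => A e b (tang i) (tang j)),
    u.sum_N_christoffel k i (fun e b => A (tang l) b e (tang j)),
    u.sum_N_christoffel k j (fun e b => A (tang l) b (tang i) e)]
  simp only [covD3, Finset.sum_add_distrib]
  ring

theorem tcov4_normal_normal (u : IsUmbilicBoundary D g h Γ ℓ ℓu γ n N κ)
    (A : Fin 4 → Fin 4 → Fin 4 → Fin 4 → R) (k l i : Fin 3) :
    ∑ b, N b * ∑ d, N d * tcov4 D Γ A k (tang l) b (tang i) d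
      = covD2 D γ (fun l i => ∑ b, N b * ∑ d, N d * A (tang l) b (tang i) d) k l i
        + κ * (ℓ k l * ∑ e, N e * ∑ b, N b * ∑ d, N d * A e b (tang i) d
          + ℓ k i * ∑ e, N e * ∑ b, N b * ∑ d, N d * A (tang l) b e d)
        - κ * ∑ d, N d * A (tang l) (tang k) (tang i) d
        - κ * ∑ b, N b * A (tang l) b (tang i) (tang k) := by
  have h1 : ∀ b, ∑ d, N d * tcov4 D Γ A k (tang l) b (tang i) d
      = (D k (∑ d, N d * A (tang l) b (tang i) d)
          - ∑ e, Γ (tang k) e b * ∑ d, N d * A (tang l) e (tang i) d)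
        - ∑ e, Γ (tang k) e (tang l) * ∑ d, N d * A e b (tang i) d
        - ∑ e, Γ (tang k) e (tang i) * ∑ d, N d * A (tang l) b e d
        - κ * A (tang l) b (tang i) (tang k) := by
    intro b
    have h2 : ∀ d, tcov4 D Γ A k (tang l) b (tang i) d = (D k (A (tang l) b (tang i) d)
        - ∑ e, Γ (tang k) e d * A (tang l) b (tang i) e)
        - ∑ e, Γ (tang k) e b * A (tang l) e (tang i) d
        - ∑ e, Γ (tang k) e (tang l) * A e b (tang i) d
        - ∑ e, Γ (tang k) e (tang i) * A (tang l) b e d := by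
      intro d
      simp only [tcov4, Finset.sum_add_distrib]
      ring
    have h3 : ∀ (c : Fin 4) (Y : Fin 4 → Fin 4 → R), ∑ d, N d * ∑ e, Γ (tang k) e c * Y e d
        = ∑ e, Γ (tang k) e c * ∑ d, N d * Y e d := by
      intro c Y
      simp only [Finset.mul_sum]
      rw [Finset.sum_comm]
      exact Finset.sum_congr rfl fun p _ => Finset.sum_congr rfl fun q _ => by ring
    simp only [h2, mul_sub _ (_ - _) _, Finset.sum_sub_distrib]
    rw [u.N_contract k (fun d => A (tang l) b (tang i) d),
      h3 b (fun e d => A (tang l) e (tang i) d), h3 (tang l) (fun e d => A e b (tang i) d),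
      h3 (tang i) (fun e d => A (tang l) b e d)]
    ring
  have h4 : ∑ b, N b * (κ * A (tang l) b (tang i) (tang k))
      = κ * ∑ b, N b * A (tang l) b (tang i) (tang k) := by
    rw [Finset.mul_sum]
    exact Finset.sum_congr rfl fun q _ => by ring
  simp only [h1, mul_sub _ (_ - _) _, Finset.sum_sub_distrib, h4]
  rw [u.N_contract k (fun b => ∑ d, N d * A (tang l) b (tang i) d),
    u.sum_N_christoffel k l (fun e b => ∑ d, N d * A e b (tang i) d),
    u.sum_N_christoffel k i (fun e b => ∑ d, N d * A (tang l) b e d)]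
  simp only [covD2, Finset.sum_add_distrib]
  ring

/-- The quadratic term of the spacetime curvature with tangential indices `j`, `k`, `l`, by the
formulas of Gauss and Weingarten. -/
theorem sum_christoffel_mul (u : IsUmbilicBoundary D g h Γ ℓ ℓu γ n N κ) (k l j : Fin 3)
    (a : Fin 4) : ∑ e, Γ (tang k) a e * Γ (tang l) e (tang j)
      = ∑ m, γ l m j * Γ (tang k) a (tang m)
        - κ * ℓ l j * (κ * (1 : Matrix (Fin 4) (Fin 4) R) a (tang k) - D k (N a)) := by
  rw [← u.sum_christoffel_N, ← u.sum_christoffel l j (fun e => Γ (tang k) a e)]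
  exact Finset.sum_congr rfl fun e _ => mul_comm _ _

theorem ell_deriv_symm (u : IsUmbilicBoundary D g h Γ ℓ ℓu γ n N κ) (k l j : Fin 3) :
    D k (ℓ l j) + ∑ m, γ l m j * ℓ k m = D l (ℓ k j) + ∑ m, γ k m j * ℓ l m := by
  simp only [u.levi.D_metric, Finset.sum_add_distrib, mul_comm (γ _ _ _),
    u.levi.torsion_free _ k l]
  ring

theorem curv_one (u : IsUmbilicBoundary D g h Γ ℓ ℓu γ n N κ) (k l j : Fin 3) :
    curv D (fun i => Γ (tang i)) k l 1 (tang j) = -((D k κ * ℓ l j - D l κ * ℓ k j) * N 1) := by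
  have h1 := u.ell_deriv_symm k l j
  have e : ∀ k l, ∑ m, γ l m j * -(κ * ℓ k m * N 1) = -(κ * N 1 * ∑ m, γ l m j * ℓ k m) := by
    intro k l
    rw [Finset.mul_sum, ← Finset.sum_neg_distrib]
    exact Finset.sum_congr rfl fun m _ => by ring
  simp only [curv, Matrix.add_apply, Matrix.sub_apply, dM_apply, Matrix.mul_apply,
    u.sum_christoffel_mul, u.christoffel_one, Matrix.one_apply_ne (tang_ne_one _).symm, e, map_neg,
    Derivation.leibniz, smul_eq_mul]
  linear_combination (-(κ * N 1)) * h1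

theorem curv_tang (u : IsUmbilicBoundary D g h Γ ℓ ℓu γ n N κ) (k l j p : Fin 3) :
    curv D (fun i => Γ (tang i)) k l (tang p) (tang j) = curv D γ k l p j
      - κ ^ 2 * (ℓ l j * (1 : Matrix (Fin 3) (Fin 3) R) p k
        - ℓ k j * (1 : Matrix (Fin 3) (Fin 3) R) p l)
      - (D k κ * ℓ l j - D l κ * ℓ k j) * N (tang p) := by
  have h1 := u.ell_deriv_symm k l j
  have e : ∀ k l, ∑ m, γ l m j * (γ k p m - κ * ℓ k m * N (tang p))
      = ∑ m, γ k p m * γ l m j - κ * N (tang p) * ∑ m, γ l m j * ℓ k m := by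
    intro k l
    rw [Finset.mul_sum, ← Finset.sum_sub_distrib]
    exact Finset.sum_congr rfl fun m _ => by ring
  have e1 : ∀ k, (1 : Matrix (Fin 4) (Fin 4) R) (tang p) (tang k)
      = (1 : Matrix (Fin 3) (Fin 3) R) p k := by
    intro k
    simp [Matrix.one_apply, tang_injective.eq_iff]
  simp only [curv, Matrix.add_apply, Matrix.sub_apply, dM_apply, Matrix.mul_apply,
    u.sum_christoffel_mul, u.christoffel_tang, e1, e, map_sub,
    Derivation.leibniz, smul_eq_mul]
  linear_combination (-(κ * N (tang p))) * h1

/-- The Gauss equation. -/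
theorem gauss (u : IsUmbilicBoundary D g h Γ ℓ ℓu γ n N κ) (i j k l : Fin 3) :
    ∑ e, g (tang i) e * curv D (fun i => Γ (tang i)) k l e (tang j)
      = riemLow D ℓ γ i j k l - κ ^ 2 * (ℓ i k * ℓ l j - ℓ i l * ℓ k j) := by
  have h1 := u.lower_N_tang i
  have e1 : ∀ k, ∑ p, ℓ i p * (1 : Matrix (Fin 3) (Fin 3) R) p k = ℓ i k := by
    intro k
    rw [← Matrix.mul_apply, Matrix.mul_one]
  have e2 : ∑ p, g (tang i) (tang p) * curv D (fun i => Γ (tang i)) k l (tang p) (tang j)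
      = ∑ p, ℓ i p * curv D γ k l p j
        - κ ^ 2 * (ℓ l j * ∑ p, ℓ i p * (1 : Matrix (Fin 3) (Fin 3) R) p k
          - ℓ k j * ∑ p, ℓ i p * (1 : Matrix (Fin 3) (Fin 3) R) p l)
        - (D k κ * ℓ l j - D l κ * ℓ k j) * ∑ p, ℓ i p * N (tang p) := by
    simp only [Finset.mul_sum, ← Finset.sum_sub_distrib, u.curv_tang]
    exact Finset.sum_congr rfl fun p _ => by rw [← u.ell_eq]; ring
  rw [sum_eq_normal_add_tang, e2, e1, e1, h1, u.curv_one, riemLow, Matrix.mul_apply]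
  ring

/-- The Codazzi equation. -/
theorem codazzi (u : IsUmbilicBoundary D g h Γ ℓ ℓu γ n N κ) (i j k : Fin 3) :
    ∑ d, N d * ∑ e, g (tang i) e * curv D (fun i => Γ (tang i)) j k e d
      = D j κ * ℓ k i - D k κ * ℓ j i := by
  have h1 : ∀ d, ∑ e, g (tang i) e * curv D (fun i => Γ (tang i)) j k e d
      = -∑ e, g d e * curv D (fun i => Γ (tang i)) j k e (tang i) := by
    intro d
    have h2 := congrFun (congrFun (u.metric.curv_skew j k) (tang i)) d
    rw [Matrix.add_apply, Matrix.mul_apply, Matrix.mul_apply, Matrix.zero_apply] at h2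
    rw [eq_neg_of_add_eq_zero_left h2, neg_inj]
    exact Finset.sum_congr rfl fun e _ => by rw [Matrix.transpose_apply, u.metric.G_swap]; ring
  have h3 : ∑ d, N d * ∑ e, g d e * curv D (fun i => Γ (tang i)) j k e (tang i)
      = ∑ e, n e * curv D (fun i => Γ (tang i)) j k e (tang i) := by
    simp only [← u.lower_N, Finset.mul_sum, Finset.sum_mul]
    rw [Finset.sum_comm]
    exact Finset.sum_congr rfl fun p _ => Finset.sum_congr rfl fun q _ => by
      rw [u.metric.G_swap]; ring
  simp only [h1, mul_neg, Finset.sum_neg_distrib, h3]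
  rw [sum_eq_normal_add_tang, u.curv_one]
  simp only [u.n_tang, zero_mul, Finset.sum_const_zero]
  linear_combination (D j κ * ℓ k i - D k κ * ℓ j i) * u.n_mul_N

end IsUmbilicBoundary

end Hypersurface

end
end ConformalBoundary

namespace ConformalBoundary

noncomputable section

/-! ### Geodesic foliations and the divergence constraint -/

section Foliation

variable {R : Type*} [CommRing R] [Algebra ℝ R] {n : ℕ}

section Leibniz

variable {D : Fin n → Derivation ℝ R R} {Γ : Fin n → Matrix (Fin n) (Fin n) R}

theorem covD2_add (A B : Fin n → Fin n → R) (m i j : Fin n) :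
    covD2 D Γ (fun i j => A i j + B i j) m i j = covD2 D Γ A m i j + covD2 D Γ B m i j := by
  simp only [covD2, map_add, mul_add, Finset.sum_add_distrib]
  ring

theorem covD2_sub (A B : Fin n → Fin n → R) (m i j : Fin n) :
    covD2 D Γ (fun i j => A i j - B i j) m i j = covD2 D Γ A m i j - covD2 D Γ B m i j := by
  simp only [covD2, map_sub, mul_sub, Finset.sum_add_distrib, Finset.sum_sub_distrib]
  ring

theorem covD2_mul (f : R) (A : Fin n → Fin n → R) (m i j : Fin n) :
    covD2 D Γ (fun i j => f * A i j) m i j = D m f * A i j + f * covD2 D Γ A m i j := by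
  simp only [covD2, Derivation.leibniz, smul_eq_mul, mul_sub, Finset.mul_sum]
  have : ∑ e, (Γ m e i * (f * A e j) + Γ m e j * (f * A i e))
      = ∑ e, f * (Γ m e i * A e j + Γ m e j * A i e) :=
    Finset.sum_congr rfl fun e _ => by ring
  rw [this]
  ring

theorem covD2_tmul (α β : Fin n → R) (m i j : Fin n) :
    covD2 D Γ (fun i j => α i * β j) m i j
      = covD1 D Γ α m i * β j + α i * covD1 D Γ β m j := by
  have h1 : ∑ e, Γ m e i * (α e * β j) = (∑ e, Γ m e i * α e) * β j := by
    simp only [Finset.sum_mul, mul_assoc]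
  have h2 : ∑ e, Γ m e j * (α i * β e) = α i * ∑ e, Γ m e j * β e := by
    simp only [Finset.mul_sum, mul_left_comm]
  simp only [covD2, covD1, Derivation.leibniz, smul_eq_mul, Finset.sum_add_distrib, h1, h2]
  ring

end Leibniz

/-- A unit timelike conormal `ν`, with index up `ν'`, of the foliation by the level sets of the
coordinate `x⁰`, with vanishing acceleration. -/
structure IsGeodesicFoliation (D : Fin 3 → Derivation ℝ R R) (G H : Matrix (Fin 3) (Fin 3) R)
    (Γ : Fin 3 → Matrix (Fin 3) (Fin 3) R) (ν ν' : Fin 3 → R) : Prop where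
  levi : IsLeviCivita D G H Γ
  up : ∀ i, ν' i = ∑ j, H i j * ν j
  conormal : ∀ i, i ≠ 0 → ν i = 0
  unit : ν' 0 * ν 0 = -1
  geodesic : ∀ i, ∑ j, ν' j * covD1 D Γ ν j i = 0

namespace IsGeodesicFoliation

variable {D : Fin 3 → Derivation ℝ R R} {G H : Matrix (Fin 3) (Fin 3) R}
  {Γ : Fin 3 → Matrix (Fin 3) (Fin 3) R} {ν ν' : Fin 3 → R}

theorem norm (F : IsGeodesicFoliation D G H Γ ν ν') : ∑ i, ν' i * ν i = -1 := by
  simp [Fin.sum_univ_three, F.unit, F.conormal]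

theorem sum_H_ν (F : IsGeodesicFoliation D G H Γ ν ν') (α : Fin 3 → R) :
    ∑ j, ∑ m, H j m * (α m * ν j) = ∑ m, ν' m * α m := by
  rw [Finset.sum_comm]
  refine Finset.sum_congr rfl fun m _ => ?_
  rw [F.up, Finset.sum_mul]
  exact Finset.sum_congr rfl fun j _ => by rw [F.levi.H_swap]; ring

/-- Contraction of a covariant derivative with the normal: the derivative of the normal
contributes the second fundamental form of the leaves. -/
theorem contract (F : IsGeodesicFoliation D G H Γ ν ν') (X : Fin 3 → R) (i : Fin 3) :
    ∑ j, ν' j * covD1 D Γ X i j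
      = D i (∑ j, ν' j * X j) - ∑ j, ∑ m, H j m * covD1 D Γ ν i m * X j := by
  have h1 : ∀ j, D i (ν' j) = ∑ m, H j m * covD1 D Γ ν i m - ∑ p, Γ i j p * ν' p := by
    intro j
    simp only [F.up, map_sum, Derivation.leibniz, smul_eq_mul, F.levi.D_inv, covD1]
    simp only [Fin.sum_univ_three]
    ring
  have h2 : ∑ j, ν' j * ∑ e, Γ i e j * X e = ∑ j, (∑ p, Γ i j p * ν' p) * X j := by
    simp only [Finset.mul_sum, Finset.sum_mul]
    rw [Finset.sum_comm]
    exact Finset.sum_congr rfl fun p _ => Finset.sum_congr rfl fun q _ => by ring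
  have h3 : ∀ j, D i (ν' j * X j) = ν' j * D i (X j)
      + ((∑ m, H j m * covD1 D Γ ν i m) * X j - (∑ p, Γ i j p * ν' p) * X j) := by
    intro j
    rw [Derivation.leibniz, h1]
    simp only [smul_eq_mul]
    ring
  rw [map_sum]
  simp only [h3, Finset.sum_add_distrib, Finset.sum_sub_distrib, ← h2, ← Finset.sum_mul]
  simp only [covD1, mul_sub, Finset.sum_sub_distrib]
  ring

theorem contract_spatial (F : IsGeodesicFoliation D G H Γ ν ν') {X : Fin 3 → R}
    (hX : ∑ j, ν' j * X j = 0) (i : Fin 3) :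
    ∑ j, ν' j * covD1 D Γ X i j = -∑ j, ∑ m, H j m * covD1 D Γ ν i m * X j := by
  rw [F.contract, hX, map_zero, zero_sub]

theorem ν_contract_right (F : IsGeodesicFoliation D G H Γ ν ν') (i : Fin 3) :
    ∑ j, ν' j * covD1 D Γ ν i j = 0 := by
  have h1 := F.contract ν i
  have h2 := F.sum_H_ν (fun m => covD1 D Γ ν i m)
  simp only [← mul_assoc] at h2
  rw [F.norm, h2, map_neg, Derivation.map_one_eq_zero] at h1
  apply two_cancel
  linear_combination h1

/-- The second fundamental form of the leaves is symmetric: its antisymmetric part is the exterior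
derivative of `ν`, which is a multiple of `dx⁰`, and both
contractions of it with the normal vanish. -/
theorem k_symm (F : IsGeodesicFoliation D G H Γ ν ν') (i j : Fin 3) :
    covD1 D Γ ν i j = covD1 D Γ ν j i := by
  have h0 : ∀ i j, covD1 D Γ ν i j - covD1 D Γ ν j i = D i (ν j) - D j (ν i) := by
    intro i j
    simp only [covD1, F.levi.torsion_free _ j i]
    ring
  have hs : ∀ i j, i ≠ 0 → j ≠ 0 → covD1 D Γ ν i j - covD1 D Γ ν j i = 0 := by
    intro i j hi hj
    rw [h0, F.conormal i hi, F.conormal j hj]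
    simp
  have hz : ∀ j, j ≠ 0 → covD1 D Γ ν 0 j - covD1 D Γ ν j 0 = 0 := by
    intro j hj
    have h1 := F.geodesic j
    have h2 := F.ν_contract_right j
    rw [Fin.sum_univ_three] at h1 h2
    have h3 := hs 1 j (by decide) hj
    have h4 := hs 2 j (by decide) hj
    have h5 : ν' 0 * (covD1 D Γ ν 0 j - covD1 D Γ ν j 0) = 0 := by
      linear_combination h1 - h2 - ν' 1 * h3 - ν' 2 * h4
    linear_combination (-ν 0) * h5 + (covD1 D Γ ν 0 j - covD1 D Γ ν j 0) * F.unit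
  rw [← sub_eq_zero]
  by_cases hi : i = 0
  · by_cases hj : j = 0
    · rw [hi, hj, sub_self]
    · rw [hi]; exact hz j hj
  · by_cases hj : j = 0
    · rw [hj, ← neg_sub, hz i hi, neg_zero]
    · exact hs i j hi hj

theorem contract_covD2 (F : IsGeodesicFoliation D G H Γ ν ν') {A : Fin 3 → Fin 3 → R}
    (hA : ∀ i, ∑ j, ν' j * A i j = 0) (b a : Fin 3) :
    ∑ j, ν' j * covD2 D Γ A b a j = -∑ j, ∑ m, H j m * covD1 D Γ ν b m * A a j := by
  rw [← F.contract_spatial (hA a)]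
  have h1 : ∀ j, covD2 D Γ A b a j = covD1 D Γ (A a) b j - ∑ p, Γ b p a * A p j := by
    intro j
    simp only [covD2, covD1, Finset.sum_add_distrib]
    ring
  have h2 : ∑ j, ν' j * ∑ p, Γ b p a * A p j = ∑ p, Γ b p a * ∑ j, ν' j * A p j := by
    simp only [Finset.mul_sum]
    rw [Finset.sum_comm]
    exact Finset.sum_congr rfl fun p _ => Finset.sum_congr rfl fun q _ => by ring
  simp only [h1, mul_sub, Finset.sum_sub_distrib, h2, hA, mul_zero, Finset.sum_const_zero,
    sub_zero]

/-- The evolution equations for `w` and `w_i` say that the divergence of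
`d_{ij} = w_{{ij}} + w s_{ij} / 2 - ν_i w_j - ν_j w_i + w ν_i ν_j` is `- Σ (p_i - p ν_i)`. -/
theorem divergence (F : IsGeodesicFoliation D G H Γ ν ν') {A : Fin 3 → Fin 3 → R} {α q : Fin 3 → R}
    {w p σ : R} (hA : ∀ i, ∑ j, ν' j * A i j = 0) (hAs : ∀ i j, A i j = A j i)
    (hα : ∑ i, ν' i * α i = 0)
    (ev_w : ∑ i, ∑ j, (H i j + ν' i * ν' j) * covD1 D Γ α i j - ∑ i, ν' i * D i w
      = ∑ i, ∑ j, ∑ a, ∑ b, H i a * H j b * covD1 D Γ ν a b * A i j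
        + algebraMap ℝ R (3 / 2) * (∑ i, ∑ j, (H i j + ν' i * ν' j) * covD1 D Γ ν i j) * w - σ * p)
    (ev_α : ∀ i, 2 * ∑ j, ν' j * covD1 D Γ α j i
        - ∑ j, ((1 : Matrix (Fin 3) (Fin 3) R) i j + ν i * ν' j) * D j w
      = -2 * (∑ i, ∑ j, (H i j + ν' i * ν' j) * covD1 D Γ ν i j) * α i
        - 2 * ∑ j, ∑ a, α j * H j a * covD1 D Γ ν i a
        + 2 * ∑ a, ∑ b, ∑ j, ((1 : Matrix (Fin 3) (Fin 3) R) i a + ν i * ν' a)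
          * (H b j + ν' b * ν' j) * covD2 D Γ A b a j
        + 2 * σ * q i) (i : Fin 3) :
    ∑ j, ∑ m, H j m * covD2 D Γ (fun i j => A i j + algebraMap ℝ R (1 / 2) * w * (G i j + ν i * ν j)
      - ν i * α j - ν j * α i + w * ν i * ν j) m i j = -(σ * (q i - p * ν i)) := by
  have hν : ∀ i, ∑ j, ν' j * covD1 D Γ ν i j = 0 := F.ν_contract_right
  have hkk : ∑ i, ∑ j, (H i j + ν' i * ν' j) * covD1 D Γ ν i j
      = ∑ i, ∑ j, H i j * covD1 D Γ ν i j := by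
    simp only [add_mul, Finset.sum_add_distrib, mul_assoc, ← Finset.mul_sum, hν]
    simp
  have hdiv1 : ∑ i, ∑ j, (H i j + ν' i * ν' j) * covD1 D Γ α i j
      = ∑ i, ∑ j, H i j * covD1 D Γ α i j := by
    simp only [add_mul, Finset.sum_add_distrib, mul_assoc, ← Finset.mul_sum, F.contract_spatial hα]
    rw [add_eq_left]
    have : ∑ x, ν' x * -∑ j, ∑ m, H j m * (covD1 D Γ ν x m * α j)
        = -∑ j, ∑ m, H j m * α j * ∑ x, ν' x * covD1 D Γ ν x m := by
      simp only [mul_neg, Finset.sum_neg_distrib, Finset.mul_sum]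
      rw [neg_inj, Finset.sum_comm]
      refine Finset.sum_congr rfl fun j _ => ?_
      rw [Finset.sum_comm]
      exact Finset.sum_congr rfl fun p _ => Finset.sum_congr rfl fun q _ => by ring
    rw [this]
    simp [F.geodesic]
  have hW : ∑ a, ν' a * ∑ j, ∑ m, H j m * covD2 D Γ A m a j
      = -∑ i, ∑ j, ∑ a, ∑ b, H i a * H j b * covD1 D Γ ν a b * A i j := by
    have hs : ∀ m a j, covD2 D Γ A m a j = covD2 D Γ A m j a := by
      intro m a j
      simp only [covD2, hAs a j, fun p => hAs p j, fun p => hAs a p, Finset.sum_add_distrib]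
      ring
    have h1 : ∑ a, ν' a * ∑ j, ∑ m, H j m * covD2 D Γ A m a j
        = ∑ j, ∑ m, H j m * ∑ a, ν' a * covD2 D Γ A m j a := by
      simp only [Finset.mul_sum]
      rw [Finset.sum_comm]
      refine Finset.sum_congr rfl fun j _ => ?_
      rw [Finset.sum_comm]
      exact Finset.sum_congr rfl fun p _ => Finset.sum_congr rfl fun q _ => by rw [hs]; ring
    rw [h1]
    simp only [F.contract_covD2 hA, mul_neg, Finset.sum_neg_distrib, Finset.mul_sum]
    rw [neg_inj]
    refine Finset.sum_congr rfl fun j _ => ?_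
    rw [Finset.sum_comm]
    exact Finset.sum_congr rfl fun c _ => Finset.sum_congr rfl fun m _ =>
      Finset.sum_congr rfl fun d _ => by rw [hAs j c]; ring
  have hdiv2 : ∑ a, ∑ b, ∑ j, ((1 : Matrix (Fin 3) (Fin 3) R) i a + ν i * ν' a)
        * (H b j + ν' b * ν' j) * covD2 D Γ A b a j
      = ∑ j, ∑ m, H j m * covD2 D Γ A m i j
        - ν i * ∑ i, ∑ j, ∑ a, ∑ b, H i a * H j b * covD1 D Γ ν a b * A i j := by
    have h1 : ∀ a, ∑ b, ∑ j, (H b j + ν' b * ν' j) * covD2 D Γ A b a j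
        = ∑ j, ∑ m, H j m * covD2 D Γ A m a j := by
      intro a
      simp only [add_mul, Finset.sum_add_distrib, mul_assoc, ← Finset.mul_sum,
        F.contract_covD2 hA]
      have h2 : ∑ x, ν' x * -∑ j, ∑ m, H j m * (covD1 D Γ ν x m * A a j)
          = -∑ j, ∑ m, H j m * A a j * ∑ x, ν' x * covD1 D Γ ν x m := by
        simp only [mul_neg, Finset.sum_neg_distrib, Finset.mul_sum]
        rw [neg_inj, Finset.sum_comm]
        refine Finset.sum_congr rfl fun j _ => ?_
        rw [Finset.sum_comm]
        exact Finset.sum_congr rfl fun p _ => Finset.sum_congr rfl fun q _ => by ring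
      rw [h2]
      simp only [F.geodesic, mul_zero, Finset.sum_const_zero, neg_zero, add_zero]
      rw [Finset.sum_comm]
      exact Finset.sum_congr rfl fun p _ => Finset.sum_congr rfl fun q _ => by rw [F.levi.H_swap]
    have h3 : ∀ a, ∑ b, ∑ j, ((1 : Matrix (Fin 3) (Fin 3) R) i a + ν i * ν' a)
        * (H b j + ν' b * ν' j) * covD2 D Γ A b a j
        = (1 : Matrix (Fin 3) (Fin 3) R) i a * (∑ j, ∑ m, H j m * covD2 D Γ A m a j)
          + ν i * (ν' a * ∑ j, ∑ m, H j m * covD2 D Γ A m a j) := by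
      intro a
      rw [← h1, ← mul_assoc, ← add_mul, Finset.mul_sum]
      refine Finset.sum_congr rfl fun b _ => ?_
      rw [Finset.mul_sum]
      exact Finset.sum_congr rfl fun j _ => mul_assoc _ _ _
    simp only [h3, Finset.sum_add_distrib, ← Finset.mul_sum]
    rw [hW]
    simp only [Matrix.one_apply, ite_mul, one_mul, zero_mul, Finset.sum_ite_eq, Finset.mem_univ,
      if_true]
    ring
  have hkα : ∑ j, ∑ a, α j * H j a * covD1 D Γ ν i a
      = ∑ j, ∑ m, H j m * (covD1 D Γ ν m i * α j) :=
    Finset.sum_congr rfl fun p _ => Finset.sum_congr rfl fun q _ => by rw [F.k_symm i q]; ring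
  have hleaf : ∑ j, ((1 : Matrix (Fin 3) (Fin 3) R) i j + ν i * ν' j) * D j w
      = D i w + ν i * ∑ m, ν' m * D m w := by
    simp [add_mul, Finset.sum_add_distrib, mul_assoc, ← Finset.mul_sum, Matrix.one_apply]
  have hexp : ∀ m j, covD2 D Γ (fun i j => A i j + algebraMap ℝ R (1 / 2) * w * (G i j + ν i * ν j)
      - ν i * α j - ν j * α i + w * ν i * ν j) m i j
      = covD2 D Γ A m i j
        + algebraMap ℝ R (1 / 2) * (D m w * (G i j + ν i * ν j)
          + w * (covD1 D Γ ν m i * ν j + ν i * covD1 D Γ ν m j))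
        - (covD1 D Γ ν m i * α j + ν i * covD1 D Γ α m j)
        - (covD1 D Γ α m i * ν j + α i * covD1 D Γ ν m j)
        + (D m w * (ν i * ν j) + w * (covD1 D Γ ν m i * ν j + ν i * covD1 D Γ ν m j)) := by
    intro m j
    have h1 : (fun i j => A i j + algebraMap ℝ R (1 / 2) * w * (G i j + ν i * ν j)
        - ν i * α j - ν j * α i + w * ν i * ν j)
        = fun i j => A i j + algebraMap ℝ R (1 / 2) * w * (G i j + ν i * ν j)
        - ν i * α j - α i * ν j + w * (ν i * ν j) := by
      funext i j; ring
    rw [h1, covD2_add, covD2_sub, covD2_sub, covD2_add, covD2_mul, covD2_mul,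
      covD2_add (fun i j => G i j) (fun i j => ν i * ν j),
      F.levi.covD2_metric, covD2_tmul, covD2_tmul, covD2_tmul, Derivation.leibniz,
      Derivation.map_algebraMap]
    simp only [smul_eq_mul]
    ring
  have t1 := F.levi.sum_inv_mul_metric (fun m => D m w) i
  have t2 := F.sum_H_ν (fun m => D m w)
  have t3 := F.sum_H_ν (fun m => covD1 D Γ ν m i)
  have t4 := F.sum_H_ν (fun m => covD1 D Γ α m i)
  rw [F.geodesic] at t3
  have t5 : ∑ j, ∑ m, H j m * covD1 D Γ ν m j = ∑ i, ∑ j, H i j * covD1 D Γ ν i j :=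
    Finset.sum_congr rfl fun p _ => Finset.sum_congr rfl fun q _ => by rw [F.k_symm]
  have t6 : ∑ j, ∑ m, H j m * covD1 D Γ α m j = ∑ i, ∑ j, H i j * covD1 D Γ α i j := by
    rw [Finset.sum_comm]
    exact Finset.sum_congr rfl fun p _ => Finset.sum_congr rfl fun q _ => by rw [F.levi.H_swap]
  have hsum : ∑ j, ∑ m, H j m * covD2 D Γ (fun i j => A i j
      + algebraMap ℝ R (1 / 2) * w * (G i j + ν i * ν j)
      - ν i * α j - ν j * α i + w * ν i * ν j) m i j
      = ∑ j, ∑ m, H j m * covD2 D Γ A m i j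
        + algebraMap ℝ R (1 / 2) * (∑ j, ∑ m, H j m * (D m w * G j i)
          + ν i * ∑ j, ∑ m, H j m * (D m w * ν j)
          + w * (∑ j, ∑ m, H j m * (covD1 D Γ ν m i * ν j)
            + ν i * ∑ j, ∑ m, H j m * covD1 D Γ ν m j))
        - (∑ j, ∑ m, H j m * (covD1 D Γ ν m i * α j) + ν i * ∑ j, ∑ m, H j m * covD1 D Γ α m j)
        - (∑ j, ∑ m, H j m * (covD1 D Γ α m i * ν j) + α i * ∑ j, ∑ m, H j m * covD1 D Γ ν m j)
        + (ν i * ∑ j, ∑ m, H j m * (D m w * ν j)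
          + w * (∑ j, ∑ m, H j m * (covD1 D Γ ν m i * ν j)
            + ν i * ∑ j, ∑ m, H j m * covD1 D Γ ν m j)) := by
    simp only [hexp, Finset.mul_sum, ← Finset.sum_add_distrib, ← Finset.sum_sub_distrib]
    exact Finset.sum_congr rfl fun p _ => Finset.sum_congr rfl fun q _ => by
      rw [F.levi.G_swap i p]; ring
  rw [hsum, t1, t2, t3, t4, t5, t6]
  have ev := ev_α i
  rw [hkk, hdiv1] at ev_w
  rw [hkk, hkα, hleaf, hdiv2] at ev
  have c2 : algebraMap ℝ R (3 / 2) * 2 = 3 := by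
    rw [← map_ofNat (algebraMap ℝ R) 2, ← map_mul, ← map_ofNat (algebraMap ℝ R) 3]
    norm_num
  have c1 := algebraMap_half (R := R)
  apply two_cancel
  generalize ∑ i, ∑ j, H i j * covD1 D Γ ν i j = kk at *
  generalize ∑ m, ν' m * D m w = δw at *
  linear_combination -ev - 2 * ν i * ev_w + (D i w + ν i * δw + w * ν i * kk) * c1
    - ν i * kk * w * c2

end IsGeodesicFoliation

end Foliation

end
end ConformalBoundary

namespace ConformalBoundary

noncomputable section

/-! ### Evaluation of the coordinate expressions in the ring of smooth functions -/

theorem IsLorentzian.symm {n : ℕ} {G : Fin (n + 1) → Fin (n + 1) → ℝ} (h : IsLorentzian G)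
    (a b : Fin (n + 1)) : G a b = G b a := by
  obtain ⟨P, hP, h⟩ := h
  have h1 := congrArg Matrix.transpose h
  rw [Matrix.diagonal_transpose, ← h, Matrix.transpose_mul, Matrix.transpose_mul,
    Matrix.transpose_transpose, ← Matrix.mul_assoc] at h1
  have hPT : IsUnit P.transpose.det := by rwa [Matrix.det_transpose]
  have h2 : (Matrix.of G).transpose = Matrix.of G := by
    have := congrArg (fun M => P.transpose⁻¹ * M * P⁻¹) h1
    simpa [Matrix.mul_assoc, Matrix.mul_nonsing_inv _ hP,
        Matrix.nonsing_inv_mul_cancel_left _ _ hPT]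
      using this
  exact congrFun (congrFun h2 b) a

theorem IsLorentzian.det_neg {n : ℕ} {G : Fin (n + 1) → Fin (n + 1) → ℝ} (h : IsLorentzian G) :
    (Matrix.of G).det < 0 := by
  obtain ⟨P, hP, h⟩ := h
  have h1 := congrArg Matrix.det h
  rw [Matrix.det_mul, Matrix.det_mul, Matrix.det_transpose, Matrix.det_diagonal,
    Fin.prod_univ_succ] at h1
  simp only [Fin.cons_zero, Fin.cons_succ, Finset.prod_const_one, mul_one] at h1
  by_contra hG
  nlinarith [mul_nonneg (mul_self_nonneg P.det) (not_lt.1 hG)]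

section Eval

variable {n : ℕ} {S : Set (Fin n → ℝ)} {g : (Fin n → ℝ) → Fin n → Fin n → ℝ}

theorem det_smooth {A : (Fin n → ℝ) → Matrix (Fin n) (Fin n) ℝ}
    (hA : ∀ a b, ContDiffOn ℝ ∞ (fun y => A y a b) S) : ContDiffOn ℝ ∞ (fun y => (A y).det) S := by
  simp only [Matrix.det_apply']
  exact ContDiffOn.sum fun s _ => contDiffOn_const.mul (contDiffOn_prod fun i _ => hA _ _)

theorem metricInv_smooth (hg : ∀ a b, ContDiffOn ℝ ∞ (fun y => g y a b) S)
    (hdet : ∀ y ∈ S, (Matrix.of (g y)).det ≠ 0) (a b : Fin n) :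
    ContDiffOn ℝ ∞ (fun y => metricInv g y a b) S := by
  have h1 : ∀ y, metricInv g y a b
      = ((Matrix.of (g y)).det)⁻¹ * ((Matrix.of (g y)).updateRow b (Pi.single a 1)).det := by
    intro y
    rw [metricInv, Matrix.inv_def, Matrix.smul_apply, Matrix.adjugate_apply, smul_eq_mul,
      Ring.inverse_eq_inv']
  simp only [h1]
  refine ((det_smooth (A := fun y => Matrix.of (g y)) hg).inv hdet).mul (det_smooth fun c d => ?_)
  simp only [Matrix.updateRow_apply]
  by_cases hc : c = b
  · simp only [hc, if_true]
    exact contDiffOn_const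
  · simp only [hc, if_false]
    exact hg c d

/-- The metric as a matrix over the ring of smooth functions. -/
def metricElt (hg : ∀ a b, ContDiffOn ℝ ∞ (fun y => g y a b) S) :
    Matrix (Fin n) (Fin n) (smoothFunctions S) :=
  Matrix.of fun a b => ofSmooth (fun y => g y a b) (hg a b)

/-- The inverse metric as a matrix over the ring of smooth functions. -/
def metricInvElt (hg : ∀ a b, ContDiffOn ℝ ∞ (fun y => g y a b) S)
    (hdet : ∀ y ∈ S, (Matrix.of (g y)).det ≠ 0) : Matrix (Fin n) (Fin n) (smoothFunctions S) :=
  Matrix.of fun a b => ofSmooth (fun y => metricInv g y a b) (metricInv_smooth hg hdet a b)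

/-- The Christoffel symbols over the ring of smooth functions. -/
def christoffelElt (hS : IsRegularDomain S) (hg : ∀ a b, ContDiffOn ℝ ∞ (fun y => g y a b) S)
    (hdet : ∀ y ∈ S, (Matrix.of (g y)).det ≠ 0) :
    Fin n → Matrix (Fin n) (Fin n) (smoothFunctions S) :=
  chr (partialD hS) (metricElt hg) (metricInvElt hg hdet)

variable (hS : IsRegularDomain S) (hg : ∀ a b, ContDiffOn ℝ ∞ (fun y => g y a b) S)
  (hdet : ∀ y ∈ S, (Matrix.of (g y)).det ≠ 0)

theorem metricElt_mul_metricInvElt : metricElt hg * metricInvElt hg hdet = 1 := by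
  refine Matrix.ext fun a b => smoothFunctions_ext fun y => ?_
  have h1 := congrFun (congrFun (Matrix.mul_nonsing_inv (Matrix.of (g y))
    (isUnit_iff_ne_zero.2 (hdet y y.2))) a) b
  rw [Matrix.mul_apply] at h1 ⊢
  rw [map_sum]
  simp only [map_mul]
  refine h1.trans ?_
  by_cases hab : a = b
  · rw [hab, Matrix.one_apply_eq]
    exact (congrArg (evalAt y) (Matrix.one_apply_eq b)).trans (map_one _) |>.symm
  · rw [Matrix.one_apply_ne hab]
    exact (congrArg (evalAt y) (Matrix.one_apply_ne hab)).trans (map_zero _) |>.symm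

theorem isLeviCivita_christoffelElt (hsymm : ∀ y ∈ S, ∀ a b, g y a b = g y b a) :
    IsLeviCivita (partialD hS) (metricElt hg) (metricInvElt hg hdet)
      (christoffelElt hS hg hdet) :=
  isLeviCivita_chr (partialD_comm hS)
    (Matrix.ext fun a b => smoothFunctions_ext fun y => hsymm y y.2 b a)
    (metricElt_mul_metricInvElt hg hdet)

theorem metricInvElt_eval (y : S) (a b : Fin n) :
    metricInv g y a b = evalAt y (metricInvElt hg hdet a b) := rfl

theorem christoffel_eval (y : S) (a b c : Fin n) :
    christoffel S g y a b c = evalAt y (christoffelElt hS hg hdet b a c) := by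
  have hpd : ∀ a b c, pd S (fun x => g x a b) y c = evalAt y (partialD hS c (metricElt hg a b)) :=
    fun a b c => Represents.pd_eq hS (fun _ => rfl) y c
  simp only [christoffel, christoffelElt, chr, Matrix.of_apply, map_mul, map_sum, map_add, map_sub,
    AlgHom.commutes, hpd, metricInvElt_eval hg hdet]
  rfl

theorem riemann_eval (y : S) (a b c d : Fin n) : riemann S g y a b c d
    = evalAt y (curv (partialD hS) (christoffelElt hS hg hdet) c d a b) := by
  have hpd : ∀ a b c d, pd S (fun x => christoffel S g x a b c) y d
      = evalAt y (partialD hS d (christoffelElt hS hg hdet b a c)) :=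
    fun a b c d => Represents.pd_eq hS (fun x => christoffel_eval hS hg hdet x a b c) y d
  simp only [riemann, curv, Matrix.add_apply, Matrix.sub_apply, dM_apply, Matrix.mul_apply, map_mul,
    map_sum, map_add, map_sub, hpd, christoffel_eval hS hg hdet, Finset.sum_sub_distrib]

theorem ricci_eval (y : S) (b d : Fin n) : ricci S g y b d
    = evalAt y (ric (partialD hS) (christoffelElt hS hg hdet) b d) := by
  simp only [ricci, ric, map_sum, riemann_eval hS hg hdet]

theorem scalarCurv_eval (y : S) : scalarCurv S g y
    = evalAt y (scal (partialD hS) (metricInvElt hg hdet) (christoffelElt hS hg hdet)) := by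
  simp only [scalarCurv, scal, map_sum, map_mul, ricci_eval hS hg hdet,
    metricInvElt_eval hg hdet]

theorem cov1_eval {α : (Fin n → ℝ) → Fin n → ℝ} {β : Fin n → smoothFunctions S}
    (h : ∀ b, Represents (fun x => α x b) (β b)) (y : S) (a b : Fin n) : cov1 S g α y a b
    = evalAt y (covD1 (partialD hS) (christoffelElt hS hg hdet) β a b) := by
  simp only [cov1, covD1, map_sum, map_mul, map_sub, christoffel_eval hS hg hdet,
    (h _).pd_eq hS]
  simp only [← h _ y]

theorem cov2_eval {A : (Fin n → ℝ) → Fin n → Fin n → ℝ} {B : Fin n → Fin n → smoothFunctions S}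
    (h : ∀ b c, Represents (fun x => A x b c) (B b c)) (y : S) (a b c : Fin n) :
    cov2 S g A y a b c = evalAt y (covD2 (partialD hS) (christoffelElt hS hg hdet) B a b c) := by
  simp only [cov2, covD2, map_sum, map_mul, map_sub, map_add, christoffel_eval hS hg hdet,
    (h _ _).pd_eq hS]
  simp only [← h _ _ y]

theorem cov4_eval {A : (Fin n → ℝ) → Fin n → Fin n → Fin n → Fin n → ℝ}
    {B : Fin n → Fin n → Fin n → Fin n → smoothFunctions S}
    (h : ∀ b c d f, Represents (fun x => A x b c d f) (B b c d f)) (y : S) (a b c d f : Fin n) :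
    cov4 S g A y a b c d f
      = evalAt y (covD4 (partialD hS) (christoffelElt hS hg hdet) B a b c d f) := by
  simp only [cov4, covD4, map_sum, map_mul, map_sub, map_add, christoffel_eval hS hg hdet,
    (h _ _ _ _).pd_eq hS]
  simp only [← h _ _ _ _ y]

end Eval

end
end ConformalBoundary

namespace ConformalBoundary

noncomputable section

/-! ### The boundary value problem in a coordinate chart -/

/-- Spacetime fields `F` with the boundary values constructed from the data `X`, on coordinate
domains on which the tensor calculus makes sense. -/
structure BoundaryProblem (F : BulkComponents) (X : BoundaryComponents) : Prop where
  regular_bulk : IsRegularDomain F.dom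
  regular_bdry : IsRegularDomain X.dom
  maps : ∀ z ∈ X.dom, bdryPoint z ∈ F.dom
  bulk : F.IsAdmissible
  bdry : X.IsAdmissible
  values : HasBoundaryValues F X
  lam_eq : X.lam = F.lam
  lam_neg : F.lam < 0

namespace BoundaryProblem

variable {F : BulkComponents} {X : BoundaryComponents}

/-- Partial derivatives in the spacetime. -/
def D4 (P : BoundaryProblem F X) := partialD P.regular_bulk

/-- Partial derivatives in the boundary. -/
def D3 (P : BoundaryProblem F X) := partialD P.regular_bdry

/-- Restriction of functions to the boundary. -/
def res (P : BoundaryProblem F X) : smoothFunctions F.dom →ₐ[ℝ] smoothFunctions X.dom :=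
  restrict P.maps

theorem det_bulk (P : BoundaryProblem F X) : ∀ y ∈ F.dom, (Matrix.of (F.g y)).det ≠ 0 :=
  fun y hy => (P.bulk.lorentzian y hy).det_neg.ne

theorem det_bdry (P : BoundaryProblem F X) : ∀ z ∈ X.dom, (Matrix.of (X.ell z)).det ≠ 0 :=
  fun z hz => (P.bdry.lorentzian z hz).det_neg.ne

/-- The Christoffel symbols of the spacetime. -/
def christoffel4 (P : BoundaryProblem F X) :=
  christoffelElt P.regular_bulk P.bulk.smooth_g P.det_bulk

/-- The spacetime metric at the boundary. -/
def gB (P : BoundaryProblem F X) : Matrix (Fin 4) (Fin 4) (smoothFunctions X.dom) :=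
  (metricElt P.bulk.smooth_g).map P.res

/-- The inverse spacetime metric at the boundary. -/
def hB (P : BoundaryProblem F X) : Matrix (Fin 4) (Fin 4) (smoothFunctions X.dom) :=
  (metricInvElt P.bulk.smooth_g P.det_bulk).map P.res

/-- The Christoffel symbols of the spacetime at the boundary. -/
def christoffelB (P : BoundaryProblem F X) (c : Fin 4) :
    Matrix (Fin 4) (Fin 4) (smoothFunctions X.dom) :=
  (P.christoffel4 c).map P.res

/-- The metric of the boundary. -/
def ellB (P : BoundaryProblem F X) : Matrix (Fin 3) (Fin 3) (smoothFunctions X.dom) :=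
  metricElt P.bdry.smooth_ell

/-- The inverse metric of the boundary. -/
def ellUpB (P : BoundaryProblem F X) : Matrix (Fin 3) (Fin 3) (smoothFunctions X.dom) :=
  metricInvElt P.bdry.smooth_ell P.det_bdry

/-- The Christoffel symbols of the boundary. -/
def christoffel3 (P : BoundaryProblem F X) :=
  christoffelElt P.regular_bdry P.bdry.smooth_ell P.det_bdry

theorem levi_bulk (P : BoundaryProblem F X) : IsLeviCivita P.D4 (metricElt P.bulk.smooth_g)
    (metricInvElt P.bulk.smooth_g P.det_bulk) P.christoffel4 :=
  isLeviCivita_christoffelElt _ _ _ fun y hy => (P.bulk.lorentzian y hy).symm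

theorem levi_bdry (P : BoundaryProblem F X) : IsLeviCivita P.D3 P.ellB P.ellUpB P.christoffel3 :=
  isLeviCivita_christoffelElt _ _ _ fun y hy => (P.bdry.lorentzian y hy).symm

theorem res_D (P : BoundaryProblem F X) (i : Fin 3) (f : smoothFunctions F.dom) :
    P.res (P.D4 (tang i) f) = P.D3 i (P.res f) :=
  restrict_partialD P.regular_bulk P.regular_bdry P.maps i f

theorem evalAt_res (P : BoundaryProblem F X) (z : X.dom) (f : smoothFunctions F.dom) :
    evalAt z (P.res f) = evalAt ⟨bdryPoint z, P.maps z z.2⟩ f :=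
  evalAt_restrict P.maps f z

/-- A tangential derivative at the boundary depends only on the boundary values. -/
theorem pd_tang (P : BoundaryProblem F X) {φ : (Fin 4 → ℝ) → ℝ} {f : smoothFunctions F.dom}
    (hf : Represents φ f)
    {k : smoothFunctions X.dom} (hk : ∀ z : X.dom, φ (bdryPoint z) = evalAt z k) (z : X.dom)
    (i : Fin 3) : pd F.dom φ (bdryPoint z) (tang i) = evalAt z (P.D3 i k) := by
  have h1 : P.res f = k := smoothFunctions_ext fun z => by
    rw [P.evalAt_res, ← hk z]
    exact (hf ⟨bdryPoint z, P.maps z z.2⟩).symm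
  rw [hf.pd_eq P.regular_bulk ⟨bdryPoint z, P.maps z z.2⟩, ← h1, ← P.res_D, P.evalAt_res]
  rfl

theorem metric_connection (P : BoundaryProblem F X) :
    IsMetricConnection P.D3 P.gB P.hB (fun i => P.christoffelB (tang i)) where
  comm := P.levi_bdry.comm
  symm := congrArg (fun M : Matrix (Fin 4) (Fin 4) (smoothFunctions F.dom) => M.map P.res)
    P.levi_bulk.symm
  mul_inv := by
    rw [gB, hB, ← Matrix.map_mul, P.levi_bulk.mul_inv]
    simp
  compat i := by
    have h1 := congrArg (fun M : Matrix (Fin 4) (Fin 4) (smoothFunctions F.dom) => M.map P.res)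
      (P.levi_bulk.compat (tang i))
    beta_reduce at h1
    rw [Matrix.map_add _ (map_add P.res), Matrix.map_mul, Matrix.map_mul, Matrix.transpose_map]
      at h1
    rw [gB, christoffelB, ← h1]
    exact Matrix.ext fun a b => (P.res_D i _).symm

/-- The coordinate `x¹` has a spacelike gradient at the boundary: by Cramer's rule `g¹¹` is the
quotient of the determinants of `ℓ` and `g`, which are both negative. -/
theorem gUp_pos (P : BoundaryProblem F X) (z : X.dom) : 0 < F.gUp (bdryPoint z) 1 1 := by
  have hy := P.maps z z.2
  have h1 := (P.bulk.lorentzian _ hy).det_neg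
  have h2 := (P.bdry.lorentzian z z.2).det_neg
  have h3 : (Matrix.of (F.g (bdryPoint z))).submatrix (Fin.succAbove 1) (Fin.succAbove 1)
      = Matrix.of (X.ell z) := by
    have ht : ∀ i : Fin 3, Fin.succAbove (1 : Fin 4) i = tang i := by decide
    ext i j
    simp only [Matrix.submatrix_apply, Matrix.of_apply, ht]
    exact P.values.ell_eq z z.2 i j
  rw [BulkComponents.gUp, metricInv, Matrix.inv_def, Matrix.smul_apply,
    Matrix.adjugate_fin_succ_eq_det_submatrix, h3, Ring.inverse_eq_inv', smul_eq_mul]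
  norm_num
  exact mul_pos_of_neg_of_neg (inv_lt_zero.2 h1) h2

theorem gUp_smooth (P : BoundaryProblem F X) :
    ContDiffOn ℝ ∞ (fun z => F.gUp (bdryPoint z) 1 1) X.dom :=
  comp_bdryPoint_smooth P.maps (metricInv_smooth P.bulk.smooth_g P.det_bulk 1 1)

/-- The unit conormal of the boundary. -/
def nB (P : BoundaryProblem F X) (a : Fin 4) : smoothFunctions X.dom :=
  if a = 1 then ofSmooth (fun z => 1 / √(F.gUp (bdryPoint z) 1 1))
    (contDiffOn_const.div (P.gUp_smooth.sqrt fun z hz => (P.gUp_pos ⟨z, hz⟩).ne')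
      fun z hz => (Real.sqrt_pos.2 (P.gUp_pos ⟨z, hz⟩)).ne') else 0

/-- The unit normal of the boundary. -/
def NB (P : BoundaryProblem F X) (a : Fin 4) : smoothFunctions X.dom := P.hB a 1 * P.nB 1

/-- The function `ϰ`. -/
def kappaB (P : BoundaryProblem F X) : smoothFunctions X.dom := ofSmooth X.kappa P.bdry.smooth_kappa

theorem gB_eval (P : BoundaryProblem F X) (z : X.dom) (a b : Fin 4) :
    evalAt z (P.gB a b) = F.g (bdryPoint z) a b :=
  P.evalAt_res z _

theorem hB_eval (P : BoundaryProblem F X) (z : X.dom) (a b : Fin 4) :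
    evalAt z (P.hB a b) = F.gUp (bdryPoint z) a b :=
  P.evalAt_res z _

theorem nB_eval (P : BoundaryProblem F X) (z : X.dom) (a : Fin 4) :
    evalAt z (P.nB a) = F.nLow (bdryPoint z) a := by
  rw [nB, BulkComponents.nLow, delta]
  split_ifs <;> simp

theorem NB_eval (P : BoundaryProblem F X) (z : X.dom) (a : Fin 4) :
    evalAt z (P.NB a) = F.nUp (bdryPoint z) a := by
  have h1 : ∀ i, F.nLow (bdryPoint z) (tang i) = 0 := fun i => by
    simp [BulkComponents.nLow, delta, tang_ne_one]
  rw [NB, map_mul, hB_eval, nB_eval, BulkComponents.nUp, sum_eq_normal_add_tang]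
  simp [h1]

theorem christoffelB_eval (P : BoundaryProblem F X) (z : X.dom) (a b c : Fin 4) :
    evalAt z (P.christoffelB b a c) = christoffel F.dom F.g (bdryPoint z) a b c := by
  rw [christoffel_eval P.regular_bulk P.bulk.smooth_g P.det_bulk ⟨bdryPoint z, P.maps z z.2⟩]
  exact P.evalAt_res z _

theorem nLow_tang (y : Fin 4 → ℝ) (i : Fin 3) : F.nLow y (tang i) = 0 := by
  simp [BulkComponents.nLow, delta, tang_ne_one]

theorem proj_tang (y : Fin 4 → ℝ) (i : Fin 3) (a : Fin 4) :
    F.proj y (tang i) a = delta (tang i) a := by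
  rw [BulkComponents.proj, nLow_tang, zero_mul, sub_zero]

/-- The boundary value `ϰ ℓ_{ij}` of the extrinsic curvature makes the boundary umbilic. -/
theorem umbilicBoundary (P : BoundaryProblem F X) :
    IsUmbilicBoundary P.D3 P.gB P.hB P.christoffelB P.ellB P.ellUpB
    P.christoffel3 P.nB P.NB P.kappaB where
  metric := P.metric_connection
  torsion_free a b c := by
    rw [christoffelB, christoffelB, Matrix.map_apply, Matrix.map_apply, P.levi_bulk.torsion_free]
  levi := P.levi_bdry
  ell_eq i j := smoothFunctions_ext fun z => by
    rw [P.gB_eval, P.values.ell_eq z z.2]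
    rfl
  n_tang i := by simp [nB, tang_ne_one]
  N_eq _ := rfl
  n_mul_N := smoothFunctions_ext fun z => by
    have h1 := P.gUp_pos z
    rw [map_mul, P.NB_eval, P.nB_eval, BulkComponents.nUp, sum_eq_normal_add_tang]
    simp only [nLow_tang, mul_zero, Finset.sum_const_zero, add_zero, map_one]
    rw [BulkComponents.nLow, delta, if_pos rfl]
    have h2 := Real.mul_self_sqrt h1.le
    have h3 := (Real.sqrt_pos.2 h1).ne'
    field_simp
    linarith
  umbilic i j := smoothFunctions_ext fun z => by
    have h1 := P.values.K_eq z z.2 i j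
    have h2 : F.extrinsic (bdryPoint z) (tang i) (tang j)
        = cov1 F.dom F.g F.nLow (bdryPoint z) (tang i) (tang j) := by
      simp [BulkComponents.extrinsic, proj_tang, delta]
    rw [h2, cov1, sum_eq_normal_add_tang] at h1
    simp only [nLow_tang, mul_zero, Finset.sum_const_zero, add_zero] at h1
    rw [show pd F.dom (fun _ => (0 : ℝ)) (bdryPoint z) (tang i) = 0 by simp [pd]] at h1
    rw [map_mul, P.christoffelB_eval, P.nB_eval, map_neg, map_mul]
    rw [zero_sub] at h1
    rw [← neg_eq_iff_eq_neg, h1]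
    rfl

/-- The restriction to the boundary of `L_{ab}`. -/
def LB (P : BoundaryProblem F X) (a b : Fin 4) : smoothFunctions X.dom :=
  P.res (ofSmooth (fun y => F.L y a b) (P.bulk.smooth_L a b))

/-- The restriction to the boundary of `d_{abcf}`. -/
def dB (P : BoundaryProblem F X) (a b c f : Fin 4) : smoothFunctions X.dom :=
  P.res (ofSmooth (fun y => F.d y a b c f) (P.bulk.smooth_d a b c f))

/-- The restriction to the boundary of `∇_a Ξ`. -/
def dXiB (P : BoundaryProblem F X) (a : Fin 4) : smoothFunctions X.dom :=
  P.res (P.D4 a (ofSmooth F.Xi P.bulk.smooth_Xi))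

theorem LB_eval (P : BoundaryProblem F X) (z : X.dom) (a b : Fin 4) :
    evalAt z (P.LB a b) = F.L (bdryPoint z) a b :=
  P.evalAt_res z _

theorem dB_eval (P : BoundaryProblem F X) (z : X.dom) (a b c f : Fin 4) :
    evalAt z (P.dB a b c f) = F.d (bdryPoint z) a b c f :=
  P.evalAt_res z _

theorem dXiB_eval (P : BoundaryProblem F X) (z : X.dom) (a : Fin 4) :
    evalAt z (P.dXiB a) = F.dXi (bdryPoint z) a := by
  rw [dXiB, P.evalAt_res]
  exact ((represents_ofSmooth F.Xi P.bulk.smooth_Xi).pd_eq P.regular_bulk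
    ⟨bdryPoint z, P.maps z z.2⟩ a).symm

/-- The gradient of the conformal factor is normal to the boundary and has the length `Σ`. -/
theorem dXiB_eq (P : BoundaryProblem F X) (a : Fin 4) :
    P.dXiB a = algebraMap ℝ _ X.Sig * P.nB a := by
  have ht : ∀ i, P.dXiB (tang i) = 0 := by
    intro i
    have h1 : P.res (ofSmooth F.Xi P.bulk.smooth_Xi) = 0 := smoothFunctions_ext fun z => by
      rw [P.evalAt_res, map_zero]
      exact P.values.Xi_eq z z.2
    rw [dXiB, P.res_D, h1, map_zero]
  have h2 : ∑ a, P.NB a * P.dXiB a = algebraMap ℝ _ X.Sig := smoothFunctions_ext fun z => by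
    simp only [map_sum, map_mul, P.NB_eval, P.dXiB_eval, AlgHom.commutes]
    exact P.values.Sig_eq z z.2
  rw [sum_eq_normal_add_tang] at h2
  simp only [ht, mul_zero, Finset.sum_const_zero, add_zero] at h2
  rcases eq_one_or_tang a with rfl | ⟨i, rfl⟩
  · linear_combination P.nB 1 * h2 - P.dXiB 1 * P.umbilicBoundary.n_mul_N
  · rw [ht, P.umbilicBoundary.n_tang, mul_zero]

theorem dXi_eq (P : BoundaryProblem F X) (z : X.dom) (a : Fin 4) :
    F.dXi (bdryPoint z) a = X.Sig * F.nLow (bdryPoint z) a := by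
  rw [← P.dXiB_eval, P.dXiB_eq, map_mul, AlgHom.commutes, P.nB_eval]
  rfl

theorem gradXi_eq (P : BoundaryProblem F X) (z : X.dom) (a : Fin 4) :
    F.gradXi (bdryPoint z) a = X.Sig * F.nUp (bdryPoint z) a := by
  simp only [BulkComponents.gradXi, BulkComponents.nUp, P.dXi_eq, Finset.mul_sum]
  exact Finset.sum_congr rfl fun b _ => by ring

theorem res_covD2 (P : BoundaryProblem F X) (A : Fin 4 → Fin 4 → smoothFunctions F.dom)
    (i : Fin 3) (b c : Fin 4) :
    P.res (covD2 P.D4 P.christoffel4 A (tang i) b c)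
      = tcov2 P.D3 P.christoffelB (fun b c => P.res (A b c)) i b c := by
  simp only [covD2, tcov2, map_sub, map_sum, map_add, map_mul, P.res_D]
  rfl

theorem res_covD4 (P : BoundaryProblem F X)
    (A : Fin 4 → Fin 4 → Fin 4 → Fin 4 → smoothFunctions F.dom) (i : Fin 3)
    (b c d f : Fin 4) : P.res (covD4 P.D4 P.christoffel4 A (tang i) b c d f)
      = tcov4 P.D3 P.christoffelB (fun b c d f => P.res (A b c d f)) i b c d f := by
  simp only [covD4, tcov4, map_sub, map_sum, map_add, map_mul, P.res_D]
  rfl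

theorem cov2_L_tang (P : BoundaryProblem F X) (z : X.dom) (i : Fin 3) (b c : Fin 4) :
    cov2 F.dom F.g F.L (bdryPoint z) (tang i) b c
      = evalAt z (tcov2 P.D3 P.christoffelB P.LB i b c) := by
  rw [cov2_eval P.regular_bulk P.bulk.smooth_g P.det_bulk
    (fun b c => represents_ofSmooth _ (P.bulk.smooth_L b c)) ⟨bdryPoint z, P.maps z z.2⟩]
  exact (P.evalAt_res z _).symm.trans (congrArg (evalAt z) (P.res_covD2 _ i b c))

theorem cov4_d_tang (P : BoundaryProblem F X) (z : X.dom) (i : Fin 3) (b c d f : Fin 4) :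
    cov4 F.dom F.g F.d (bdryPoint z) (tang i) b c d f
      = evalAt z (tcov4 P.D3 P.christoffelB P.dB i b c d f) := by
  rw [cov4_eval P.regular_bulk P.bulk.smooth_g P.det_bulk
    (fun b c d f => represents_ofSmooth _ (P.bulk.smooth_d b c d f)) ⟨bdryPoint z, P.maps z z.2⟩]
  exact (P.evalAt_res z _).symm.trans (congrArg (evalAt z) (P.res_covD4 _ i b c d f))

end BoundaryProblem

end
end ConformalBoundary

namespace ConformalBoundary

noncomputable section

namespace BoundaryProblem

variable {F : BulkComponents} {X : BoundaryComponents}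

/-! ### The zero-quantities `Θ`, `Z` and `Υ` -/

theorem Sig_sq (P : BoundaryProblem F X) : F.lam + 3 * (X.Sig * X.Sig) = 0 := by
  rw [BoundaryComponents.Sig, P.lam_eq, Real.mul_self_sqrt (by positivity), abs_of_neg P.lam_neg]
  ring

theorem Sig_ne_zero (P : BoundaryProblem F X) : X.Sig ≠ 0 := by
  intro h
  have h1 := P.Sig_sq
  rw [h] at h1
  linarith [P.lam_neg]

theorem sum_N_L (P : BoundaryProblem F X) (i : Fin 3) :
    ∑ c, P.NB c * P.LB c (tang i) = -P.D3 i P.kappaB := smoothFunctions_ext fun z => by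
  simp only [map_sum, map_mul, P.NB_eval, P.LB_eval, map_neg]
  rw [P.values.L1_eq z z.2, BoundaryComponents.L1, BoundaryComponents.grad,
    (represents_ofSmooth X.kappa P.bdry.smooth_kappa).pd_eq P.regular_bdry z]
  rfl

theorem LB_symm (P : BoundaryProblem F X) (a b : Fin 4) : P.LB a b = P.LB b a :=
  smoothFunctions_ext fun z => by
    rw [P.LB_eval, P.LB_eval, P.bulk.L_symm _ (P.maps z z.2)]

theorem g_symm (P : BoundaryProblem F X) (z : X.dom) (a b : Fin 4) :
    F.g (bdryPoint z) a b = F.g (bdryPoint z) b a :=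
  (P.bulk.lorentzian _ (P.maps z z.2)).symm a b

/-- Lowering the index of the unit normal. -/
theorem sum_g_nUp (P : BoundaryProblem F X) (z : X.dom) (b : Fin 4) :
    ∑ a, F.g (bdryPoint z) b a * F.nUp (bdryPoint z) a = F.nLow (bdryPoint z) b := by
  have h := congrArg (evalAt z) (P.umbilicBoundary.lower_N b)
  simpa only [map_sum, map_mul, P.gB_eval, P.NB_eval, P.nB_eval] using h

theorem sum_nUp_g (P : BoundaryProblem F X) (z : X.dom) (b : Fin 4) :
    ∑ a, F.nUp (bdryPoint z) a * F.g (bdryPoint z) a b = F.nLow (bdryPoint z) b := by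
  rw [← P.sum_g_nUp]
  exact Finset.sum_congr rfl fun a _ => by rw [P.g_symm, mul_comm]

theorem sum_nUp_nLow (P : BoundaryProblem F X) (z : X.dom) :
    ∑ a, F.nUp (bdryPoint z) a * F.nLow (bdryPoint z) a = 1 := by
  have h := congrArg (evalAt z) P.umbilicBoundary.sum_n_N
  simp only [map_sum, map_mul, P.NB_eval, P.nB_eval, map_one] at h
  rw [← h]
  exact Finset.sum_congr rfl fun a _ => mul_comm _ _

/-- `D_i s = Σ D_i ϰ` is compensated by `L_{ic} ∇^c Ξ = Σ L_i`. -/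
theorem theta_tang (P : BoundaryProblem F X) (z : X.dom) (i : Fin 3) :
    F.Theta (bdryPoint z) (tang i) = 0 := by
  have h1 := P.pd_tang (represents_ofSmooth F.s P.bulk.smooth_s)
    (k := algebraMap ℝ _ X.Sig * P.kappaB) (fun z => by
      rw [map_mul, AlgHom.commutes]
      exact P.values.s_eq z z.2) z i
  have h2 := congrArg (evalAt z) (P.sum_N_L i)
  simp only [map_sum, map_mul, P.NB_eval, P.LB_eval, map_neg] at h2
  rw [Derivation.leibniz, Derivation.map_algebraMap, smul_zero, add_zero, smul_eq_mul, map_mul,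
    AlgHom.commutes] at h1
  have h3 : ∑ c, F.L (bdryPoint z) (tang i) c * F.gradXi (bdryPoint z) c
      = X.Sig * ∑ c, F.nUp (bdryPoint z) c * F.L (bdryPoint z) c (tang i) := by
    rw [Finset.mul_sum]
    exact Finset.sum_congr rfl fun c _ => by
      rw [P.gradXi_eq, P.bulk.L_symm _ (P.maps z z.2)]; ring
  rw [BulkComponents.Theta, h1, h3, h2, P.values.Xi_eq z z.2]
  simp

theorem Zq_eq_zero (P : BoundaryProblem F X) (z : X.dom) : F.Zq (bdryPoint z) = 0 := by
  have h1 : ∑ c, F.gradXi (bdryPoint z) c * F.dXi (bdryPoint z) c = X.Sig * X.Sig := by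
    have h2 := congrArg (X.Sig * X.Sig * ·) (P.sum_nUp_nLow z)
    beta_reduce at h2
    rw [mul_one, Finset.mul_sum] at h2
    rw [← h2]
    exact Finset.sum_congr rfl fun c _ => by rw [P.gradXi_eq, P.dXi_eq]; ring
  rw [BulkComponents.Zq, h1, P.values.Xi_eq z z.2]
  linarith [P.Sig_sq]

theorem res_covD1_dXi (P : BoundaryProblem F X) (i : Fin 3) (b : Fin 4) :
    P.res (covD1 P.D4 P.christoffel4 (fun a => P.D4 a (ofSmooth F.Xi P.bulk.smooth_Xi)) (tang i) b)
      = P.D3 i (P.dXiB b) - ∑ e, P.christoffelB (tang i) e b * P.dXiB e := by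
  simp only [covD1, map_sub, map_sum, map_mul, P.res_D]
  rfl

theorem cov1_dXi (P : BoundaryProblem F X) (z : X.dom) (a b : Fin 4) :
    cov1 F.dom F.g F.dXi (bdryPoint z) a b = evalAt z (P.res (covD1 P.D4 P.christoffel4
      (fun a => P.D4 a (ofSmooth F.Xi P.bulk.smooth_Xi)) a b)) := by
  rw [P.evalAt_res]
  exact cov1_eval P.regular_bulk P.bulk.smooth_g P.det_bulk
    (fun b y => (represents_ofSmooth F.Xi P.bulk.smooth_Xi).pd_eq P.regular_bulk y b)
    ⟨bdryPoint z, P.maps z z.2⟩ a b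

/-- The tangential part of `∇∇Ξ` is `Σ` times the extrinsic curvature, which is `Σ ϰ ℓ = s ℓ`. -/
theorem upsilon_tang (P : BoundaryProblem F X) (z : X.dom) (i j : Fin 3) :
    F.Upsilon (bdryPoint z) (tang i) (tang j) = 0 := by
  have h1 : P.D3 i (P.dXiB (tang j)) - ∑ e, P.christoffelB (tang i) e (tang j) * P.dXiB e
      = algebraMap ℝ _ X.Sig * (P.kappaB * P.gB (tang i) (tang j)) := by
    simp only [P.dXiB_eq, P.umbilicBoundary.n_tang, mul_zero, map_zero]
    rw [sum_eq_normal_add_tang]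
    simp only [P.umbilicBoundary.n_tang, mul_zero, Finset.sum_const_zero, add_zero]
    rw [← P.umbilicBoundary.ell_eq]
    linear_combination (-algebraMap ℝ _ X.Sig) * P.umbilicBoundary.umbilic i j
  rw [BulkComponents.Upsilon, P.cov1_dXi, P.res_covD1_dXi, h1, P.values.Xi_eq z z.2,
    P.values.s_eq z z.2, map_mul, map_mul, AlgHom.commutes, P.gB_eval,
    BoundaryComponents.friedrich]
  simp only [kappaB, evalAt_ofSmooth, Algebra.algebraMap_self, RingHom.id_apply]
  ring

/-- The mixed part of `∇∇Ξ` is the tangential derivative of the constant `n^a ∇_a Ξ = Σ`. -/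
theorem sum_upsilon_normal (P : BoundaryProblem F X) (z : X.dom) (j : Fin 3) :
    ∑ a, F.nUp (bdryPoint z) a * F.Upsilon (bdryPoint z) a (tang j) = 0 := by
  have h1 : ∀ a, cov1 F.dom F.g F.dXi (bdryPoint z) a (tang j)
      = evalAt z (P.D3 j (P.dXiB a) - ∑ e, P.christoffelB (tang j) e a * P.dXiB e) := by
    intro a
    rw [P.cov1_dXi, P.levi_bulk.D_comm_covD1, P.res_covD1_dXi]
  have h2 : ∑ a, P.NB a * P.dXiB a = algebraMap ℝ _ X.Sig := smoothFunctions_ext fun z => by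
    simp only [map_sum, map_mul, P.NB_eval, P.dXiB_eval, AlgHom.commutes]
    exact P.values.Sig_eq z z.2
  have h3 := congrArg (evalAt z) (P.umbilicBoundary.N_contract j P.dXiB)
  rw [h2, Derivation.map_algebraMap, P.dXiB_eq (tang j), P.umbilicBoundary.n_tang, mul_zero,
    mul_zero, sub_zero, map_zero, map_sum] at h3
  simp only [map_mul, P.NB_eval, ← h1] at h3
  have h4 := P.sum_nUp_g z (tang j)
  rw [nLow_tang] at h4
  simp only [BulkComponents.Upsilon, P.values.Xi_eq z z.2]
  have h5 : ∀ a, F.nUp (bdryPoint z) a * (cov1 F.dom F.g F.dXi (bdryPoint z) a (tang j)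
      + 0 * F.L (bdryPoint z) a (tang j) - F.s (bdryPoint z) * F.g (bdryPoint z) a (tang j)
      - 1 / 2 * 0 ^ 3 * F.T (bdryPoint z) a (tang j))
      = F.nUp (bdryPoint z) a * cov1 F.dom F.g F.dXi (bdryPoint z) a (tang j)
        - F.s (bdryPoint z) * (F.nUp (bdryPoint z) a * F.g (bdryPoint z) a (tang j)) := by
    intro a; ring
  simp only [h5, Finset.sum_sub_distrib, ← Finset.mul_sum, h3, h4]
  ring

/-! ### The zero-quantity `Δ` -/

/-- The Schouten tensor of the boundary. -/
def schB (P : BoundaryProblem F X) : Fin 3 → Fin 3 → smoothFunctions X.dom :=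
  sch P.D3 P.ellB P.ellUpB P.christoffel3

/-- The Cotton tensor of the boundary. -/
def cotB (P : BoundaryProblem F X) : Fin 3 → Fin 3 → Fin 3 → smoothFunctions X.dom :=
  cot P.D3 P.ellB P.ellUpB P.christoffel3

theorem schB_eval (P : BoundaryProblem F X) (z : X.dom) (i j : Fin 3) :
    X.schouten z i j = evalAt z (P.schB i j) := by
  rw [BoundaryComponents.schouten, schB, sch, map_sub, map_mul, map_mul, AlgHom.commutes,
    ricci_eval P.regular_bdry P.bdry.smooth_ell P.det_bdry,
    scalarCurv_eval P.regular_bdry P.bdry.smooth_ell P.det_bdry]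
  rfl

theorem cotB_eval (P : BoundaryProblem F X) (z : X.dom) (i j k : Fin 3) :
    X.cotton z i j k = evalAt z (P.cotB i j k) := by
  rw [BoundaryComponents.cotton, cotB, cot, map_sub,
    cov2_eval P.regular_bdry P.bdry.smooth_ell P.det_bdry (fun b c z => P.schB_eval z b c),
    cov2_eval P.regular_bdry P.bdry.smooth_ell P.det_bdry (fun b c z => P.schB_eval z b c)]
  rfl

theorem LB_tang (P : BoundaryProblem F X) (i j : Fin 3) : P.LB (tang i) (tang j)
    = P.schB i j - algebraMap ℝ _ (1 / 2) * (P.kappaB * P.kappaB) * P.ellB i j :=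
  smoothFunctions_ext fun z => by
    rw [P.LB_eval, P.values.L2_eq z z.2, BoundaryComponents.L2, map_sub, map_mul, map_mul,
      AlgHom.commutes, P.schB_eval, map_mul, sq]
    rfl

/-- The skew part of `∇_i L_{jk}` is the Cotton tensor of the boundary. -/
theorem tcov2_L_skew (P : BoundaryProblem F X) (i j k : Fin 3) :
    tcov2 P.D3 P.christoffelB P.LB i (tang j) (tang k)
      - tcov2 P.D3 P.christoffelB P.LB j (tang i) (tang k) = P.cotB i j k := by
  have u := P.umbilicBoundary
  have hL : (fun j k => P.LB (tang j) (tang k)) = fun j k => P.schB j k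
      - algebraMap ℝ _ (1 / 2) * (P.kappaB * P.kappaB) * P.ellB j k :=
    funext fun j => funext fun k => P.LB_tang j k
  have hN : ∀ j, ∑ e, P.NB e * P.LB (tang j) e = -P.D3 j P.kappaB := by
    intro j
    rw [← P.sum_N_L]
    exact Finset.sum_congr rfl fun e _ => by rw [P.LB_symm]
  have hm := P.levi_bdry.covD2_metric
  have hc : ∀ i j k, covD2 P.D3 P.christoffel3 (fun j k => P.LB (tang j) (tang k)) i j k
      = covD2 P.D3 P.christoffel3 P.schB i j k - P.kappaB * P.D3 i P.kappaB * P.ellB j k := by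
    intro i j k
    rw [hL, covD2_sub (fun j k => P.schB j k)
      (fun j k => algebraMap ℝ _ (1 / 2) * (P.kappaB * P.kappaB) * P.ellB j k),
      covD2_mul _ (fun j k => P.ellB j k), hm]
    simp only [Derivation.leibniz, Derivation.map_algebraMap, smul_eq_mul]
    linear_combination (-(P.kappaB * P.D3 i P.kappaB * P.ellB j k))
      * algebraMap_half (R := smoothFunctions X.dom)
  rw [u.tcov2_tang, u.tcov2_tang, hc, hc, P.sum_N_L, hN, hN, P.levi_bdry.G_swap j i]
  simp only [cotB, cot]
  change _ = covD2 P.D3 P.christoffel3 P.schB i j k - covD2 P.D3 P.christoffel3 P.schB j i k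
  ring

theorem dB_skew_left (P : BoundaryProblem F X) (a b c f : Fin 4) :
    P.dB a b c f = -P.dB b a c f := smoothFunctions_ext fun z => by
  rw [map_neg, P.dB_eval, P.dB_eval, P.bulk.d_antisymm_left _ (P.maps z z.2)]

theorem dB_skew_right (P : BoundaryProblem F X) (a b c f : Fin 4) :
    P.dB a b c f = -P.dB a b f c := smoothFunctions_ext fun z => by
  rw [map_neg, P.dB_eval, P.dB_eval, P.bulk.d_antisymm_right _ (P.maps z z.2)]

theorem dB_pair (P : BoundaryProblem F X) (a b c f : Fin 4) :
    P.dB a b c f = P.dB c f a b := smoothFunctions_ext fun z => by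
  rw [P.dB_eval, P.dB_eval, P.bulk.d_pair _ (P.maps z z.2)]

theorem sum_N_d3 (P : BoundaryProblem F X) (i j k : Fin 3) :
    ∑ b, P.NB b * P.dB (tang i) b (tang j) (tang k)
      = -(algebraMap ℝ _ X.Sig⁻¹ * P.cotB j k i) := smoothFunctions_ext fun z => by
  simp only [map_sum, map_mul, P.NB_eval, P.dB_eval, map_neg, AlgHom.commutes]
  rw [P.values.d3_eq z z.2, BoundaryComponents.d3, P.cotB_eval]
  rfl

/-- The Cotton tensor cancels the term `∇_e Ξ d^e_{cab}` by the choice of `d_{kij}`. -/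
theorem delta_tang (P : BoundaryProblem F X) (z : X.dom) (i j k : Fin 3) :
    F.Delta (bdryPoint z) (tang i) (tang j) (tang k) = 0 := by
  have h1 := congrArg (evalAt z) (P.tcov2_L_skew i j k)
  rw [map_sub, ← P.cov2_L_tang, ← P.cov2_L_tang] at h1
  have h2 := congrArg (evalAt z) (P.sum_N_d3 k i j)
  simp only [map_sum, map_mul, P.NB_eval, P.dB_eval, map_neg, AlgHom.commutes] at h2
  have h3 : ∑ e, F.gradXi (bdryPoint z) e * F.d (bdryPoint z) e (tang k) (tang i) (tang j)
      = -(X.Sig * ∑ b, F.nUp (bdryPoint z) b * F.d (bdryPoint z) (tang k) b (tang i) (tang j)) := by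
    rw [Finset.mul_sum, ← Finset.sum_neg_distrib]
    exact Finset.sum_congr rfl fun e _ => by
      rw [P.gradXi_eq, P.bulk.d_antisymm_left _ (P.maps z z.2)]; ring
  rw [BulkComponents.Delta, h1, h3, h2, P.values.Xi_eq z z.2]
  have h4 := P.Sig_ne_zero
  simp only [Algebra.algebraMap_self, RingHom.id_apply]
  field_simp
  ring

theorem sum_sum_skew {R : Type*} [CommRing R] [Algebra ℝ R] {ι : Type*} [Fintype ι] {N : ι → R}
    {A : ι → ι → R} (h : ∀ a b, A a b = -A b a) : ∑ a, N a * ∑ b, N b * A a b = 0 := by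
  have h1 : ∑ a, N a * ∑ b, N b * A a b = -∑ a, N a * ∑ b, N b * A a b := by
    conv_lhs => simp only [Finset.mul_sum]
    rw [Finset.sum_comm, ← Finset.sum_neg_distrib]
    refine Finset.sum_congr rfl fun a _ => ?_
    rw [Finset.mul_sum, ← Finset.sum_neg_distrib]
    exact Finset.sum_congr rfl fun b _ => by rw [h b a]; ring
  apply two_cancel
  linear_combination h1

theorem sum_symm_mul_skew {R : Type*} [CommRing R] [Algebra ℝ R] {ι : Type*} [Fintype ι]
    {H A : ι → ι → R} (hH : ∀ a b, H a b = H b a) (h : ∀ a b, A a b = -A b a) :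
    ∑ a, ∑ b, H a b * A a b = 0 := by
  have h1 : ∑ a, ∑ b, H a b * A a b = -∑ a, ∑ b, H a b * A a b := by
    conv_lhs => rw [Finset.sum_comm]
    rw [← Finset.sum_neg_distrib]
    refine Finset.sum_congr rfl fun a _ => ?_
    rw [← Finset.sum_neg_distrib]
    exact Finset.sum_congr rfl fun b _ => by rw [hH, h b a]; ring
  apply two_cancel
  linear_combination h1

/-- What remains of `Δ` is the antisymmetric part of the Hessian of `ϰ`, since `L_{ij}` is symmetric
and `d_{ebij}` is antisymmetric in `e` and `b`. -/
theorem sum_delta_normal (P : BoundaryProblem F X) (z : X.dom) (i j : Fin 3) :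
    ∑ b, F.nUp (bdryPoint z) b * F.Delta (bdryPoint z) (tang i) (tang j) b = 0 := by
  have u := P.umbilicBoundary
  have hN : (fun j => ∑ b, P.NB b * P.LB (tang j) b) = fun j => -P.D3 j P.kappaB := by
    funext j
    rw [← P.sum_N_L]
    exact Finset.sum_congr rfl fun e _ => by rw [P.LB_symm]
  have hs : covD1 P.D3 P.christoffel3 (fun j => -P.D3 j P.kappaB) i j
      = covD1 P.D3 P.christoffel3 (fun j => -P.D3 j P.kappaB) j i := by
    have h := P.levi_bdry.D_comm_covD1 (-P.kappaB) i j
    simpa only [map_neg] using h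
  have h1 : ∑ b, P.NB b * tcov2 P.D3 P.christoffelB P.LB i (tang j) b
      - ∑ b, P.NB b * tcov2 P.D3 P.christoffelB P.LB j (tang i) b = 0 := by
    rw [u.tcov2_normal, u.tcov2_normal, hN, hs, P.levi_bdry.G_swap j i, P.LB_symm (tang j)]
    ring
  have h2 := congrArg (evalAt z) h1
  simp only [map_sub, map_sum, map_mul, P.NB_eval, ← P.cov2_L_tang, map_zero] at h2
  have h3 : ∑ b, F.nUp (bdryPoint z) b * ∑ e, F.gradXi (bdryPoint z) e
      * F.d (bdryPoint z) e b (tang i) (tang j) = 0 := by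
    have h4 := sum_sum_skew (N := F.nUp (bdryPoint z))
      (A := fun b e => F.d (bdryPoint z) e b (tang i) (tang j))
      (fun b e => P.bulk.d_antisymm_left _ (P.maps z z.2) _ _ _ _)
    have h5 : ∀ b, ∑ e, F.gradXi (bdryPoint z) e * F.d (bdryPoint z) e b (tang i) (tang j)
        = X.Sig * ∑ e, F.nUp (bdryPoint z) e * F.d (bdryPoint z) e b (tang i) (tang j) := by
      intro b
      rw [Finset.mul_sum]
      exact Finset.sum_congr rfl fun e _ => by rw [P.gradXi_eq]; ring
    simp only [h5, mul_left_comm _ X.Sig, ← Finset.mul_sum, h4, mul_zero]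
  simp only [BulkComponents.Delta, P.values.Xi_eq z z.2, zero_mul, sub_zero, mul_sub,
    Finset.sum_sub_distrib, h3, h2]

end BoundaryProblem

end
end ConformalBoundary

namespace ConformalBoundary

noncomputable section

/-! ### Symmetries of covariant derivatives -/

section Tensor

variable {R : Type*} [CommRing R] [Algebra ℝ R] {n : ℕ} (D : Fin n → Derivation ℝ R R)
  (Γ : Fin n → Matrix (Fin n) (Fin n) R)

theorem covD4_skew {A : Fin n → Fin n → Fin n → Fin n → R}
    (h : ∀ a b c f, A a b c f = -A b a c f) (e a b c f : Fin n) :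
    covD4 D Γ A e a b c f = -covD4 D Γ A e b a c f := by
  rw [covD4, covD4, h a b, map_neg, neg_sub, sub_eq_add_neg, add_comm, sub_eq_add_neg,
    ← Finset.sum_neg_distrib]
  congr 1
  exact Finset.sum_congr rfl fun x _ => by rw [h x b, h a x, h a b, h a b]; ring

theorem covD2_symm {A : Fin n → Fin n → R} (h : ∀ a b, A a b = A b a) (k i j : Fin n) :
    covD2 D Γ A k i j = covD2 D Γ A k j i := by
  rw [covD2, covD2, h i j]
  congr 1
  exact Finset.sum_congr rfl fun e _ => by rw [h e j, h i e, add_comm]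

theorem covD3_const_mul (r : ℝ) (A : Fin n → Fin n → Fin n → R) (l i j k : Fin n) :
    covD3 D Γ (fun l i j => -(algebraMap ℝ R r * A i j l)) k l i j
      = -(algebraMap ℝ R r * covD3 D Γ A k i j l) := by
  simp only [covD3, map_neg, Derivation.leibniz, Derivation.map_algebraMap, smul_eq_mul, mul_zero,
    add_zero, mul_sub, Finset.mul_sum, neg_sub]
  rw [sub_eq_add_neg, ← Finset.sum_neg_distrib, sub_eq_add_neg, add_comm]
  congr 1
  exact Finset.sum_congr rfl fun e _ => by ring

end Tensor

namespace BoundaryProblem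

variable {F : BulkComponents} {X : BoundaryComponents}

/-! ### The foliation of the boundary -/

theorem ellUp_smooth (P : BoundaryProblem F X) :
    ContDiffOn ℝ ∞ (fun z => -X.ellUp z 0 0) X.dom :=
  (metricInv_smooth P.bdry.smooth_ell P.det_bdry 0 0).neg

theorem neg_ellUp_pos (P : BoundaryProblem F X) (z : Fin 3 → ℝ) (hz : z ∈ X.dom) :
    0 < -X.ellUp z 0 0 := neg_pos.2 (P.bdry.leaves_spacelike z hz)

/-- The function `1 / √(-ℓ⁰⁰)`, the lapse of the foliation. -/
def lapseB (P : BoundaryProblem F X) : smoothFunctions X.dom :=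
  ofSmooth (fun z => 1 / √(-X.ellUp z 0 0))
    (contDiffOn_const.div (P.ellUp_smooth.sqrt fun z hz => (P.neg_ellUp_pos z hz).ne')
      fun z hz => (Real.sqrt_pos.2 (P.neg_ellUp_pos z hz)).ne')

/-- The unit conormal of the leaves. -/
def nuB (P : BoundaryProblem F X) (i : Fin 3) : smoothFunctions X.dom :=
  if i = 0 then -P.lapseB else 0

/-- The unit normal of the leaves. -/
def nuUpB (P : BoundaryProblem F X) (i : Fin 3) : smoothFunctions X.dom :=
  ∑ j, P.ellUpB i j * P.nuB j

theorem nuB_eval (P : BoundaryProblem F X) (z : X.dom) (i : Fin 3) :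
    X.nu z i = evalAt z (P.nuB i) := by
  rw [nuB, BoundaryComponents.nu, delta]
  split_ifs <;> simp [lapseB]

theorem ellUpB_eval (P : BoundaryProblem F X) (z : X.dom) (i j : Fin 3) :
    X.ellUp z i j = evalAt z (P.ellUpB i j) := rfl

theorem nuUpB_eval (P : BoundaryProblem F X) (z : X.dom) (i : Fin 3) :
    X.nuUp z i = evalAt z (P.nuUpB i) := by
  simp only [nuUpB, BoundaryComponents.nuUp, map_sum, map_mul, P.nuB_eval, P.ellUpB_eval]

theorem kExt_eval (P : BoundaryProblem F X) (z : X.dom) (i j : Fin 3) :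
    X.kExt z i j = evalAt z (covD1 P.D3 P.christoffel3 P.nuB i j) :=
  cov1_eval P.regular_bdry P.bdry.smooth_ell P.det_bdry (fun b z => P.nuB_eval z b) z i j

theorem foliation (P : BoundaryProblem F X) :
    IsGeodesicFoliation P.D3 P.ellB P.ellUpB P.christoffel3 P.nuB P.nuUpB where
  levi := P.levi_bdry
  up _ := rfl
  conormal i hi := by simp [nuB, hi]
  unit := smoothFunctions_ext fun z => by
    have h1 := P.neg_ellUp_pos z z.2
    rw [nuUpB, Fin.sum_univ_three]
    simp only [nuB, if_pos, Fin.reduceEq, if_false, mul_zero, add_zero, one_ne_zero]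
    simp only [map_mul, map_neg, map_one, ← P.ellUpB_eval, lapseB, evalAt_ofSmooth]
    have h2 := Real.mul_self_sqrt h1.le
    have h3 := (Real.sqrt_pos.2 h1).ne'
    field_simp
    linarith
  geodesic i := smoothFunctions_ext fun z => by
    have h1 := P.bdry.geodesic z z.2 i
    rw [BoundaryComponents.normalD1] at h1
    simp only [map_sum, map_mul, map_zero, ← P.nuUpB_eval, ← P.kExt_eval]
    exact h1

/-- The tensor `w_{{ij}}`. -/
def wTFB (P : BoundaryProblem F X) (i j : Fin 3) : smoothFunctions X.dom :=
  ofSmooth (fun z => X.wTF z i j) (P.bdry.smooth_wTF i j)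

/-- The covector `w_i`. -/
def wVecB (P : BoundaryProblem F X) (i : Fin 3) : smoothFunctions X.dom :=
  ofSmooth (fun z => X.wVec z i) (P.bdry.smooth_wVec i)

/-- The function `w`. -/
def wB (P : BoundaryProblem F X) : smoothFunctions X.dom := ofSmooth X.w P.bdry.smooth_w

/-- The covector `p_i`. -/
def pVecB (P : BoundaryProblem F X) (i : Fin 3) : smoothFunctions X.dom :=
  ofSmooth (fun z => X.pVec z i) (P.bdry.smooth_pVec i)

/-- The function `p`. -/
def pB (P : BoundaryProblem F X) : smoothFunctions X.dom := ofSmooth X.p P.bdry.smooth_p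

/-- The tensor `d_{ij}` of the boundary data. -/
def d2B (P : BoundaryProblem F X) (i j : Fin 3) : smoothFunctions X.dom :=
  P.wTFB i j + algebraMap ℝ _ (1 / 2) * P.wB * (P.ellB i j + P.nuB i * P.nuB j)
    - P.nuB i * P.wVecB j - P.nuB j * P.wVecB i + P.wB * P.nuB i * P.nuB j

theorem d2B_eval (P : BoundaryProblem F X) (z : X.dom) (i j : Fin 3) :
    X.d2 z i j = evalAt z (P.d2B i j) := by
  simp only [d2B, map_add, map_sub, map_mul, ← P.nuB_eval, AlgHom.commutes]
  rfl

/-- The divergence constraint `D^j d_{ij} = -Σ j_i`, which is what the two evolution equations for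
`w` and `w_i` say. -/
theorem div_d2 (P : BoundaryProblem F X) (z : X.dom) (i : Fin 3) :
    evalAt z (∑ j, ∑ m, P.ellUpB j m * covD2 P.D3 P.christoffel3 P.d2B m i j)
      = -(X.Sig * X.j1 z i) := by
  have e1 : ∀ (z : X.dom) i j, cov1 X.dom X.ell X.wVec z i j
      = evalAt z (covD1 P.D3 P.christoffel3 P.wVecB i j) := fun z i j =>
    cov1_eval P.regular_bdry P.bdry.smooth_ell P.det_bdry
      (fun b => represents_ofSmooth _ (P.bdry.smooth_wVec b)) z i j
  have e2 : ∀ (z : X.dom) i j k, cov2 X.dom X.ell X.wTF z i j k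
      = evalAt z (covD2 P.D3 P.christoffel3 P.wTFB i j k) := fun z i j k =>
    cov2_eval P.regular_bdry P.bdry.smooth_ell P.det_bdry
      (fun b c => represents_ofSmooth _ (P.bdry.smooth_wTF b c)) z i j k
  have e3 : ∀ (z : X.dom) i, X.grad X.w z i = evalAt z (P.D3 i P.wB) := fun z i =>
    (represents_ofSmooth X.w P.bdry.smooth_w).pd_eq P.regular_bdry z i
  have e4 : ∀ (z : X.dom) i j, evalAt z ((1 : Matrix (Fin 3) (Fin 3) (smoothFunctions X.dom)) i j)
      = delta i j := by
    intro z i j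
    by_cases h : i = j
    · rw [h, Matrix.one_apply_eq, map_one, delta, if_pos rfl]
    · rw [Matrix.one_apply_ne h, map_zero, delta, if_neg h]
  have h := P.foliation.divergence (A := P.wTFB) (α := P.wVecB) (q := P.pVecB) (w := P.wB)
    (p := P.pB) (σ := algebraMap ℝ _ X.Sig)
    (fun i => smoothFunctions_ext fun z => by
      simp only [map_sum, map_mul, map_zero, ← P.nuUpB_eval]
      exact P.bdry.wTF_spatial z z.2 i)
    (fun i j => smoothFunctions_ext fun z => P.bdry.wTF_symm z z.2 i j)
    (smoothFunctions_ext fun z => by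
      simp only [map_sum, map_mul, map_zero, ← P.nuUpB_eval]
      exact P.bdry.wVec_spatial z z.2)
    (smoothFunctions_ext fun z => by
      simp only [map_sum, map_mul, map_sub, map_add, ← P.nuUpB_eval, ← P.ellUpB_eval, ← P.kExt_eval,
        ← e1, ← e3, AlgHom.commutes]
      exact P.bdry.evolution_w z z.2)
    (fun i => smoothFunctions_ext fun z => by
      simp only [map_sum, map_mul, map_sub, map_add, ← P.nuUpB_eval, ← P.nuB_eval, ← P.ellUpB_eval,
        ← P.kExt_eval, ← e1, ← e2, ← e3, e4, AlgHom.commutes, map_neg, map_ofNat]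
      exact P.bdry.evolution_wVec z z.2 i) i
  have h1 := congrArg (evalAt z) h
  refine h1.trans ?_
  simp only [map_neg, map_mul, map_sub, ← P.nuB_eval, AlgHom.commutes]
  rfl

/-! ### The zero-quantity `Λ` -/

/-- The electric part `n^b n^e d_{ibje}` has the prescribed boundary value. -/
theorem sum_N_N_d (P : BoundaryProblem F X) (i j : Fin 3) :
    ∑ b, P.NB b * ∑ e, P.NB e * P.dB (tang i) b (tang j) e = P.d2B i j :=
  smoothFunctions_ext fun z => by
    simp only [map_sum, map_mul, P.NB_eval, P.dB_eval, Finset.mul_sum, ← mul_assoc]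
    rw [P.values.d2_eq z z.2, P.d2B_eval]

theorem d2B_symm (P : BoundaryProblem F X) (i j : Fin 3) : P.d2B i j = P.d2B j i := by
  rw [← P.sum_N_N_d, ← P.sum_N_N_d]
  simp only [Finset.mul_sum]
  rw [Finset.sum_comm]
  exact Finset.sum_congr rfl fun a _ => Finset.sum_congr rfl fun b _ => by rw [P.dB_pair]; ring

/-- The decomposition of the inverse metric at a boundary point. -/
theorem sum_gUp (P : BoundaryProblem F X) (z : X.dom) (A : Fin 4 → Fin 4 → ℝ) :
    ∑ e, ∑ f, F.gUp (bdryPoint z) e f * A e f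
      = ∑ e, F.nUp (bdryPoint z) e * ∑ f, F.nUp (bdryPoint z) f * A e f
        + ∑ k, ∑ l, X.ellUp z k l * A (tang k) (tang l) := by
  have h := congrArg (evalAt z) (P.umbilicBoundary.sum_h (fun e f => algebraMap ℝ _ (A e f)))
  simp only [map_sum, map_mul, map_add, P.hB_eval, P.NB_eval, AlgHom.commutes, ← P.ellUpB_eval,
    Algebra.algebraMap_self, RingHom.id_apply, mul_assoc, ← Finset.mul_sum] at h
  exact h

theorem cov4_d_skew (P : BoundaryProblem F X) (z : X.dom) (e f b c d : Fin 4) :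
    cov4 F.dom F.g F.d (bdryPoint z) e f b c d = -cov4 F.dom F.g F.d (bdryPoint z) e b f c d := by
  have hr := fun b c d f => represents_ofSmooth _ (P.bulk.smooth_d b c d f)
  rw [cov4_eval P.regular_bulk P.bulk.smooth_g P.det_bulk hr ⟨bdryPoint z, P.maps z z.2⟩,
    cov4_eval P.regular_bulk P.bulk.smooth_g P.det_bulk hr ⟨bdryPoint z, P.maps z z.2⟩, ← map_neg]
  congr 1
  have hs : ∀ a b c f, ofSmooth _ (P.bulk.smooth_d a b c f)
      = -ofSmooth _ (P.bulk.smooth_d b a c f) :=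
    fun a b c f => smoothFunctions_ext fun y => by
      rw [map_neg]
      exact P.bulk.d_antisymm_left y y.2 a b c f
  exact covD4_skew _ _ hs _ _ _ _ _

/-- The divergence of `d_{abcf}`, contracted with the normal in the second slot: only tangential
derivatives survive, because of the antisymmetry in the first two slots. -/
theorem sum_nUp_div_d (P : BoundaryProblem F X) (z : X.dom) (c d : Fin 4) :
    ∑ b, F.nUp (bdryPoint z) b * ∑ e, ∑ f, F.gUp (bdryPoint z) e f
        * cov4 F.dom F.g F.d (bdryPoint z) e f b c d
      = ∑ k, ∑ l, X.ellUp z k l * ∑ b, F.nUp (bdryPoint z) b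
        * cov4 F.dom F.g F.d (bdryPoint z) (tang k) (tang l) b c d := by
  have h1 : ∑ b, F.nUp (bdryPoint z) b * ∑ e, ∑ f, F.gUp (bdryPoint z) e f
        * cov4 F.dom F.g F.d (bdryPoint z) e f b c d
      = ∑ e, ∑ f, F.gUp (bdryPoint z) e f * ∑ b, F.nUp (bdryPoint z) b
        * cov4 F.dom F.g F.d (bdryPoint z) e f b c d := by
    simp only [Finset.mul_sum]
    rw [Finset.sum_comm]
    refine Finset.sum_congr rfl fun e _ => ?_
    rw [Finset.sum_comm]
    exact Finset.sum_congr rfl fun f _ => Finset.sum_congr rfl fun b _ => by ring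
  rw [h1, P.sum_gUp z (fun e f => ∑ b, F.nUp (bdryPoint z) b
    * cov4 F.dom F.g F.d (bdryPoint z) e f b c d)]
  have h2 : ∀ e, ∑ f, F.nUp (bdryPoint z) f * ∑ b, F.nUp (bdryPoint z) b
      * cov4 F.dom F.g F.d (bdryPoint z) e f b c d = 0 := fun e =>
    sum_sum_skew fun f b => P.cov4_d_skew z e f b c d
  simp [h2]

theorem sum_ellUp_mul_ell (P : BoundaryProblem F X) (i : Fin 3)
    (Y : Fin 3 → smoothFunctions X.dom) :
    ∑ k, ∑ l, P.ellUpB k l * (P.ellB k i * Y l) = Y i := by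
  rw [← P.levi_bdry.sum_inv_mul_metric Y i]
  exact Finset.sum_congr rfl fun k _ => Finset.sum_congr rfl fun l _ => by ring

/-- `n^b ∇^e d_{ebij} = 0`, since the divergence of the Cotton tensor vanishes. -/
theorem sum_div_d_normal (P : BoundaryProblem F X) (i j : Fin 3) :
    ∑ k, ∑ l, P.ellUpB k l * ∑ b, P.NB b
      * tcov4 P.D3 P.christoffelB P.dB k (tang l) b (tang i) (tang j) = 0 := by
  have hd3 : (fun l i j => ∑ b, P.NB b * P.dB (tang l) b (tang i) (tang j))
      = fun l i j => -(algebraMap ℝ _ X.Sig⁻¹ * P.cotB i j l) :=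
    funext fun l => funext fun i => funext fun j => P.sum_N_d3 l i j
  have hc : ∀ k l, covD3 P.D3 P.christoffel3 (fun l i j => -(algebraMap ℝ _ X.Sig⁻¹ * P.cotB i j l))
      k l i j = -(algebraMap ℝ _ X.Sig⁻¹ * covD3 P.D3 P.christoffel3 P.cotB k i j l) := fun k l =>
    covD3_const_mul _ _ _ _ _ _ _ _
  have hz : ∑ e, P.NB e * ∑ b, P.NB b * P.dB e b (tang i) (tang j) = 0 :=
    sum_sum_skew fun e b => P.dB_skew_left e b _ _
  have h2 : ∀ l, ∑ e, P.NB e * ∑ b, P.NB b * P.dB (tang l) b e (tang j) = -P.d2B l j := by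
    intro l
    rw [← P.sum_N_N_d]
    simp only [Finset.mul_sum]
    rw [Finset.sum_comm, ← Finset.sum_neg_distrib]
    refine Finset.sum_congr rfl fun b _ => ?_
    rw [← Finset.sum_neg_distrib]
    exact Finset.sum_congr rfl fun e _ => by rw [P.dB_skew_right _ _ e]; ring
  have h3 : ∀ l, ∑ e, P.NB e * ∑ b, P.NB b * P.dB (tang l) b (tang i) e = P.d2B l i := by
    intro l
    rw [← P.sum_N_N_d]
    simp only [Finset.mul_sum]
    rw [Finset.sum_comm]
    exact Finset.sum_congr rfl fun b _ => Finset.sum_congr rfl fun e _ => by ring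
  have h4 : ∀ k l, ∑ b, P.NB b * tcov4 P.D3 P.christoffelB P.dB k (tang l) b (tang i) (tang j)
      = -(algebraMap ℝ _ X.Sig⁻¹ * covD3 P.D3 P.christoffel3 P.cotB k i j l)
        + P.kappaB * (P.ellB k j * P.d2B l i - P.ellB k i * P.d2B l j)
        - P.kappaB * P.dB (tang l) (tang k) (tang i) (tang j) := by
    intro k l
    rw [P.umbilicBoundary.tcov4_normal, hd3, hc, hz, h2, h3]
    ring
  have h5 : ∑ k, ∑ l, P.ellUpB k l * covD3 P.D3 P.christoffel3 P.cotB k i j l = 0 :=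
    P.levi_bdry.div_cot i j
  have h6 : ∑ k, ∑ l, P.ellUpB k l * P.dB (tang l) (tang k) (tang i) (tang j) = 0 :=
    sum_symm_mul_skew P.levi_bdry.H_swap fun k l => P.dB_skew_left _ _ _ _
  have h7 := P.sum_ellUp_mul_ell j (fun l => P.d2B l i)
  have h8 := P.sum_ellUp_mul_ell i (fun l => P.d2B l j)
  have h9 : ∑ k, ∑ l, P.ellUpB k l * ∑ b, P.NB b
      * tcov4 P.D3 P.christoffelB P.dB k (tang l) b (tang i) (tang j)
      = -(algebraMap ℝ _ X.Sig⁻¹)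
          * ∑ k, ∑ l, P.ellUpB k l * covD3 P.D3 P.christoffel3 P.cotB k i j l
        + P.kappaB * (∑ k, ∑ l, P.ellUpB k l * (P.ellB k j * P.d2B l i)
          - ∑ k, ∑ l, P.ellUpB k l * (P.ellB k i * P.d2B l j))
        - P.kappaB * ∑ k, ∑ l, P.ellUpB k l * P.dB (tang l) (tang k) (tang i) (tang j) := by
    simp only [h4, Finset.mul_sum, ← Finset.sum_add_distrib, ← Finset.sum_sub_distrib]
    exact Finset.sum_congr rfl fun b _ => Finset.sum_congr rfl fun e _ => by ring
  rw [h9, h5, h6, h7, h8, P.d2B_symm j i]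
  ring

/-- The trace over the tangential slots of `n^b d_{kbli}` vanishes. -/
theorem trace_d3 (P : BoundaryProblem F X) (i : Fin 3) :
    ∑ k, ∑ l, P.ellUpB k l * ∑ b, P.NB b * P.dB (tang l) b (tang i) (tang k) = 0 := by
  have h1 : ∑ b, P.NB b * ∑ a, ∑ c, P.hB a c * P.dB a b c (tang i) = 0 := by
    have : ∀ b, ∑ a, ∑ c, P.hB a c * P.dB a b c (tang i) = 0 := fun b =>
      smoothFunctions_ext fun z => by
        simp only [map_sum, map_mul, P.hB_eval, P.dB_eval, map_zero]
        exact P.bulk.d_tracefree _ (P.maps z z.2) b (tang i)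
    simp [this]
  simp only [P.umbilicBoundary.sum_h, mul_add, Finset.sum_add_distrib] at h1
  have h2 : ∑ b, P.NB b * ∑ e, ∑ f, P.NB e * P.NB f * P.dB e b f (tang i) = 0 := by
    have h3 := sum_sum_skew (N := P.NB) (A := fun b e => ∑ f, P.NB f * P.dB e b f (tang i))
      (fun b e => by
        rw [← Finset.sum_neg_distrib]
        exact Finset.sum_congr rfl fun f _ => by rw [P.dB_skew_left]; ring)
    rw [← h3]
    simp only [mul_assoc, ← Finset.mul_sum]
  rw [h2, zero_add] at h1
  rw [← neg_eq_zero, ← h1]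
  simp only [Finset.mul_sum]
  rw [Finset.sum_comm, ← Finset.sum_neg_distrib]
  conv_rhs => rw [Finset.sum_comm]
  refine Finset.sum_congr rfl fun k _ => ?_
  rw [← Finset.sum_neg_distrib]
  conv_rhs => rw [Finset.sum_comm]
  refine Finset.sum_congr rfl fun l _ => ?_
  rw [← Finset.sum_neg_distrib]
  refine Finset.sum_congr rfl fun b _ => ?_
  rw [P.dB_skew_right _ _ (tang l), P.levi_bdry.H_swap l k]
  ring

end BoundaryProblem

end
end ConformalBoundary

namespace ConformalBoundary

noncomputable section

namespace BoundaryProblem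

variable {F : BulkComponents} {X : BoundaryComponents}

/-- At the boundary the term with `Ξ` drops out and `∇Ξ = Σ n`. -/
theorem rescaledCotton_eq (P : BoundaryProblem F X) (z : X.dom) (a b c : Fin 4) :
    F.rescaledCotton (bdryPoint z) a b c
      = -(1 / 2 * X.Sig * (F.g (bdryPoint z) c a
            * ∑ e, F.nUp (bdryPoint z) e * F.T (bdryPoint z) b e
          - F.g (bdryPoint z) c b * ∑ e, F.nUp (bdryPoint z) e * F.T (bdryPoint z) a e))
        - 3 / 2 * X.Sig * (F.T (bdryPoint z) c a * F.nLow (bdryPoint z) b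
          - F.T (bdryPoint z) c b * F.nLow (bdryPoint z) a) := by
  have h1 : ∑ e, 1 / 2 * (F.g (bdryPoint z) c a * F.T (bdryPoint z) b e
        - F.g (bdryPoint z) c b * F.T (bdryPoint z) a e) * F.gradXi (bdryPoint z) e
      = 1 / 2 * X.Sig * (F.g (bdryPoint z) c a
            * ∑ e, F.nUp (bdryPoint z) e * F.T (bdryPoint z) b e
          - F.g (bdryPoint z) c b * ∑ e, F.nUp (bdryPoint z) e * F.T (bdryPoint z) a e) := by
    rw [Finset.mul_sum, Finset.mul_sum, ← Finset.sum_sub_distrib, Finset.mul_sum]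
    exact Finset.sum_congr rfl fun e _ => by rw [P.gradXi_eq]; ring
  rw [BulkComponents.rescaledCotton, h1, P.values.Xi_eq z z.2, P.dXi_eq, P.dXi_eq]
  ring

theorem sum_cotton_normal (P : BoundaryProblem F X) (z : X.dom) (i j : Fin 3) :
    ∑ b, F.nUp (bdryPoint z) b * F.rescaledCotton (bdryPoint z) (tang i) (tang j) b = 0 := by
  set t := fun a => ∑ e, F.nUp (bdryPoint z) e * F.T (bdryPoint z) a e
  have h : ∀ b, F.nUp (bdryPoint z) b * F.rescaledCotton (bdryPoint z) (tang i) (tang j) b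
      = -(1 / 2 * X.Sig * t (tang j)) * (F.nUp (bdryPoint z) b * F.g (bdryPoint z) b (tang i))
        + 1 / 2 * X.Sig * t (tang i) * (F.nUp (bdryPoint z) b * F.g (bdryPoint z) b (tang j)) := by
    intro b
    rw [P.rescaledCotton_eq, nLow_tang, nLow_tang]
    ring
  simp only [h, Finset.sum_add_distrib, ← Finset.mul_sum, P.sum_nUp_g, nLow_tang]
  ring

theorem sum_cotton_normal_normal (P : BoundaryProblem F X) (z : X.dom) (i : Fin 3) :
    ∑ b, F.nUp (bdryPoint z) b * ∑ d, F.nUp (bdryPoint z) d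
      * F.rescaledCotton (bdryPoint z) (tang i) d b = -(X.Sig * X.j1 z i) := by
  have ht := P.values.j1_eq z z.2 i
  set t := fun a => ∑ e, F.nUp (bdryPoint z) e * F.T (bdryPoint z) a e with ht'
  have h : ∀ b, F.nUp (bdryPoint z) b * ∑ d, F.nUp (bdryPoint z) d
      * F.rescaledCotton (bdryPoint z) (tang i) d b
      = -(1 / 2 * X.Sig * ∑ d, F.nUp (bdryPoint z) d * t d)
          * (F.nUp (bdryPoint z) b * F.g (bdryPoint z) b (tang i))
        + 1 / 2 * X.Sig * t (tang i) * (F.nUp (bdryPoint z) b * F.nLow (bdryPoint z) b)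
        - 3 / 2 * X.Sig * (F.nUp (bdryPoint z) b * F.T (bdryPoint z) (tang i) b) := by
    intro b
    have h1 : ∀ d, F.nUp (bdryPoint z) d * F.rescaledCotton (bdryPoint z) (tang i) d b
        = -(1 / 2 * X.Sig * F.g (bdryPoint z) b (tang i)) * (F.nUp (bdryPoint z) d * t d)
          + 1 / 2 * X.Sig * t (tang i) * (F.g (bdryPoint z) b d * F.nUp (bdryPoint z) d)
          - 3 / 2 * X.Sig * F.T (bdryPoint z) (tang i) b
            * (F.nUp (bdryPoint z) d * F.nLow (bdryPoint z) d) := by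
      intro d
      rw [P.rescaledCotton_eq, nLow_tang, P.bulk.T_symm _ (P.maps z z.2) b (tang i)]
      ring
    simp only [h1, Finset.sum_add_distrib, Finset.sum_sub_distrib, ← Finset.mul_sum, P.sum_g_nUp,
      P.sum_nUp_nLow]
    ring
  have ht2 : t (tang i) = X.j1 z i := ht
  simp only [h, Finset.sum_add_distrib, Finset.sum_sub_distrib, ← Finset.mul_sum, P.sum_nUp_g,
    P.sum_nUp_nLow, nLow_tang, ht, ht2]
  ring

theorem sum_lambda_normal (P : BoundaryProblem F X) (z : X.dom) (i j : Fin 3) :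
    ∑ b, F.nUp (bdryPoint z) b * F.Lambda (bdryPoint z) b (tang i) (tang j) = 0 := by
  have h := congrArg (evalAt z) (P.sum_div_d_normal i j)
  simp only [map_sum, map_mul, map_zero, P.NB_eval, ← P.ellUpB_eval, ← P.cov4_d_tang] at h
  simp only [BulkComponents.Lambda, mul_sub, Finset.sum_sub_distrib, P.sum_cotton_normal,
    P.sum_nUp_div_d, h, sub_zero]

/-- `n^b n^d ∇^e d_{ebid} = D^j d_{ij}`. -/
theorem sum_div_d_normal_normal (P : BoundaryProblem F X) (i : Fin 3) :
    ∑ k, ∑ l, P.ellUpB k l * ∑ b, P.NB b * ∑ d, P.NB d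
      * tcov4 P.D3 P.christoffelB P.dB k (tang l) b (tang i) d
      = ∑ j, ∑ m, P.ellUpB j m * covD2 P.D3 P.christoffel3 P.d2B m i j := by
  have hd2 : (fun l i => ∑ b, P.NB b * ∑ d, P.NB d * P.dB (tang l) b (tang i) d) = P.d2B :=
    funext fun l => funext fun i => P.sum_N_N_d l i
  have h1 : ∑ e, P.NB e * ∑ b, P.NB b * ∑ d, P.NB d * P.dB e b (tang i) d = 0 :=
    sum_sum_skew fun e b => by
      rw [← Finset.sum_neg_distrib]
      exact Finset.sum_congr rfl fun d _ => by rw [P.dB_skew_left]; ring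
  have h2 : ∀ l, ∑ e, P.NB e * ∑ b, P.NB b * ∑ d, P.NB d * P.dB (tang l) b e d = 0 := by
    intro l
    have h3 : ∑ e, P.NB e * ∑ b, P.NB b * ∑ d, P.NB d * P.dB (tang l) b e d
        = ∑ b, P.NB b * ∑ e, P.NB e * ∑ d, P.NB d * P.dB (tang l) b e d := by
      simp only [Finset.mul_sum]
      rw [Finset.sum_comm]
      exact Finset.sum_congr rfl fun b _ => Finset.sum_congr rfl fun e _ =>
        Finset.sum_congr rfl fun d _ => by ring
    rw [h3]
    exact Finset.sum_eq_zero fun b _ => by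
      rw [sum_sum_skew fun e d => P.dB_skew_right _ _ e d, mul_zero]
  have h4 : ∑ k, ∑ l, P.ellUpB k l * ∑ d, P.NB d * P.dB (tang l) (tang k) (tang i) d = 0 :=
    sum_symm_mul_skew P.levi_bdry.H_swap fun k l => by
      rw [← Finset.sum_neg_distrib]
      exact Finset.sum_congr rfl fun d _ => by rw [P.dB_skew_left]; ring
  have h5 : ∑ k, ∑ l, P.ellUpB k l * ∑ b, P.NB b * ∑ d, P.NB d
      * tcov4 P.D3 P.christoffelB P.dB k (tang l) b (tang i) d
      = ∑ k, ∑ l, P.ellUpB k l * covD2 P.D3 P.christoffel3 P.d2B k l i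
        - P.kappaB * (∑ k, ∑ l, P.ellUpB k l
          * ∑ d, P.NB d * P.dB (tang l) (tang k) (tang i) d)
        - P.kappaB * ∑ k, ∑ l, P.ellUpB k l
          * ∑ b, P.NB b * P.dB (tang l) b (tang i) (tang k) := by
    rw [Finset.mul_sum, Finset.mul_sum, ← Finset.sum_sub_distrib, ← Finset.sum_sub_distrib]
    refine Finset.sum_congr rfl fun k _ => ?_
    rw [Finset.mul_sum, Finset.mul_sum, ← Finset.sum_sub_distrib, ← Finset.sum_sub_distrib]
    refine Finset.sum_congr rfl fun l _ => ?_
    rw [P.umbilicBoundary.tcov4_normal_normal, hd2, h1, h2]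
    ring
  rw [h5, h4, P.trace_d3, mul_zero, sub_zero, sub_zero, Finset.sum_comm]
  exact Finset.sum_congr rfl fun k _ => Finset.sum_congr rfl fun l _ => by
    rw [P.levi_bdry.H_swap, covD2_symm _ _ P.d2B_symm]

/-- The divergence `D^j d_{ij} = -Σ j_i` compensates the rescaled Cotton tensor. -/
theorem sum_lambda_normal_normal (P : BoundaryProblem F X) (z : X.dom) (i : Fin 3) :
    ∑ b, F.nUp (bdryPoint z) b * ∑ d, F.nUp (bdryPoint z) d
      * F.Lambda (bdryPoint z) b (tang i) d = 0 := by
  have h := congrArg (evalAt z) (P.sum_div_d_normal_normal i)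
  rw [P.div_d2] at h
  simp only [map_sum, map_mul, P.NB_eval, ← P.ellUpB_eval, ← P.cov4_d_tang] at h
  have h1 : ∑ b, F.nUp (bdryPoint z) b * ∑ d, F.nUp (bdryPoint z) d
        * ∑ e, ∑ f, F.gUp (bdryPoint z) e f * cov4 F.dom F.g F.d (bdryPoint z) e f b (tang i) d
      = ∑ d, F.nUp (bdryPoint z) d * ∑ b, F.nUp (bdryPoint z) b
        * ∑ e, ∑ f, F.gUp (bdryPoint z) e f
          * cov4 F.dom F.g F.d (bdryPoint z) e f b (tang i) d := by
    simp only [Finset.mul_sum]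
    rw [Finset.sum_comm]
    exact Finset.sum_congr rfl fun b _ => Finset.sum_congr rfl fun d _ =>
      Finset.sum_congr rfl fun e _ => Finset.sum_congr rfl fun f _ => by ring
  have h2 : ∑ d, F.nUp (bdryPoint z) d * ∑ k, ∑ l, X.ellUp z k l * ∑ b, F.nUp (bdryPoint z) b
        * cov4 F.dom F.g F.d (bdryPoint z) (tang k) (tang l) b (tang i) d
      = ∑ k, ∑ l, X.ellUp z k l * ∑ b, F.nUp (bdryPoint z) b * ∑ d, F.nUp (bdryPoint z) d
        * cov4 F.dom F.g F.d (bdryPoint z) (tang k) (tang l) b (tang i) d := by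
    simp only [Finset.mul_sum]
    rw [Finset.sum_comm]
    refine Finset.sum_congr rfl fun k _ => ?_
    rw [Finset.sum_comm]
    refine Finset.sum_congr rfl fun l _ => ?_
    rw [Finset.sum_comm]
    exact Finset.sum_congr rfl fun b _ => Finset.sum_congr rfl fun d _ => by ring
  simp only [BulkComponents.Lambda, mul_sub, Finset.sum_sub_distrib, P.sum_cotton_normal_normal,
    h1, P.sum_nUp_div_d, h2, h]
  ring

/-! ### The zero-quantity `P` -/

/-- Curvature components with tangential form indices are determined at the boundary. -/
theorem riemann_tang (P : BoundaryProblem F X) (z : X.dom) (a b : Fin 4) (k l : Fin 3) :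
    riemann F.dom F.g (bdryPoint z) a b (tang k) (tang l)
      = evalAt z (curv P.D3 (fun i => P.christoffelB (tang i)) k l a b) := by
  have h : P.res (curv P.D4 P.christoffel4 (tang k) (tang l) a b)
      = curv P.D3 (fun i => P.christoffelB (tang i)) k l a b := by
    simp only [curv, Matrix.add_apply, Matrix.sub_apply, dM_apply, Matrix.mul_apply, map_add,
      map_sub, map_sum, map_mul, P.res_D]
    rfl
  rw [riemann_eval P.regular_bulk P.bulk.smooth_g P.det_bulk ⟨bdryPoint z, P.maps z z.2⟩, ← h,
    P.evalAt_res]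
  rfl

/-- The boundary is three-dimensional, so that its curvature is given by its Schouten tensor. -/
theorem riemLow_eq_schB (P : BoundaryProblem F X) (z : X.dom) (i j k l : Fin 3) :
    evalAt z (riemLow P.D3 P.ellB P.christoffel3 i j k l)
      = X.ell z i k * X.schouten z j l - X.ell z i l * X.schouten z j k
        + X.schouten z i k * X.ell z j l - X.schouten z i l * X.ell z j k := by
  have hs : ∀ i j, X.schouten z i j = evalAt z (ric P.D3 P.christoffel3 i j)
      - 1 / 4 * evalAt z (scal P.D3 P.ellUpB P.christoffel3) * X.ell z i j := fun i j => by
    rw [P.schB_eval, schB, sch, map_sub, map_mul, map_mul, AlgHom.commutes]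
    rfl
  have h := P.levi_bdry
  simp only [hs]
  refine riemann_eq_schouten_of_dim_three (G := P.ellB.map (evalAt z))
    (H := P.ellUpB.map (evalAt z)) (fun a b => congrArg (evalAt z) (h.G_swap a b)) ?_
    (A := fun i j k l => evalAt z (riemLow P.D3 P.ellB P.christoffel3 i j k l))
    (fun a b c d => ?_) (fun a b c d => ?_) (fun a b c d => ?_)
    (fun i j => evalAt z (ric P.D3 P.christoffel3 i j)) (fun b d => ?_)
    (evalAt z (scal P.D3 P.ellUpB P.christoffel3)) ?_ i j k l
  · rw [← Matrix.map_mul, h.mul_inv]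
    simp
  · rw [h.riemLow_skew_left, map_neg]
  · rw [riemLow_skew_right, map_neg]
  · rw [h.riemLow_pair]
  · rw [← h.sum_riemLow, map_sum]
    simp only [map_sum, map_mul, Matrix.map_apply]
  · simp only [scal, map_sum, map_mul, Matrix.map_apply]

/-- The Gauss equation: the terms with `ϰ²` cancel between the extrinsic curvature and `L_{ij}`. -/
theorem Pq_tang (P : BoundaryProblem F X) (z : X.dom) (i j k l : Fin 3) :
    F.Pq (bdryPoint z) (tang i) (tang j) (tang k) (tang l) = 0 := by
  have h := congrArg (evalAt z) (P.umbilicBoundary.gauss i j k l)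
  rw [map_sub, P.riemLow_eq_schB] at h
  simp only [map_sum, map_mul, map_sub, map_pow, P.gB_eval, ← P.riemann_tang] at h
  have hl : ∀ i j, evalAt z (P.ellB i j) = X.ell z i j := fun _ _ => rfl
  have hk : evalAt z P.kappaB = X.kappa z := rfl
  have hs : ∀ i j, X.ell z i j = X.ell z j i := (P.bdry.lorentzian z z.2).symm
  have hS : ∀ i j, X.schouten z i j = X.schouten z j i := fun i j => by
    rw [P.schB_eval, P.schB_eval, schB, P.levi_bdry.sch_symm]
  rw [BulkComponents.Pq, h, P.values.Xi_eq z z.2]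
  simp only [P.values.ell_eq z z.2, P.values.L2_eq z z.2, hl, hk, BoundaryComponents.L2]
  rw [hs l j, hs k j, hS l j, hS k j]
  ring

/-- The Codazzi equation: `L_i = -D_i ϰ` balances the derivative of the extrinsic curvature. -/
theorem sum_Pq_normal (P : BoundaryProblem F X) (z : X.dom) (i j k : Fin 3) :
    ∑ d, F.nUp (bdryPoint z) d * F.Pq (bdryPoint z) (tang i) d (tang j) (tang k) = 0 := by
  have h := congrArg (evalAt z) (P.umbilicBoundary.codazzi i j k)
  simp only [map_sum, map_mul, map_sub, P.gB_eval, P.NB_eval, ← P.riemann_tang] at h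
  have hL : ∀ j, ∑ d, F.nUp (bdryPoint z) d * F.L (bdryPoint z) (tang j) d
      = -evalAt z (P.D3 j P.kappaB) := by
    intro j
    rw [← map_neg, ← P.sum_N_L, map_sum]
    exact Finset.sum_congr rfl fun d _ => by
      rw [map_mul, P.NB_eval, P.LB_eval, P.bulk.L_symm _ (P.maps z z.2)]
  have hg : ∀ j, ∑ d, F.nUp (bdryPoint z) d * F.g (bdryPoint z) (tang j) d = 0 := by
    intro j
    rw [← nLow_tang (F := F) (bdryPoint z) j, ← P.sum_nUp_g]
    exact Finset.sum_congr rfl fun d _ => by rw [P.g_symm]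
  have hl : ∀ i j, evalAt z (P.ellB i j) = F.g (bdryPoint z) (tang i) (tang j) := fun i j =>
    (P.values.ell_eq z z.2 i j).symm
  have h1 : ∀ d, F.nUp (bdryPoint z) d * F.Pq (bdryPoint z) (tang i) d (tang j) (tang k)
      = F.nUp (bdryPoint z) d * ∑ e, F.g (bdryPoint z) (tang i) e
          * riemann F.dom F.g (bdryPoint z) e d (tang j) (tang k)
        - F.g (bdryPoint z) (tang i) (tang j)
          * (F.nUp (bdryPoint z) d * F.L (bdryPoint z) (tang k) d)
        + F.g (bdryPoint z) (tang i) (tang k)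
          * (F.nUp (bdryPoint z) d * F.L (bdryPoint z) (tang j) d)
        - F.L (bdryPoint z) (tang i) (tang j)
          * (F.nUp (bdryPoint z) d * F.g (bdryPoint z) (tang k) d)
        + F.L (bdryPoint z) (tang i) (tang k)
          * (F.nUp (bdryPoint z) d * F.g (bdryPoint z) (tang j) d) := by
    intro d
    rw [BulkComponents.Pq, P.values.Xi_eq z z.2]
    ring
  simp only [h1, Finset.sum_add_distrib, Finset.sum_sub_distrib, ← Finset.mul_sum, h, hL, hg, hl]
  rw [P.g_symm z (tang k), P.g_symm z (tang j)]
  ring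

/-! ### Contractions with the projector -/

/-- The projector annihilates `dx¹`, so that only tangential components enter its contractions. -/
theorem proj_one (P : BoundaryProblem F X) (z : X.dom) (b : Fin 4) :
    F.proj (bdryPoint z) b 1 = 0 := by
  have h := P.sum_nUp_nLow z
  rw [sum_eq_normal_add_tang] at h
  simp only [nLow_tang, mul_zero, Finset.sum_const_zero, add_zero] at h
  rw [BulkComponents.proj]
  rcases eq_one_or_tang b with rfl | ⟨i, rfl⟩
  · rw [delta, if_pos rfl]
    linarith
  · rw [nLow_tang, delta, if_neg (tang_ne_one i)]
    ring

theorem sum_proj_eq_zero (P : BoundaryProblem F X) (z : X.dom) (b : Fin 4) {f : Fin 4 → ℝ}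
    (hf : ∀ i, f (tang i) = 0) : ∑ a, F.proj (bdryPoint z) b a * f a = 0 := by
  rw [sum_eq_normal_add_tang, P.proj_one]
  simp [hf]

end BoundaryProblem

end
end ConformalBoundary

namespace ConformalBoundary

noncomputable section

/-! ### Coordinate domains of charts of the surface -/

section Chart

variable {B : Type*} [TopologicalSpace B] [ChartedSpace (EuclideanSpace ℝ (Fin 2)) B]
  (e : OpenPartialHomeomorph B (EuclideanSpace ℝ (Fin 2)))

theorem continuous_pair {n : ℕ} (a b : Fin n) :
    Continuous fun y : Fin n → ℝ => (!₂[y a, y b] : EuclideanSpace ℝ (Fin 2)) :=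
  (PiLp.continuous_toLp 2 _).comp (continuous_pi fun i => by
    fin_cases i <;> exact continuous_apply _)

theorem isRegularDomain_boundary (X : BoundaryFields B) (lam : ℝ) :
    IsRegularDomain (X.inChart e lam).dom := by
  have h1 : (X.inChart e lam).dom
      = {z : Fin 3 → ℝ | 0 ≤ z 0} ∩ {z | z 0 < X.tEnd ∧ !₂[z 1, z 2] ∈ e.target} := rfl
  rw [h1]
  refine IsRegularDomain.convex_inter_open ?_ ⟨fun _ => 1, ?_⟩ ?_
  · exact convex_halfSpace_ge (LinearMap.proj (R := ℝ) (φ := fun _ : Fin 3 => ℝ) 0).isLinear 0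
  · refine mem_interior.2 ⟨{z | 0 < z 0}, fun z (hz : 0 < z 0) => hz.le,
      isOpen_lt continuous_const (continuous_apply 0), ?_⟩
    exact zero_lt_one' ℝ
  · exact (isOpen_lt (continuous_apply 0) continuous_const).inter
      (e.open_target.preimage (continuous_pair 1 2))

theorem isRegularDomain_bulk (F : BulkFields B) (hF : IsOpen F.region) (lam : ℝ) :
    IsRegularDomain (F.inChart e lam).dom := by
  have h1 : (F.inChart e lam).dom = {y : Fin 4 → ℝ | 0 ≤ y 0 ∧ 0 ≤ y 1}
      ∩ ({y | !₂[y 2, y 3] ∈ e.target} ∩ bulkPt e ⁻¹' F.region) := by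
    ext y
    exact (and_assoc (a := 0 ≤ y 0)).symm
  rw [h1]
  refine IsRegularDomain.convex_inter_open ?_ ⟨fun _ => 1, ?_⟩ ?_
  · have h2 : ∀ a : Fin 4, Convex ℝ {y : Fin 4 → ℝ | 0 ≤ y a} := fun a =>
      convex_halfSpace_ge (LinearMap.proj (R := ℝ) (φ := fun _ : Fin 4 => ℝ) a).isLinear 0
    exact (h2 0).inter (h2 1)
  · refine mem_interior.2 ⟨{y | 0 < y 0 ∧ 0 < y 1}, fun y hy => ⟨hy.1.le, hy.2.le⟩,
      (isOpen_lt continuous_const (continuous_apply 0)).inter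
        (isOpen_lt continuous_const (continuous_apply 1)), ?_⟩
    exact ⟨zero_lt_one' ℝ, zero_lt_one' ℝ⟩
  · have h3 : ContinuousOn (bulkPt e) {y | !₂[y 2, y 3] ∈ e.target} :=
      (continuous_apply 0).continuousOn.prodMk ((continuous_apply 1).continuousOn.prodMk
        (e.continuousOn_symm.comp (continuous_pair 2 3).continuousOn fun _ hy => hy))
    exact h3.isOpen_inter_preimage (e.open_target.preimage (continuous_pair 2 3)) hF

/-- The fields in a chart of the surface satisfy the hypotheses of the local analysis. -/
theorem boundaryProblem_inChart (lam : ℝ) (hlam : lam < 0) (X : BoundaryFields B)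
    (F : BulkFields B) (hcollar : F.IsCollarOf X) (hX : (X.inChart e lam).IsAdmissible)
    (hF : (F.inChart e lam).IsAdmissible)
    (hFX : HasBoundaryValues (F.inChart e lam) (X.inChart e lam)) :
    BoundaryProblem (F.inChart e lam) (X.inChart e lam) where
  regular_bulk := isRegularDomain_bulk e F hcollar.1 lam
  regular_bdry := isRegularDomain_boundary e X lam
  maps _ hz := ⟨hz.1, le_rfl, hz.2.2, hcollar.2 _ _ hz.1 hz.2.1⟩
  bulk := hF
  bdry := hX
  values := hFX
  lam_eq := rfl
  lam_neg := hlam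

end Chart

end
end ConformalBoundary

theorem mainTheorem2
    {B : Type*} [TopologicalSpace B] [ChartedSpace (EuclideanSpace ℝ (Fin 2)) B]
    [IsManifold (𝓡 2) ∞ B]
    (lam : ℝ) (hlam : lam < 0)
    (X : ConformalBoundary.BoundaryFields B) (htEnd : 0 < X.tEnd)
    (F : ConformalBoundary.BulkFields B) (hcollar : F.IsCollarOf X)
    (hX : ∀ e ∈ IsManifold.maximalAtlas (𝓡 2) ∞ B, (X.inChart e lam).IsAdmissible)
    (hF : ∀ e ∈ IsManifold.maximalAtlas (𝓡 2) ∞ B, (F.inChart e lam).IsAdmissible)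
    (hFX : ∀ e ∈ IsManifold.maximalAtlas (𝓡 2) ∞ B,
      ConformalBoundary.HasBoundaryValues (F.inChart e lam) (X.inChart e lam)) :
    ∀ e ∈ IsManifold.maximalAtlas (𝓡 2) ∞ B, ∀ z ∈ (X.inChart e lam).dom,
      let C := F.inChart e lam
      let y := ConformalBoundary.bdryPoint z
      let n := C.nUp y
      let ℓ := C.proj y
      -- `ℓ_b^a Θ_a = 0` and `Z = 0`
      (∀ b, ∑ a, ℓ b a * C.Theta y a = 0) ∧
      C.Zq y = 0 ∧
      -- `ℓ_c^a ℓ_d^b Υ_{ab} = 0` and `n^a ℓ_c^b Υ_{ab} = 0`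
      (∀ c d, ∑ a, ∑ b, ℓ c a * ℓ d b * C.Upsilon y a b = 0) ∧
      (∀ c, ∑ a, ∑ b, n a * ℓ c b * C.Upsilon y a b = 0) ∧
      -- `ℓ_e^c ℓ_f^d ℓ_g^b Δ_{cdb} = 0` and `n^b ℓ_e^c ℓ_f^d Δ_{cdb} = 0`
      (∀ e f g, ∑ c, ∑ d, ∑ b, ℓ e c * ℓ f d * ℓ g b * C.Delta y c d b = 0) ∧
      (∀ e f, ∑ c, ∑ d, ∑ b, n b * ℓ e c * ℓ f d * C.Delta y c d b = 0) ∧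
      -- `n^b ℓ_e^c ℓ_f^d Λ_{bcd} = 0` and `n^b n^d ℓ_e^c Λ_{bcd} = 0`
      (∀ e f, ∑ b, ∑ c, ∑ d, n b * ℓ e c * ℓ f d * C.Lambda y b c d = 0) ∧
      (∀ e, ∑ b, ∑ c, ∑ d, n b * n d * ℓ e c * C.Lambda y b c d = 0) ∧
      -- `ℓ_a^e ℓ_b^f ℓ_c^g ℓ_d^h P_{efgh} = 0` and `n^d ℓ_a^e ℓ_b^f ℓ_c^g P_{edfg} = 0`
      (∀ a b c d, ∑ e, ∑ f, ∑ g, ∑ h,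
        ℓ a e * ℓ b f * ℓ c g * ℓ d h * C.Pq y e f g h = 0) ∧
      (∀ a b c, ∑ e, ∑ d, ∑ f, ∑ g,
        n d * ℓ a e * ℓ b f * ℓ c g * C.Pq y e d f g = 0) := by
  intro e he z hz C y n ℓ
  have P := ConformalBoundary.boundaryProblem_inChart e lam hlam X F hcollar (hX e he) (hF e he)
    (hFX e he)
  let z' : (X.inChart e lam).dom := ⟨z, hz⟩
  have hℓ : ∀ (b : Fin 4) {f : Fin 4 → ℝ}, (∀ i, f (ConformalBoundary.tang i) = 0) →
      ∑ a, ℓ b a * f a = 0 := fun b _ hf => P.sum_proj_eq_zero z' b hf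
  -- every contraction is rewritten so that the normals are innermost
  refine ⟨fun b => hℓ b (P.theta_tang z'), P.Zq_eq_zero z', fun c d => ?_, fun c => ?_,
    fun c d b => ?_, fun c d => ?_, fun c d => ?_, fun c => ?_, fun a b c d => ?_, fun a b c => ?_⟩
  · have h : ∑ a, ℓ c a * ∑ b, ℓ d b * C.Upsilon y a b = 0 :=
      hℓ c fun i => hℓ d fun j => P.upsilon_tang z' i j
    simpa only [Finset.mul_sum, mul_assoc] using h
  · have h : ∑ b, ℓ c b * ∑ a, n a * C.Upsilon y a b = 0 :=
      hℓ c fun j => P.sum_upsilon_normal z' j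
    rw [← h, Finset.sum_comm]
    simp only [Finset.mul_sum]
    exact Finset.sum_congr rfl fun b _ => Finset.sum_congr rfl fun a _ => by ring
  · have h : ∑ p, ℓ c p * ∑ q, ℓ d q * ∑ r, ℓ b r * C.Delta y p q r = 0 :=
      hℓ c fun i => hℓ d fun j => hℓ b fun k => P.delta_tang z' i j k
    simpa only [Finset.mul_sum, mul_assoc] using h
  · have h : ∑ p, ℓ c p * ∑ q, ℓ d q * ∑ b, n b * C.Delta y p q b = 0 :=
      hℓ c fun i => hℓ d fun j => P.sum_delta_normal z' i j
    rw [← h]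
    simp only [Finset.mul_sum]
    exact Finset.sum_congr rfl fun p _ => Finset.sum_congr rfl fun q _ =>
      Finset.sum_congr rfl fun b _ => by ring
  · have h : ∑ p, ℓ c p * ∑ q, ℓ d q * ∑ b, n b * C.Lambda y b p q = 0 :=
      hℓ c fun i => hℓ d fun j => P.sum_lambda_normal z' i j
    rw [← h, Finset.sum_comm]
    simp only [Finset.mul_sum]
    refine Finset.sum_congr rfl fun p _ => ?_
    rw [Finset.sum_comm]
    exact Finset.sum_congr rfl fun q _ => Finset.sum_congr rfl fun b _ => by ring
  · have h : ∑ p, ℓ c p * ∑ b, n b * ∑ d, n d * C.Lambda y b p d = 0 :=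
      hℓ c fun i => P.sum_lambda_normal_normal z' i
    rw [← h, Finset.sum_comm]
    simp only [Finset.mul_sum]
    exact Finset.sum_congr rfl fun p _ => Finset.sum_congr rfl fun b _ =>
      Finset.sum_congr rfl fun d _ => by ring
  · have h : ∑ p, ℓ a p * ∑ q, ℓ b q * ∑ r, ℓ c r * ∑ s, ℓ d s * C.Pq y p q r s = 0 :=
      hℓ a fun i => hℓ b fun j => hℓ c fun k => hℓ d fun l => P.Pq_tang z' i j k l
    simpa only [Finset.mul_sum, mul_assoc] using h
  · have h : ∑ p, ℓ a p * ∑ q, ℓ b q * ∑ r, ℓ c r * ∑ d, n d * C.Pq y p d q r = 0 :=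
      hℓ a fun i => hℓ b fun j => hℓ c fun k => P.sum_Pq_normal z' i j k
    rw [← h]
    simp only [Finset.mul_sum]
    refine Finset.sum_congr rfl fun p _ => ?_
    rw [Finset.sum_comm]
    refine Finset.sum_congr rfl fun q _ => ?_
    rw [Finset.sum_comm]
    exact Finset.sum_congr rfl fun r _ => Finset.sum_congr rfl fun d _ => by ring
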